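/- All manifolds, maps and forms are smooth. A para-CR structure of type $(1,2,3)$ on a 6-manifold $M$ is a class of coframes $(\lambda,\nu_1,\nu_2,\nu_3,\mu_1,\mu_2)$ such that the annihilator of $(\lambda,\mu_1,\mu_2)$ and the annihilator of $(\lambda,\nu_1,\nu_2,\nu_3)$ are integrable, coframes being equivalent if they differ by a function with values in the group $G_0$ of the invertible matrices $$\begin{pmatrix} a&0&0&0&0&0\\ b_1&f_{11}&f_{12}&f_{13}&0&0\\ b_2&f_{21}&f_{22}&f_{23}&0&0\\ b_3&f_{31}&f_{32}&f_{33}&0&0\\ c_1&0&0&0&h_{11}&h_{12}\\ c_2&0&0&0&h_{21}&h_{22}\end{pmatrix}.$$ Two such structures are locally equivalent if near every point of the first there is a diffeomorphism onto an open subset of the second which pulls the forms of the second back to forms in the class of the first. The flat structure is the one on $\mathbb{R}^6\ni(x,y,a_0,a_1,a_2,a_3)$ given by $$\lambda=da_0+x\,da_1+y\,da_2+xy\,da_3,\quad \nu_i=da_i,\quad \mu_1=dx,\quad \mu_2=dy,$$ which comes from the general solution $z=a_0+a_1x+a_2y+a_3xy$ of $z_{xx}=0=z_{yy}$. Let $P$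 be an 11-manifold with a map $(\pi,G):P\to M\times G_0$. Its lifted forms are $(\theta^4,\theta^1,\theta^2,\theta^3,\Omega_3,\Omega_2)^T=G\cdot\pi^*(\lambda,\nu_1,\nu_2,\nu_3,\mu_1,\mu_2)^T$. A completion consists of five 1-forms $(\Omega_1,\Omega_4,\Omega_5,\Omega_6,A)$ on $P$ such that $(\theta^i,\Omega_\mu,A)$, $1\le i\le4$, $1\le\mu\le6$, is a coframe on $P$ and $$d\theta^i+\Gamma^i{}_j\wedge\theta^j=0,\qquad d\Gamma^i{}_j+\Gamma^i{}_k\wedge\Gamma^k{}_j=0,$$ where $\Gamma^i{}_j=g^{ik}\Gamma_{kj}$, $\Gamma_{ij}=\Gamma_{[ij]}+\tfrac12A\,g_{ij}$, $$g^{ij}=g_{ij}=\begin{pmatrix}0&1&0&0\\1&0&0&0\\0&0&0&1\\0&0&1&0\end{pmatrix},\qquad \Gamma_{[ij]}=\begin{pmatrix}0&\Omega_1&\Omega_2&\Omega_4\\-\Omega_1&0&\Omega_3&\Omega_5\\-\Omega_2&-\Omega_3&0&\Omega_6\\-\Omega_4&-\Omega_5&-\Omega_6&0\end{pmatrix}.$$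 **Theorem.** (1) For the flat structure there is an 11-dimensional submanifold $P\subset\mathbb{R}^6\times G_0$, projecting onto $\mathbb{R}^6$, whose lifted forms have a completion, and this completion is unique. This $P$ is the maximal one, and is therefore unique: for every 11-manifold $Q$ with a map $Q\to\mathbb{R}^6\times G_0$ and a completion, there is a unique map $F:Q\to P$ commuting with the maps to $\mathbb{R}^6\times G_0$, and $F$ is a local diffeomorphism which pulls the completion on $P$ back to the one on $Q$. (2) A para-CR structure of type $(1,2,3)$ on a 6-manifold $M$ is locally equivalent to the flat one if and only if there are an 11-manifold $\bar P$ and a map $\bar P\to M\times G_0$, with $\bar P\to M$ surjective, whose lifted forms have a completion. -/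

import Mathlib

open scoped Manifold ContDiff

noncomputable section

namespace ParaCR

/-! ### Differential forms of degree one and two on a smooth manifold -/

section Forms

variable {m n : ℕ}
  {M : Type*} [TopologicalSpace M] [ChartedSpace (EuclideanSpace ℝ (Fin n)) M]
  {N : Type*} [TopologicalSpace N] [ChartedSpace (EuclideanSpace ℝ (Fin m)) N]

/-- A (not necessarily smooth) 1-form on an `n`-dimensional manifold. -/
abbrev OneForm (n : ℕ) (M : Type*) [TopologicalSpace M]
    [ChartedSpace (EuclideanSpace ℝ (Fin n)) M] : Type _ :=
  (p : M) → TangentSpace (𝓡 n) p →L[ℝ] ℝ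

/-- A 2-form, given by its values on pairs of tangent vectors. -/
abbrev TwoForm (n : ℕ) (M : Type*) [TopologicalSpace M]
    [ChartedSpace (EuclideanSpace ℝ (Fin n)) M] : Type _ :=
  (p : M) → TangentSpace (𝓡 n) p → TangentSpace (𝓡 n) p → ℝ

/-- The expression of a 1-form in a chart `e`: the pullback of the form under `e⁻¹`. -/
def inChart (η : OneForm n M) (e : OpenPartialHomeomorph M (EuclideanSpace ℝ (Fin n))) :
    EuclideanSpace ℝ (Fin n) → (EuclideanSpace ℝ (Fin n) →L[ℝ] ℝ) :=
  fun u => (η (e.symm u)).comp (mfderiv (𝓡 n) (𝓡 n) e.symm u)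

/-- A 1-form is smooth if its expressions in all charts of the atlas are smooth. -/
def IsSmooth (η : OneForm n M) : Prop :=
  ∀ e ∈ atlas (EuclideanSpace ℝ (Fin n)) M, ContDiffOn ℝ ∞ (inChart η e) e.target

/-- The exterior derivative of a 1-form, `dη(v,w) = D_v η(w) - D_w η(v)`, computed at `p` in the
preferred chart at `p` (through which `TangentSpace (𝓡 n) p` is identified with `ℝⁿ`). -/
def extD (η : OneForm n M) : TwoForm n M := fun p v w =>
  let e := chartAt (EuclideanSpace ℝ (Fin n)) p
  let D : EuclideanSpace ℝ (Fin n) →L[ℝ] (EuclideanSpace ℝ (Fin n) →L[ℝ] ℝ) :=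
    fderiv ℝ (inChart η e) (e p)
  D v w - D w v

/-- The wedge product of two 1-forms. -/
def wedge (α β : OneForm n M) : TwoForm n M := fun p v w =>
  α p v * β p w - α p w * β p v

/-- The pullback `F^* η` of a 1-form. -/
def pullback (F : M → N) (η : OneForm m N) : OneForm n M := fun p =>
  (η (F p)).comp (mfderiv (𝓡 n) (𝓡 m) F p)

end Forms

/-! ### Para-CR structures of type `(1,2,3)` -/

/-- The `6 × 6` matrices by which the forms `(λ, ν₁, ν₂, ν₃, μ₁, μ₂)` of a para-CR structure of
type `(1,2,3)` may be transformed: the invertible matrices of the shape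
`a 0 0 0 0 0 / b₁ f₁₁ f₁₂ f₁₃ 0 0 / b₂ f₂₁ f₂₂ f₂₃ 0 0 / b₃ f₃₁ f₃₂ f₃₃ 0 0 /
c₁ 0 0 0 h₁₁ h₁₂ / c₂ 0 0 0 h₂₁ h₂₂`. -/
def IsParaCRMatrix (G : Matrix (Fin 6) (Fin 6) ℝ) : Prop :=
  (∃ a b₁ b₂ b₃ c₁ c₂ f₁₁ f₁₂ f₁₃ f₂₁ f₂₂ f₂₃ f₃₁ f₃₂ f₃₃ h₁₁ h₁₂ h₂₁ h₂₂ : ℝ,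
    G = !![a,  0,   0,   0,   0,   0;
           b₁, f₁₁, f₁₂, f₁₃, 0,   0;
           b₂, f₂₁, f₂₂, f₂₃, 0,   0;
           b₃, f₃₁, f₃₂, f₃₃, 0,   0;
           c₁, 0,   0,   0,   h₁₁, h₁₂;
           c₂, 0,   0,   0,   h₂₁, h₂₂]) ∧
  G.det ≠ 0

/-- An (integrable, smooth) para-CR structure of type `(1,2,3)` on a 6-dimensional manifold, given
by a representative `form = (λ, ν₁, ν₂, ν₃, μ₁, μ₂)` of its class of coframes; two coframes define
the same structure iff they differ by a function with values in `IsParaCRMatrix`, and everything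
below depends on the class only. The last two fields are the Frobenius conditions that the
annihilator `H⁻` of `(λ, μ₁, μ₂)` and the annihilator `H⁺` of `(λ, ν₁, ν₂, ν₃)` are integrable:
`dη ∧ λ ∧ μ₁ ∧ μ₂ = 0` for `η = λ, μ₁, μ₂`, and
`dη ∧ λ ∧ ν₁ ∧ ν₂ ∧ ν₃ = 0` for `η = λ, ν₁, ν₂, ν₃`, that is, `dη` vanishes on the annihilator. -/
structure Structure123 (M : Type*) [TopologicalSpace M]
    [ChartedSpace (EuclideanSpace ℝ (Fin 6)) M] where
  form : Fin 6 → OneForm 6 M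
  smooth : ∀ i, IsSmooth (form i)
  indep : ∀ p : M, LinearIndependent ℝ (fun i => form i p)
  integrable_minus : ∀ i ∈ ({0, 4, 5} : Set (Fin 6)), ∀ (p : M) (v w : TangentSpace (𝓡 6) p),
    (∀ j ∈ ({0, 4, 5} : Set (Fin 6)), form j p v = 0 ∧ form j p w = 0) → extD (form i) p v w = 0
  integrable_plus : ∀ i ∈ ({0, 1, 2, 3} : Set (Fin 6)), ∀ (p : M) (v w : TangentSpace (𝓡 6) p),
    (∀ j ∈ ({0, 1, 2, 3} : Set (Fin 6)), form j p v = 0 ∧ form j p w = 0) →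
      extD (form i) p v w = 0

/-- Local para-CR equivalence of `S` to `S'`: near every point of `M` there is a diffeomorphism
`Φ` onto an open subset of `M'` such that `Φ^*` of the forms of `S'` are obtained from the forms of
`S` by a para-CR transformation. -/
def Structure123.LocallyEquivalent
    {M : Type*} [TopologicalSpace M] [ChartedSpace (EuclideanSpace ℝ (Fin 6)) M]
    {M' : Type*} [TopologicalSpace M'] [ChartedSpace (EuclideanSpace ℝ (Fin 6)) M']
    (S : Structure123 M) (S' : Structure123 M') : Prop :=
  ∀ p : M, ∃ Φ : OpenPartialHomeomorph M M', p ∈ Φ.source ∧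
    ContMDiffOn (𝓡 6) (𝓡 6) ∞ Φ Φ.source ∧ ContMDiffOn (𝓡 6) (𝓡 6) ∞ Φ.symm Φ.target ∧
    ∀ x ∈ Φ.source, ∃ G : Matrix (Fin 6) (Fin 6) ℝ, IsParaCRMatrix G ∧
      ∀ i, pullback Φ (S'.form i) x = ∑ j, G i j • S.form j x

/-! ### The flat model -/

/-- The coordinate 1-form `du_i` at a point of `ℝ⁶`. -/
def coord (i : Fin 6) : EuclideanSpace ℝ (Fin 6) →L[ℝ] ℝ := EuclideanSpace.proj i

/-- The forms `(λ, ν₁, ν₂, ν₃, μ₁, μ₂)` on the solution hypersurface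
`z = a₀ + a₁ x + a₂ y + a₃ x y` of `z_xx = 0 = z_yy`, in the coordinates
`u = (x, y, a₀, a₁, a₂, a₃)`:
`λ = da₀ + x da₁ + y da₂ + x y da₃`, `ν_i = da_i`, `μ₁ = dx`, `μ₂ = dy`. -/
def flatForm : Fin 6 → OneForm 6 (EuclideanSpace ℝ (Fin 6)) :=
  ![fun u => coord 2 + u 0 • coord 3 + u 1 • coord 4 + (u 0 * u 1) • coord 5,
    fun _ => coord 3, fun _ => coord 4, fun _ => coord 5, fun _ => coord 0, fun _ => coord 1]

theorem inChart_model {n : ℕ} (η : OneForm n (EuclideanSpace ℝ (Fin n))) :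
    inChart η (OpenPartialHomeomorph.refl _) = η := by
  funext u
  ext v
  simp [inChart]
  rfl

theorem extD_model {n : ℕ}
    (η : EuclideanSpace ℝ (Fin n) → (EuclideanSpace ℝ (Fin n) →L[ℝ] ℝ))
    (p v w : EuclideanSpace ℝ (Fin n)) :
    extD (n := n) (M := EuclideanSpace ℝ (Fin n)) η p v w
      = (fderiv ℝ η p v) w - (fderiv ℝ η p w) v := by
  simp only [extD, chartAt_self_eq]
  rw [inChart_model (n := n) η]
  rfl

theorem flatForm_smooth (i : Fin 6) : IsSmooth (flatForm i) := by
  intro e he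
  rw [chartedSpaceSelf_atlas] at he
  subst he
  rw [inChart_model]
  apply ContDiff.contDiffOn
  fin_cases i
  · change ContDiff ℝ ∞ (fun u : EuclideanSpace ℝ (Fin 6) =>
      coord 2 + u 0 • coord 3 + u 1 • coord 4 + (u 0 * u 1) • coord 5)
    fun_prop
  all_goals exact contDiff_const

theorem flatForm_indep (p : EuclideanSpace ℝ (Fin 6)) :
    LinearIndependent ℝ (fun i => flatForm i p) := by
  rw [Fintype.linearIndependent_iff]
  intro g hg
  have key : ∀ v : EuclideanSpace ℝ (Fin 6),
      g 0 * (v 2 + p 0 * v 3 + p 1 * v 4 + p 0 * p 1 * v 5) + g 1 * v 3 + g 2 * v 4 + g 3 * v 5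
        + g 4 * v 0 + g 5 * v 1 = 0 := by
    intro v
    have h := congrArg (fun f : EuclideanSpace ℝ (Fin 6) →L[ℝ] ℝ => f v) hg
    rw [Fin.sum_univ_six] at h
    exact h
  have h0 := key (EuclideanSpace.single 2 1)
  have h1 := key (EuclideanSpace.single 3 1)
  have h2 := key (EuclideanSpace.single 4 1)
  have h3 := key (EuclideanSpace.single 5 1)
  have h4 := key (EuclideanSpace.single 0 1)
  have h5 := key (EuclideanSpace.single 1 1)
  simp at h0 h1 h2 h3 h4 h5
  simp [h0] at h1 h2 h3
  intro i
  fin_cases i <;> assumption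

theorem flatForm_extD_zero (p v w : EuclideanSpace ℝ (Fin 6)) :
    extD (flatForm 0) p v w =
      v 0 * w 3 - w 0 * v 3 + (v 1 * w 4 - w 1 * v 4)
      + ((v 0 * p 1 + p 0 * v 1) * w 5 - (w 0 * p 1 + p 0 * w 1) * v 5) := by
  have hc : ∀ i : Fin 6, HasFDerivAt (fun u : EuclideanSpace ℝ (Fin 6) => u i) (coord i) p :=
    fun i => (coord i).hasFDerivAt
  have h : HasFDerivAt (fun u : EuclideanSpace ℝ (Fin 6) =>
      coord 2 + u 0 • coord 3 + u 1 • coord 4 + (u 0 * u 1) • coord 5) _ p :=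
    (((hasFDerivAt_const (coord 2) p).add ((hc 0).smul_const (coord 3))).add
      ((hc 1).smul_const (coord 4))).add (((hc 0).mul (hc 1)).smul_const (coord 5))
  have e := extD_model (fun u : EuclideanSpace ℝ (Fin 6) =>
      coord 2 + u 0 • coord 3 + u 1 • coord 4 + (u 0 * u 1) • coord 5) p v w
  rw [h.fderiv] at e
  refine e.trans ?_
  simp [coord]
  ring

theorem flatForm_extD_ne (i : Fin 6) (hi : i ≠ 0) (p v w : EuclideanSpace ℝ (Fin 6)) :
    extD (flatForm i) p v w = 0 := by
  have hk : ∀ c : EuclideanSpace ℝ (Fin 6) →L[ℝ] ℝ,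
      extD (n := 6) (M := EuclideanSpace ℝ (Fin 6)) (fun _ => c) p v w = 0 := by
    intro c
    rw [extD_model (fun _ => c) p v w]
    simp
  fin_cases i
  · exact absurd rfl hi
  all_goals exact hk _

/-- The flat para-CR structure of type `(1,2,3)`. -/
def flatModel : Structure123 (EuclideanSpace ℝ (Fin 6)) where
  form := flatForm
  smooth := flatForm_smooth
  indep := flatForm_indep
  integrable_minus := by
    intro i _ p v w h
    change EuclideanSpace ℝ (Fin 6) at v w
    by_cases hi : i = 0
    · subst hi
      have h4 : v 0 = 0 ∧ w 0 = 0 := h 4 (by simp)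
      have h5 : v 1 = 0 ∧ w 1 = 0 := h 5 (by simp)
      refine (flatForm_extD_zero p v w).trans ?_
      simp [h4.1, h4.2, h5.1, h5.2]
    · exact flatForm_extD_ne i hi p v w
  integrable_plus := by
    intro i _ p v w h
    change EuclideanSpace ℝ (Fin 6) at v w
    by_cases hi : i = 0
    · subst hi
      have h1 : v 3 = 0 ∧ w 3 = 0 := h 1 (by simp)
      have h2 : v 4 = 0 ∧ w 4 = 0 := h 2 (by simp)
      have h3 : v 5 = 0 ∧ w 5 = 0 := h 3 (by simp)
      refine (flatForm_extD_zero p v w).trans ?_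
      simp [h1.1, h1.2, h2.1, h2.2, h3.1, h3.2]
    · exact flatForm_extD_ne i hi p v w

/-! ### Lifted forms and the structure equations -/

/-- A lift of a para-CR structure to an 11-dimensional manifold `P`: a smooth map from `P` to the
bundle of all coframes of the structure, that is, a smooth map `proj : P → M` together with smooth
functions `coeff i j` on `P` which form a para-CR matrix at each point. -/
structure Lift {M : Type*} [TopologicalSpace M] [ChartedSpace (EuclideanSpace ℝ (Fin 6)) M]
    (S : Structure123 M) (P : Type*) [TopologicalSpace P]
    [ChartedSpace (EuclideanSpace ℝ (Fin 11)) P] where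
  proj : P → M
  coeff : P → Matrix (Fin 6) (Fin 6) ℝ
  smooth_proj : ContMDiff (𝓡 11) (𝓡 6) ∞ proj
  smooth_coeff : ∀ i j, ContMDiff (𝓡 11) 𝓘(ℝ) ∞ (fun q => coeff q i j)
  isParaCRMatrix : ∀ q, IsParaCRMatrix (coeff q)

section EDS

variable {M : Type*} [TopologicalSpace M] [ChartedSpace (EuclideanSpace ℝ (Fin 6)) M]
  {S : Structure123 M} {P : Type*} [TopologicalSpace P]
  [ChartedSpace (EuclideanSpace ℝ (Fin 11)) P]

/-- The six lifted forms on `P`: the para-CR matrix applied to the column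
`(λ, ν₁, ν₂, ν₃, μ₁, μ₂)` of forms pulled back to `P`. In this order they are
`(θ⁴, θ¹, θ², θ³, Ω₃, Ω₂)`. -/
def Lift.form (L : Lift S P) (i : Fin 6) : OneForm 11 P :=
  fun q => ∑ j, L.coeff q i j • pullback L.proj (S.form j) q

/-- `(θ¹, θ², θ³, θ⁴)`. -/
def Lift.theta (L : Lift S P) : Fin 4 → OneForm 11 P :=
  ![L.form 1, L.form 2, L.form 3, L.form 0]

/-- `(Ω₁, Ω₂, Ω₃, Ω₄, Ω₅, Ω₆)`, where `B = (Ω₁, Ω₄, Ω₅, Ω₆, A)` are the supplementing forms. -/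
def Lift.Omega (L : Lift S P) (B : Fin 5 → OneForm 11 P) : Fin 6 → OneForm 11 P :=
  ![B 0, L.form 5, L.form 4, B 1, B 2, B 3]

/-- The matrix of the split metric, `g_{ij} = g^{ij}`. -/
def splitMetric : Matrix (Fin 4) (Fin 4) ℝ :=
  !![0, 1, 0, 0;
     1, 0, 0, 0;
     0, 0, 0, 1;
     0, 0, 1, 0]

/-- The skew part `Γ_{[ij]}`, for `Ω = (Ω₁, …, Ω₆)`. -/
def gammaSkew (Ω : Fin 6 → OneForm 11 P) : Fin 4 → Fin 4 → OneForm 11 P :=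
  ![![0, Ω 0, Ω 1, Ω 3],
    ![-Ω 0, 0, Ω 2, Ω 4],
    ![-Ω 1, -Ω 2, 0, Ω 5],
    ![-Ω 3, -Ω 4, -Ω 5, 0]]

/-- `Γ_{ij} = Γ_{[ij]} + ½ A g_{ij}`. -/
def gammaLow (Ω : Fin 6 → OneForm 11 P) (A : OneForm 11 P) (i j : Fin 4) : OneForm 11 P :=
  gammaSkew Ω i j + ((1 / 2 : ℝ) * splitMetric i j) • A

/-- `Γ^i_j = g^{ik} Γ_{kj}`. -/
def gamma (Ω : Fin 6 → OneForm 11 P) (A : OneForm 11 P) (i j : Fin 4) : OneForm 11 P :=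
  ∑ k, splitMetric i k • gammaLow Ω A k j

/-- The forms `(θ^i, Ω_μ, A)` satisfy `dθ^i + Γ^i_j ∧ θ^j = 0` and
`dΓ^i_j + Γ^i_k ∧ Γ^k_j = 0`. -/
def FlatEquations (θ : Fin 4 → OneForm 11 P) (Ω : Fin 6 → OneForm 11 P) (A : OneForm 11 P) : Prop :=
  (∀ i, extD (θ i) + ∑ j, wedge (gamma Ω A i j) (θ j) = 0) ∧
  (∀ i j, extD (gamma Ω A i j) + ∑ k, wedge (gamma Ω A i k) (gamma Ω A k j) = 0)

/-- The smooth 1-forms `B = (Ω₁, Ω₄, Ω₅, Ω₆, A)` supplement the six lifted forms to a coframe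
`(θ^i, Ω_μ, A)` of `P` which satisfies the flat structure equations. -/
def Lift.IsFlatCompletion (L : Lift S P) (B : Fin 5 → OneForm 11 P) : Prop :=
  (∀ i, IsSmooth (B i)) ∧
  (∀ q : P, LinearIndependent ℝ
    (Sum.elim (fun i => L.theta i q) (Sum.elim (fun μ => L.Omega B μ q) (fun _ : Unit => B 4 q)))) ∧
  FlatEquations L.theta (L.Omega B) (B 4)

end EDS

end ParaCR

end

open ParaCR

universe u v

open scoped Manifold ContDiff

noncomputable section

namespace ParaCR

/-! ### Flat linear systems `Df(v) = Λ(v) f` -/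

section FlatSystem

open Metric Set

set_option maxSynthPendingDepth 3

variable {E F : Type*} [NormedAddCommGroup E] [NormedSpace ℝ E] [NormedAddCommGroup F]
  [NormedSpace ℝ F] {Λ : E → E →L[ℝ] F →L[ℝ] F} {r C : ℝ}

/-! The structure equations say that Γ, with values in the conformal algebra 𝔠𝔬(2,2), is a flat
connection for which θ is torsion-free. Together they are the Maurer–Cartan equations of the group
CO(2,2) ⋉ ℝ⁴, of dimension 6 + 1 + 4 = 11. The flat para-CR structure fits into this as follows. The
space ℝ⁴ of the aᵢ carries the quadratic form da₀da₃ - da₁da₂, and λ = (1, x, y, xy) runs through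
its null covectors. So ℝ⁶ is ℝ⁴ times an affine chart of the quadric of null directions, and x, y
are the parameters of the two rulings of this quadric.

Existence for the flat structure. The conformal null coframes whose θ⁴ is a multiple of λ depend on
five parameters a, p, q, m, n, once it is decided which ruling comes first. This gives eleven
coordinates on each of two sheets (`FlatBundle`). The forms are written down in `ModelCoords`, and
`ModelCoords.IsAdmissible.explicitFlat` checks the equations by differentiation.

Uniqueness and maximality. For any completed lift, the equations for θ¹, θ², θ⁴ on dual vectors
become algebraic relations between its coefficients (`coefficient_relations`). These determine all
coefficients in terms of eleven functions, except the λ-parts of θ³, Ω₂, Ω₃ (`coeff_eq_liftMatrix`).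
The rest is rigidity (`SmoothFlat.rigid`): two flat coframes that agree up to this ambiguity differ
by a change of A by an explicit combination of θ¹, θ², θ⁴, and closedness of A before and after
forces this change to vanish. Hence every completed lift is the pullback of the model by its own
eleven coordinates (`eq_model`, `exists_localDiffeomorph`).

Local flatness. Local equivalences pull the model back to open pieces, and countably many of them
form the required 11-manifold. Conversely, a flat connection has parallel rows T, and functions X
with dX = Tθ (`exists_parallel`). They satisfy T g Tᵗ = κ h, where h is the quadratic form above. A
null column of T supplies x and y, and the X supply the aᵢ. The resulting map to ℝ⁶ pulls the flat
forms back to para-CR combinations of the lifted ones (`exists_developing_map`). Restricted to a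
6-dimensional slice, this map and the projection to M are both local diffeomorphisms, and composing
one with the inverse of the other is the equivalence (`locallyEquivalent`).

The analytic tool is the Frobenius theorem for linear systems (`exists_flat_solution`), proved by
integrating along rays and comparing neighbouring rays with Grönwall's inequality. -/

theorem smul_mem_ball_zero {x : E} (hx : x ∈ ball (0 : E) r) {t : ℝ} (ht : t ∈ Icc (0 : ℝ) 1) :
    t • x ∈ ball (0 : E) r := by
  rw [mem_ball_zero_iff] at hx ⊢
  rw [norm_smul, Real.norm_of_nonneg ht.1]
  nlinarith [norm_nonneg x, ht.2]

theorem norm_apply_le_of_mem_ball (hC : 0 ≤ C) (hCr : C * r ≤ 1 / 2)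
    (hb : ∀ x ∈ ball (0 : E) r, ‖Λ x‖ ≤ C) {x y : E} (hy : y ∈ ball (0 : E) r)
    (hx : x ∈ ball (0 : E) r) : ‖Λ y x‖ ≤ 1 / 2 := by
  have h1 := (Λ y).le_of_opNorm_le (hb y hy) x
  rw [mem_ball_zero_iff] at hx
  nlinarith [norm_nonneg x]

/-- On the ray t ↦ t • x the system is a linear ODE with coefficient `Λ (t • x) x`, of norm at most
1/2. This smallness makes a single Picard–Lindelöf step reach t = 1. -/
theorem exists_ray_solution [CompleteSpace F] (hC : 0 ≤ C) (hCr : C * r ≤ 1 / 2)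
    (hd : ∀ x ∈ ball (0 : E) r, DifferentiableAt ℝ Λ x)
    (hb : ∀ x ∈ ball (0 : E) r, ‖Λ x‖ ≤ C) (f₀ : F) {x : E} (hx : x ∈ ball (0 : E) r) :
    ∃ φ : ℝ → F, φ 0 = f₀ ∧
      ∀ t ∈ Icc (0 : ℝ) 1, HasDerivWithinAt φ (Λ (t • x) x (φ t)) (Icc 0 1) t := by
  -- In the ball of radius ‖f₀‖ + 1 around f₀ one has ‖f‖ ≤ 2‖f₀‖ + 1, so the speed is at most half
  -- of that, hence below ‖f₀‖ + 1. In unit time the solution stays in the ball.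
  have hP : IsPicardLindelof (fun t f => Λ (t • x) x f) (tmin := 0) (tmax := 1)
      ⟨0, by simp⟩ f₀ (‖f₀‖₊ + 1) 0 (‖f₀‖₊ + 1) 1 := by
    refine ⟨fun t ht => ?_, fun f hf => ?_, fun t ht f hf => ?_, by simp⟩
    · refine (ContinuousLinearMap.lipschitzWith_of_opNorm_le ?_).lipschitzOnWith
      exact (norm_apply_le_of_mem_ball hC hCr hb (smul_mem_ball_zero hx ht) hx).trans
        (by norm_num)
    · intro t ht
      have h1 : ContinuousAt Λ (t • x) := (hd _ (smul_mem_ball_zero hx ht)).continuousAt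
      have h2 : ContinuousAt (fun t : ℝ => Λ (t • x)) t :=
        ContinuousAt.comp (f := fun t : ℝ => t • x) h1 (by fun_prop)
      exact ((h2.clm_apply continuousAt_const).clm_apply continuousAt_const).continuousWithinAt
    · have h1 := (Λ (t • x) x).le_of_opNorm_le
        (norm_apply_le_of_mem_ball hC hCr hb (smul_mem_ball_zero hx ht) hx) f
      have h2 : ‖f‖ ≤ ‖f₀‖ + (‖f₀‖ + 1) := by
        have := norm_le_of_mem_closedBall hf
        simpa using this
      simp only [NNReal.coe_add, coe_nnnorm, NNReal.coe_one]
      linarith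
  exact hP.exists_eq_forall_mem_Icc_hasDerivWithinAt₀

theorem ray_solution_norm_le (hC : 0 ≤ C) (hCr : C * r ≤ 1 / 2)
    (hb : ∀ x ∈ ball (0 : E) r, ‖Λ x‖ ≤ C) {x : E} (hx : x ∈ ball (0 : E) r) {φ : ℝ → F}
    (hφ : ∀ t ∈ Icc (0 : ℝ) 1, HasDerivWithinAt φ (Λ (t • x) x (φ t)) (Icc 0 1) t)
    {t : ℝ} (ht : t ∈ Icc (0 : ℝ) 1) : ‖φ t‖ ≤ ‖φ 0‖ * Real.exp (1 / 2) := by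
  have h := norm_le_gronwallBound_of_norm_deriv_right_le (f := φ) (a := 0) (b := 1)
    (f' := fun t => Λ (t • x) x (φ t)) (δ := ‖φ 0‖) (K := 1 / 2) (ε := 0)
    (fun t ht => (hφ t ht).continuousWithinAt)
    (fun t ht => (hφ t ⟨ht.1, ht.2.le⟩).mono_of_mem_nhdsWithin (Icc_mem_nhdsGE_of_mem ht)) le_rfl
    (fun t ht => by
      rw [add_zero]
      exact ContinuousLinearMap.le_of_opNorm_le _ (norm_apply_le_of_mem_ball hC hCr hb
        (smul_mem_ball_zero hx ⟨ht.1, ht.2.le⟩) hx) _) t ht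
  rw [gronwallBound_ε0] at h
  refine h.trans (mul_le_mul_of_nonneg_left (Real.exp_le_exp.2 ?_) (norm_nonneg _))
  linarith [ht.2]

/-- The defect of the first order variation of a solution along a ray is quadratic. -/
theorem ray_variation_defect_le {l l' : E →L[ℝ] F →L[ℝ] F} {D : E →L[ℝ] E →L[ℝ] F →L[ℝ] F}
    {x h : E} {f : F} {t N : ℝ} (hC : 0 ≤ C) (ht : t ∈ Icc (0 : ℝ) 1) (hl : ‖l‖ ≤ C)
    (hD : ‖D‖ ≤ C) (hl' : ‖l' - l - D (t • h)‖ ≤ C * ‖t • h‖ ^ 2) (hx : ‖x + h‖ ≤ 1)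
    (hh : ‖h‖ ≤ 2) (hf : ‖f‖ ≤ N)
    (flat : D h x f - D x h f + l x (l h f) - l h (l x f) = 0) :
    ‖l' (x + h) (f + t • l h f) -
      (l x f + (l h f + t • D x h f + t • l h (l x f)))‖ ≤
        (2 * C + C ^ 2 + 3 * C ^ 2) * N * ‖h‖ ^ 2 := by
  obtain ⟨ρ, hρ⟩ : ∃ ρ, ρ = l' - l - D (t • h) := ⟨_, rfl⟩
  rw [← hρ] at hl'
  have e : l' = l + t • D h + ρ := by rw [hρ, map_smul]; abel
  -- The terms of first order in `h` cancel by flatness. What remains is at least quadratic in `h`.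
  have key : l' (x + h) (f + t • l h f) -
      (l x f + (l h f + t • D x h f + t • l h (l x f))) =
      t • D h h f + ρ (x + h) f + t • l h (l h f)
        + ((t • t • D h (x + h) (l h f)) + t • ρ (x + h) (l h f)) := by
    have := congrArg (fun z => t • z) flat
    simp only [smul_sub, smul_add, smul_zero] at this
    rw [← sub_eq_zero, ← this, e]
    simp only [add_apply, map_add, smul_apply, map_smul,
      smul_add, smul_smul]
    module
  rw [key]
  have t0 := ht.1
  have t1 := ht.2
  have nt : ‖t‖ ≤ 1 := by rw [Real.norm_of_nonneg t0]; exact t1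
  have hN : 0 ≤ N := (norm_nonneg f).trans hf
  have n0 := norm_nonneg h
  have hρ' : ‖ρ‖ ≤ C * ‖h‖ ^ 2 := by
    refine hl'.trans (mul_le_mul_of_nonneg_left ?_ hC)
    rw [norm_smul]
    gcongr
    nlinarith
  have hlh : ‖l h‖ ≤ C * ‖h‖ := l.le_of_opNorm_le hl h
  have hlf : ‖l h f‖ ≤ C * ‖h‖ * N := (l h).le_of_opNorm_le_of_le hlh hf
  have hDh : ‖D h‖ ≤ C * ‖h‖ := D.le_of_opNorm_le hD h
  have hDhx : ‖D h (x + h)‖ ≤ C * ‖h‖ * 1 := (D h).le_of_opNorm_le_of_le hDh hx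
  have hρx : ‖ρ (x + h)‖ ≤ C * ‖h‖ ^ 2 * 1 := ρ.le_of_opNorm_le_of_le hρ' hx
  have smul_le : ∀ z : F, ‖t • z‖ ≤ ‖z‖ := fun z => by
    rw [norm_smul]; nlinarith [norm_nonneg z]
  have b1 : ‖t • D h h f‖ ≤ C * ‖h‖ * ‖h‖ * N :=
    (smul_le _).trans ((D h h).le_of_opNorm_le_of_le ((D h).le_of_opNorm_le hDh h) hf)
  have b2 : ‖ρ (x + h) f‖ ≤ C * ‖h‖ ^ 2 * 1 * N := (ρ (x + h)).le_of_opNorm_le_of_le hρx hf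
  have b3 : ‖t • l h (l h f)‖ ≤ C * ‖h‖ * (C * ‖h‖ * N) :=
    (smul_le _).trans ((l h).le_of_opNorm_le_of_le hlh hlf)
  have b4 : ‖t • t • D h (x + h) (l h f)‖ ≤ C * ‖h‖ * 1 * (C * ‖h‖ * N) :=
    (smul_le _).trans ((smul_le _).trans ((D h (x + h)).le_of_opNorm_le_of_le hDhx hlf))
  have b5 : ‖t • ρ (x + h) (l h f)‖ ≤ C * ‖h‖ ^ 2 * 1 * (C * ‖h‖ * N) :=
    (smul_le _).trans ((ρ (x + h)).le_of_opNorm_le_of_le hρx hlf)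
  -- The only cubic term is made quadratic by ‖h‖ ≤ 2, which explains the 3C² in the constant.
  have b6 : C * ‖h‖ ^ 2 * 1 * (C * ‖h‖ * N) ≤ C * ‖h‖ ^ 2 * 1 * (C * 2 * N) := by gcongr
  refine (norm_add_le _ _).trans (le_trans (add_le_add (norm_add₃_le) (norm_add_le _ _)) ?_)
  nlinarith

/-- The solution at `x` is the endpoint of the ODE along the ray to `x`. Its derivative is found
without differentiating an ODE in a parameter: the expected first variation is compared with the
true solution on the neighbouring ray, and flatness makes the error O(‖h‖²). -/
theorem exists_flat_solution_of_bounds [CompleteSpace F] (hr : 0 < r) (hr1 : r ≤ 1) (hC : 0 ≤ C)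
    (hCr : C * r ≤ 1 / 2) (hd : ∀ x ∈ ball (0 : E) r, DifferentiableAt ℝ Λ x)
    (hb : ∀ x ∈ ball (0 : E) r, ‖Λ x‖ ≤ C) (hb' : ∀ x ∈ ball (0 : E) r, ‖fderiv ℝ Λ x‖ ≤ C)
    (taylor : ∀ x ∈ ball (0 : E) r, ∀ y ∈ ball (0 : E) r,
      ‖Λ y - Λ x - fderiv ℝ Λ x (y - x)‖ ≤ C * ‖y - x‖ ^ 2)
    (flat : ∀ x ∈ ball (0 : E) r, ∀ u v f, fderiv ℝ Λ x u v f - fderiv ℝ Λ x v u f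
      + Λ x v (Λ x u f) - Λ x u (Λ x v f) = 0) (f₀ : F) :
    ∃ f : E → F, f 0 = f₀ ∧
      ∀ x ∈ ball (0 : E) r, HasFDerivAt f ((Λ x).flip (f x)) x := by
  choose! φ hφ0 hφ using fun (x : E) (hx : x ∈ ball (0 : E) r) =>
    exists_ray_solution hC hCr hd hb f₀ hx
  refine ⟨fun x => φ x 1, ?_, fun x hx => ?_⟩
  · have h0 : (0 : E) ∈ ball (0 : E) r := mem_ball_self hr
    have := constant_of_has_deriv_right_zero (f := φ 0) (a := 0) (b := 1)
      (fun t ht => (hφ 0 h0 t ht).continuousWithinAt)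
      (fun t ht => by
        have := (hφ 0 h0 t ⟨ht.1, ht.2.le⟩).mono_of_mem_nhdsWithin (Icc_mem_nhdsGE_of_mem ht)
        simpa using this) 1 (by simp)
    exact this.trans (hφ0 0 h0)
  set N : ℝ := ‖f₀‖ * Real.exp (1 / 2) with hN
  set B : ℝ := (2 * C + C ^ 2 + 3 * C ^ 2) * N with hB
  have key : ∀ y ∈ ball (0 : E) r,
      ‖φ y 1 - φ x 1 - (Λ x).flip (φ x 1) (y - x)‖ ≤ gronwallBound 0 1 (B * ‖y - x‖ ^ 2) 1 := by
    intro y hy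
    obtain ⟨h, rfl⟩ : ∃ h, y = x + h := ⟨y - x, by abel⟩
    rw [add_sub_cancel_left]
    have hh : ‖h‖ ≤ 2 := by
      have e : h = (x + h) - x := by abel
      rw [mem_ball_zero_iff] at hx hy
      rw [e]
      exact (norm_sub_le _ _).trans (by linarith)
    -- The trial solution on the ray through `x + h` moves the solution at `t • x` by the
    -- displacement `t • h`, to first order.
    have hψ : ∀ t ∈ Icc (0 : ℝ) 1, HasDerivWithinAt (fun t => φ x t + t • Λ (t • x) h (φ x t))
        (Λ (t • x) x (φ x t) + (Λ (t • x) h (φ x t) + t • fderiv ℝ Λ (t • x) x h (φ x t)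
          + t • Λ (t • x) h (Λ (t • x) x (φ x t)))) (Icc 0 1) t := by
      intro t ht
      have h1 : HasDerivAt (fun t : ℝ => Λ (t • x)) (fderiv ℝ Λ (t • x) x) t := by
        have := (hd _ (smul_mem_ball_zero hx ht)).hasFDerivAt.comp_hasDerivAt t
          (f := fun t : ℝ => t • x) ((hasDerivAt_id t).smul_const x)
        rw [one_smul] at this
        exact this
      have h2 : HasDerivWithinAt (fun t : ℝ => Λ (t • x) h (φ x t))
          (fderiv ℝ Λ (t • x) x h (φ x t) + Λ (t • x) h (Λ (t • x) x (φ x t))) (Icc 0 1) t := by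
        have h3 : HasDerivWithinAt (fun t : ℝ => Λ (t • x) h) (fderiv ℝ Λ (t • x) x h)
            (Icc 0 1) t := by
          simpa using (h1.clm_apply (hasDerivAt_const t h)).hasDerivWithinAt
        exact h3.clm_apply (hφ x hx t ht)
      have := (hφ x hx t ht).add ((hasDerivWithinAt_id t (Icc 0 1)).smul h2)
      refine (this.congr_deriv ?_ :)
      simp only [id, smul_add, one_smul]
      abel
    have hg : ∀ t ∈ Icc (0 : ℝ) 1, HasDerivWithinAt
        (fun t => φ (x + h) t - (φ x t + t • Λ (t • x) h (φ x t)))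
        (Λ (t • (x + h)) (x + h) (φ (x + h) t) - (Λ (t • x) x (φ x t) + (Λ (t • x) h (φ x t)
          + t • fderiv ℝ Λ (t • x) x h (φ x t) + t • Λ (t • x) h (Λ (t • x) x (φ x t)))))
        (Icc 0 1) t := fun t ht => (hφ _ hy t ht).sub (hψ t ht)
    have G := norm_le_gronwallBound_of_norm_deriv_right_le (δ := 0) (K := 1)
      (ε := B * ‖h‖ ^ 2) (fun t ht => (hg t ht).continuousWithinAt)
      (fun t ht => (hg t ⟨ht.1, ht.2.le⟩).mono_of_mem_nhdsWithin (Icc_mem_nhdsGE_of_mem ht))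
      (by simp [hφ0 x hx, hφ0 _ hy]) (fun t ht => ?_) 1 (by simp)
    · have e : φ (x + h) 1 - φ x 1 - (Λ x).flip (φ x 1) h
          = φ (x + h) 1 - (φ x 1 + (1 : ℝ) • Λ ((1 : ℝ) • x) h (φ x 1)) := by
        simp [sub_sub]
      rw [e]
      simpa using G
    · have ht' : t ∈ Icc (0 : ℝ) 1 := ⟨ht.1, ht.2.le⟩
      have hx' := smul_mem_ball_zero hx ht'
      have hy' := smul_mem_ball_zero hy ht'
      have hT := taylor _ hx' _ hy'
      have hsub : t • (x + h) - t • x = t • h := by rw [smul_add]; abel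
      rw [hsub] at hT
      have hdef := ray_variation_defect_le (f := φ x t) (N := N) hC ht' (hb _ hx') (hb' _ hx')
        hT ((mem_ball_zero_iff.1 hy).le.trans hr1) hh
        (by rw [hN, ← hφ0 x hx]; exact ray_solution_norm_le hC hCr hb hx (hφ x hx) ht')
        (flat _ hx' _ _ _)
      -- The derivative of the difference is the operator applied to the difference, which Grönwall
      -- absorbs, plus the quadratic defect.
      have hsplit : ∀ z w u : F, Λ (t • (x + h)) (x + h) z - u
          = Λ (t • (x + h)) (x + h) (z - w) + (Λ (t • (x + h)) (x + h) w - u) := by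
        intro z w u
        rw [map_sub]
        abel
      rw [hsplit _ (φ x t + t • Λ (t • x) h (φ x t))]
      refine (norm_add_le _ _).trans (add_le_add ?_ hdef)
      exact ContinuousLinearMap.le_of_opNorm_le _ ((norm_apply_le_of_mem_ball hC hCr hb hy'
        hy).trans (by norm_num)) _
  have key' : ∀ y ∈ ball (0 : E) r,
      ‖φ y 1 - φ x 1 - (Λ x).flip (φ x 1) (y - x)‖ ≤ (B * (Real.exp 1 - 1)) * ‖y - x‖ ^ 2 := by
    intro y hy
    refine (key y hy).trans (le_of_eq ?_)
    rw [gronwallBound_of_K_ne_0 one_ne_zero]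
    simp
    ring
  refine .of_isLittleO ?_
  have hO : (fun y => φ y 1 - φ x 1 - (Λ x).flip (φ x 1) (y - x)) =O[nhds x]
      fun y => ‖y - x‖ ^ 2 := by
    refine Asymptotics.IsBigO.of_bound (B * (Real.exp 1 - 1)) ?_
    filter_upwards [isOpen_ball.mem_nhds hx] with y hy
    simpa using key' y hy
  exact hO.trans_isLittleO (Asymptotics.isLittleO_pow_sub_sub x one_lt_two)

/-- A flat linear system has a smooth solution with any given initial value. -/
theorem exists_flat_solution [CompleteSpace F] {s : Set E} (hs : s ∈ nhds (0 : E))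
    (hΛ : ContDiffOn ℝ ∞ Λ s)
    (flat : ∀ x ∈ s, ∀ u v f, fderiv ℝ Λ x u v f - fderiv ℝ Λ x v u f
      + Λ x v (Λ x u f) - Λ x u (Λ x v f) = 0) (f₀ : F) :
    ∃ r > 0, ball (0 : E) r ⊆ s ∧ ∃ f : E → F, f 0 = f₀ ∧ ContDiffOn ℝ ∞ f (ball 0 r) ∧
      ∀ x ∈ ball (0 : E) r, HasFDerivAt f ((Λ x).flip (f x)) x := by
  have h0 : ContDiffAt ℝ ∞ Λ 0 := hΛ.contDiffAt hs
  have h1 : ContDiffAt ℝ 1 (fderiv ℝ Λ) 0 :=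
    h0.fderiv_right (m := 1) (by norm_cast)
  obtain ⟨K, t, ht, hK⟩ := h1.exists_lipschitzOnWith
  -- One constant bounds `Λ`, its derivative and the Lipschitz constant of the derivative near 0.
  -- The summand 1 makes the first two bounds strict at 0, so that they persist nearby.
  set C : ℝ := ‖Λ 0‖ + ‖fderiv ℝ Λ 0‖ + 1 + K with hCdef
  have hC1 : 0 < C := by positivity
  have e1 : ∀ᶠ x in nhds (0 : E), ‖Λ x‖ < C :=
    h0.continuousAt.norm.eventually (gt_mem_nhds (by
      have := norm_nonneg (fderiv ℝ Λ 0); have := K.2; rw [hCdef]; linarith [K.coe_nonneg]))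
  have e2 : ∀ᶠ x in nhds (0 : E), ‖fderiv ℝ Λ x‖ < C :=
    h1.continuousAt.norm.eventually (gt_mem_nhds (by
      have := norm_nonneg (Λ 0); rw [hCdef]; linarith [K.coe_nonneg]))
  obtain ⟨ρ, hρ, hball⟩ := Metric.mem_nhds_iff.1
    (Filter.inter_mem (Filter.inter_mem hs ht) (Filter.inter_mem e1 e2))
  set r := min ρ (min 1 (1 / (2 * C)))
  have hr : 0 < r := by positivity
  have hsub : ∀ x ∈ ball (0 : E) r, ((x ∈ s ∧ x ∈ t) ∧ ‖Λ x‖ < C ∧ ‖fderiv ℝ Λ x‖ < C) :=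
    fun x hx => hball (ball_subset_ball (min_le_left _ _) hx)
  have hss : ball (0 : E) r ⊆ s := fun x hx => (hsub x hx).1.1
  have hd : ∀ x ∈ ball (0 : E) r, DifferentiableAt ℝ Λ x := fun x hx =>
    (hΛ.contDiffAt (Filter.mem_of_superset (isOpen_ball.mem_nhds hx) hss)).differentiableAt
      (by simp)
  obtain ⟨f, hf0, hf⟩ := exists_flat_solution_of_bounds (C := C) hr
    ((min_le_right _ _).trans (min_le_left _ _)) hC1.le
    (by
      have : r ≤ 1 / (2 * C) := (min_le_right _ _).trans (min_le_right _ _)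
      calc C * r ≤ C * (1 / (2 * C)) := by gcongr
        _ = 1 / 2 := by field_simp)
    hd (fun x hx => (hsub x hx).2.1.le) (fun x hx => (hsub x hx).2.2.le)
    (fun x hx y hy => by
      have hseg : segment ℝ x y ⊆ ball (0 : E) r := (convex_ball 0 r).segment_subset hx hy
      have := (convex_segment x y).norm_image_sub_le_of_norm_fderiv_le' (𝕜 := ℝ) (f := Λ)
        (φ := fderiv ℝ Λ x) (C := C * ‖y - x‖) (fun z hz => hd z (hseg hz))
        (fun z hz => by
          have h2 := hK.dist_le_mul z (hsub z (hseg hz)).1.2 x (hsub x hx).1.2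
          rw [dist_eq_norm, dist_eq_norm] at h2
          have h3 : ‖z - x‖ ≤ ‖y - x‖ := by
            have := norm_sub_le_of_mem_segment hz
            rwa [norm_sub_rev y x, norm_sub_rev z x] at *
          have h4 : (K : ℝ) ≤ C := by
            have := norm_nonneg (Λ 0); have := norm_nonneg (fderiv ℝ Λ 0); rw [hCdef]; linarith
          exact h2.trans (mul_le_mul h4 h3 (norm_nonneg _) hC1.le))
        (left_mem_segment ℝ x y) (right_mem_segment ℝ x y)
      rw [pow_two, ← mul_assoc]
      exact this)
    (fun x hx => flat x (hss hx)) f₀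
  refine ⟨r, hr, hss, f, hf0, ?_, hf⟩
  -- Bootstrapping: the derivative of `f` is `Λ` applied to `f`, so it is as smooth as `f`, and each
  -- step gains one order.
  rw [contDiffOn_infty]
  intro n
  induction n with
  | zero =>
    exact contDiffOn_zero.2 fun x hx => (hf x hx).continuousAt.continuousWithinAt
  | succ n ih =>
    push_cast
    rw [contDiffOn_succ_iff_fderiv_of_isOpen isOpen_ball]
    refine ⟨fun x hx => (hf x hx).differentiableAt.differentiableWithinAt, by simp, ?_⟩
    have hflip : ContDiffOn ℝ n (fun x => (Λ x).flip) (ball 0 r) :=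
      (ContinuousLinearMap.flipₗᵢ ℝ E F F).contDiff.comp_contDiffOn
        ((hΛ.mono hss).of_le (by exact_mod_cast le_top))
    exact (hflip.clm_apply ih).congr fun x hx => (hf x hx).fderiv

/-- A function with `df = f A` that vanishes at the centre of a ball vanishes identically. -/
theorem eq_zero_of_fderiv_eq_smul {A : E → E →L[ℝ] ℝ} (hA : ContinuousOn A (ball 0 r)) {f : E → ℝ}
    (h0 : f 0 = 0) (hf : ∀ x ∈ ball (0 : E) r, HasFDerivAt f (f x • A x) x) :
    ∀ x ∈ ball (0 : E) r, f x = 0 := by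
  intro x hx
  have hcont : ContinuousOn (fun t : ℝ => A (t • x) x) (Icc 0 1) := by
    have : ContinuousOn (fun t : ℝ => A (t • x)) (Icc 0 1) :=
      hA.comp (by fun_prop) fun t ht => smul_mem_ball_zero hx ht
    exact this.clm_apply continuousOn_const
  obtain ⟨K, hK⟩ := isCompact_Icc.exists_bound_of_continuousOn hcont
  have hg : ∀ t ∈ Icc (0 : ℝ) 1, HasDerivAt (fun t : ℝ => f (t • x))
      (f (t • x) * A (t • x) x) t := by
    intro t ht
    have := (hf _ (smul_mem_ball_zero hx ht)).comp_hasDerivAt t (f := fun t : ℝ => t • x)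
      ((hasDerivAt_id t).smul_const x)
    simp only [one_smul, smul_apply, smul_eq_mul] at this
    exact this
  have := eq_zero_of_abs_deriv_le_mul_abs_self_of_eq_zero_right (K := K)
    (fun t ht => (hg t ht).continuousAt.continuousWithinAt)
    (fun t ht => (hg t ⟨ht.1, ht.2.le⟩).hasDerivWithinAt) (by simpa using h0)
    (fun t ht => by
      rw [norm_mul, mul_comm]
      exact mul_le_mul_of_nonneg_right (hK t ⟨ht.1, ht.2.le⟩) (norm_nonneg _)) 1 (by simp)
  simpa using this

end FlatSystem

/-! ### Calculus of 1-forms on a manifold -/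

section Calculus

open Set

set_option maxSynthPendingDepth 3

/-- Naturality of the exterior derivative in coordinates. Differentiating η ∘ τ · Dτ also produces η
applied to the second derivative of τ, which is symmetric and drops out of the antisymmetrization.
-/
theorem fderiv_pullback_antisymm {E E' : Type*} [NormedAddCommGroup E] [NormedSpace ℝ E]
    [NormedAddCommGroup E'] [NormedSpace ℝ E'] {η : E → E →L[ℝ] ℝ} {τ : E' → E} {x : E'}
    (hη : DifferentiableAt ℝ η (τ x)) (hτ : ContDiffAt ℝ 2 τ x) (v w : E') :
    fderiv ℝ (fun u => (η (τ u)).comp (fderiv ℝ τ u)) x v w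
      - fderiv ℝ (fun u => (η (τ u)).comp (fderiv ℝ τ u)) x w v
      = fderiv ℝ η (τ x) (fderiv ℝ τ x v) (fderiv ℝ τ x w)
        - fderiv ℝ η (τ x) (fderiv ℝ τ x w) (fderiv ℝ τ x v) := by
  have h1 : HasFDerivAt τ (fderiv ℝ τ x) x := (hτ.differentiableAt (by simp)).hasFDerivAt
  have h2 : HasFDerivAt (fderiv ℝ τ) (fderiv ℝ (fderiv ℝ τ) x) x :=
    ((hτ.fderiv_right (m := 1) le_rfl).differentiableAt (by simp)).hasFDerivAt
  have h3 := (hη.hasFDerivAt.comp x h1).clm_comp h2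
  have hs : fderiv ℝ (fderiv ℝ τ) x v w = fderiv ℝ (fderiv ℝ τ) x w v :=
    (hτ.isSymmSndFDerivAt (by simp)) v w
  have h4 := h3.fderiv
  simp only [Function.comp_def] at h4
  rw [h4]
  simp [hs]

variable {m n : ℕ}
  {M : Type*} [TopologicalSpace M] [ChartedSpace (EuclideanSpace ℝ (Fin n)) M]
  {N : Type*} [TopologicalSpace N] [ChartedSpace (EuclideanSpace ℝ (Fin m)) N]

/-- The preferred chart at a point. -/
abbrev chart (n : ℕ) {M : Type*} [TopologicalSpace M] [ChartedSpace (EuclideanSpace ℝ (Fin n)) M]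
    (p : M) : OpenPartialHomeomorph M (EuclideanSpace ℝ (Fin n)) :=
  chartAt (EuclideanSpace ℝ (Fin n)) p

/-- The differential of a function. -/
def diff (f : M → ℝ) : OneForm n M := fun p => mfderiv (𝓡 n) 𝓘(ℝ) f p

theorem mfderiv_eq_fderiv_chart {E : Type*} [NormedAddCommGroup E] [NormedSpace ℝ E] {f : M → E}
    {p : M} (hf : MDifferentiableAt (𝓡 n) 𝓘(ℝ, E) f p) :
    mfderiv (𝓡 n) 𝓘(ℝ, E) f p = fderiv ℝ (f ∘ (chart n p).symm) (chart n p p) := by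
  have h : fderivWithin ℝ (writtenInExtChartAt (𝓡 n) 𝓘(ℝ, E) p f) (range (𝓡 n))
      (extChartAt (𝓡 n) p p) = fderiv ℝ (f ∘ (chart n p).symm) (chart n p p) := by
    simp only [writtenInExtChartAt, extChartAt, mfld_simps, fderivWithin_univ]
    rfl
  exact hf.mfderiv.trans h

theorem differentiableAt_comp_chart_symm {E : Type*} [NormedAddCommGroup E] [NormedSpace ℝ E]
    {f : M → E} {p : M} (hf : MDifferentiableAt (𝓡 n) 𝓘(ℝ, E) f p) :
    DifferentiableAt ℝ (f ∘ (chart n p).symm) (chart n p p) := by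
  have := hf.2
  simp only [DifferentiableWithinAtProp, mfld_simps, differentiableWithinAt_univ] at this
  exact this

theorem hasFDerivAt_comp_chart_symm {f : M → ℝ} {p : M}
    (hf : MDifferentiableAt (𝓡 n) 𝓘(ℝ) f p) :
    HasFDerivAt (f ∘ (chart n p).symm) (diff f p : EuclideanSpace ℝ (Fin n) →L[ℝ] ℝ)
      (chart n p p) := by
  have h := (differentiableAt_comp_chart_symm hf).hasFDerivAt
  rw [← mfderiv_eq_fderiv_chart hf] at h
  exact h

variable [IsManifold (𝓡 n) ∞ M] [IsManifold (𝓡 m) ∞ N]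

theorem mdifferentiableAt_chart_symm {e : OpenPartialHomeomorph M (EuclideanSpace ℝ (Fin n))}
    (he : e ∈ atlas (EuclideanSpace ℝ (Fin n)) M) {u : EuclideanSpace ℝ (Fin n)}
    (hu : u ∈ e.target) : MDifferentiableAt (𝓡 n) (𝓡 n) e.symm u :=
  have : IsManifold (𝓡 n) 1 M := IsManifold.of_le (n := ∞) (by simp)
  mdifferentiableAt_atlas_symm he hu

/-- The tangent space at `p` is ℝⁿ by way of the preferred chart at `p`, so that the inverse of this
chart has the identity as derivative there. -/
theorem mfderiv_chart_symm (p : M) :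
    mfderiv (𝓡 n) (𝓡 n) (chart n p).symm (chart n p p)
      = ContinuousLinearMap.id ℝ (EuclideanSpace ℝ (Fin n)) := by
  have h := mdifferentiableAt_chart_symm (chart_mem_atlas (EuclideanSpace ℝ (Fin n)) p)
    (mem_chart_target _ p)
  have hid : fderiv ℝ (chart n p ∘ (chart n p).symm) (chart n p p)
      = ContinuousLinearMap.id ℝ (EuclideanSpace ℝ (Fin n)) := by
    rw [← fderiv_id (x := chart n p p)]
    apply Filter.EventuallyEq.fderiv_eq
    filter_upwards [(chart n p).open_target.mem_nhds (mem_chart_target _ p)] with u hu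
    exact (chart n p).right_inv hu
  refine h.mfderiv.trans (Eq.trans ?_ hid)
  have hw : writtenInExtChartAt (𝓡 n) (𝓡 n) (chart n p p) (chart n p).symm
      = chart n p ∘ (chart n p).symm := by
    simp only [writtenInExtChartAt, extChartAt, mfld_simps]
    rfl
  rw [hw]
  simp only [extChartAt, mfld_simps, fderivWithin_univ]
  rfl

theorem inChart_chart_apply (η : OneForm n M) (p : M) :
    inChart η (chart n p) (chart n p p) = η p := by
  unfold inChart
  rw [mfderiv_chart_symm]
  have h := (chart n p).left_inv (mem_chart_source _ p)
  ext v
  have : ∀ q : M, q = p → ∀ v : EuclideanSpace ℝ (Fin n),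
      (η q : EuclideanSpace ℝ (Fin n) →L[ℝ] ℝ) v
        = (η p : EuclideanSpace ℝ (Fin n) →L[ℝ] ℝ) v := by
    rintro q rfl v; rfl
  exact this _ h v

/-- Both charts are arbitrary members of the atlases. This is needed because points near a given one
have other preferred charts. -/
theorem inChart_pullback {F : M → N} {η : OneForm m N}
    {e : OpenPartialHomeomorph M (EuclideanSpace ℝ (Fin n))}
    (he : e ∈ atlas (EuclideanSpace ℝ (Fin n)) M)
    {e' : OpenPartialHomeomorph N (EuclideanSpace ℝ (Fin m))}
    (he' : e' ∈ atlas (EuclideanSpace ℝ (Fin m)) N) {u : EuclideanSpace ℝ (Fin n)}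
    (hu : u ∈ e.target) (hF : MDifferentiableAt (𝓡 n) (𝓡 m) F (e.symm u))
    (hFu : F (e.symm u) ∈ e'.source) :
    inChart (pullback F η) e u
      = (inChart η e' (e' (F (e.symm u)))).comp (fderiv ℝ (e' ∘ F ∘ e.symm) u) := by
  have : IsManifold (𝓡 m) 1 N := IsManifold.of_le (n := ∞) (by simp)
  have h1 := mdifferentiableAt_chart_symm he hu
  have h2 : MDifferentiableAt (𝓡 n) (𝓡 m) (F ∘ e.symm) u := hF.comp u h1
  have h3 : MDifferentiableAt (𝓡 m) (𝓡 m) e' (F (e.symm u)) := mdifferentiableAt_atlas he' hFu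
  have h4 : MDifferentiableAt (𝓡 n) (𝓡 m) (e' ∘ F ∘ e.symm) u := h3.comp u h2
  have h5 := mdifferentiableAt_chart_symm he' (e'.map_source hFu)
  have e1 : mfderiv (𝓡 n) (𝓡 m) (F ∘ e.symm) u
      = (mfderiv (𝓡 n) (𝓡 m) F (e.symm u)).comp (mfderiv (𝓡 n) (𝓡 n) e.symm u) :=
    mfderiv_comp u hF h1
  have e2 : mfderiv (𝓡 n) (𝓡 m) (e'.symm ∘ (e' ∘ F ∘ e.symm)) u
      = (mfderiv (𝓡 m) (𝓡 m) e'.symm (e' (F (e.symm u)))).comp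
        (mfderiv (𝓡 n) (𝓡 m) (e' ∘ F ∘ e.symm) u) :=
    mfderiv_comp u h5 h4
  have e3 : F ∘ e.symm =ᶠ[nhds u] e'.symm ∘ (e' ∘ F ∘ e.symm) := by
    filter_upwards [h2.continuousAt.preimage_mem_nhds (e'.open_source.mem_nhds hFu)] with z hz
    exact (e'.left_inv hz).symm
  have e4 : mfderiv (𝓡 n) (𝓡 m) (F ∘ e.symm) u
      = mfderiv (𝓡 n) (𝓡 m) (e'.symm ∘ (e' ∘ F ∘ e.symm)) u := e3.mfderiv_eq
  have e5 : mfderiv (𝓡 n) (𝓡 m) (e' ∘ F ∘ e.symm) u = fderiv ℝ (e' ∘ F ∘ e.symm) u :=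
    mfderiv_eq_fderiv
  ext v
  have c1 := congrArg (fun L : EuclideanSpace ℝ (Fin n) →L[ℝ] EuclideanSpace ℝ (Fin m) => L v)
    (e1.symm.trans (e4.trans e2))
  have c2 := congrArg (fun L : EuclideanSpace ℝ (Fin n) →L[ℝ] EuclideanSpace ℝ (Fin m) => L v) e5
  have key : ∀ q : N, q = F (e.symm u) → ∀ z z' : EuclideanSpace ℝ (Fin m), z = z' →
      (η (F (e.symm u)) : EuclideanSpace ℝ (Fin m) →L[ℝ] ℝ) z
        = (η q : EuclideanSpace ℝ (Fin m) →L[ℝ] ℝ) z' := by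
    rintro q rfl z z' rfl; rfl
  refine key _ (e'.left_inv hFu) _ _ (Eq.trans c1 ?_)
  exact congrArg (fun z => (mfderiv (𝓡 m) (𝓡 m) e'.symm (e' (F (e.symm u))) :
    EuclideanSpace ℝ (Fin m) →L[ℝ] EuclideanSpace ℝ (Fin m)) z) c2

end Calculus

/-! ### Smooth 1-forms and the rules for the exterior derivative. -/

section Calculus

open Set

set_option maxSynthPendingDepth 3

variable {m n : ℕ}
  {M : Type*} [TopologicalSpace M] [ChartedSpace (EuclideanSpace ℝ (Fin n)) M]
  {N : Type*} [TopologicalSpace N] [ChartedSpace (EuclideanSpace ℝ (Fin m)) N]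

theorem contDiffAt_comp_atlas_symm [IsManifold (𝓡 n) ∞ M] {E : Type*} [NormedAddCommGroup E]
    [NormedSpace ℝ E] {f : M → E}
    {e : OpenPartialHomeomorph M (EuclideanSpace ℝ (Fin n))}
    (he : e ∈ atlas (EuclideanSpace ℝ (Fin n)) M) {u : EuclideanSpace ℝ (Fin n)}
    (hu : u ∈ e.target) (hf : ContMDiffAt (𝓡 n) 𝓘(ℝ, E) ∞ f (e.symm u)) :
    ContDiffAt ℝ ∞ (f ∘ e.symm) u := by
  have h1 : ContMDiffAt (𝓡 n) (𝓡 n) ∞ e.symm u :=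
    contMDiffAt_symm_of_mem_maximalAtlas (IsManifold.subset_maximalAtlas he) hu
  exact (hf.comp u h1).contDiffAt

theorem contMDiffAt_of_contDiffAt_comp_chart_symm [IsManifold (𝓡 n) ∞ M] {E : Type*}
    [NormedAddCommGroup E] [NormedSpace ℝ E] {f : M → E} {p : M}
    (hf : ContDiffAt ℝ ∞ (f ∘ (chart n p).symm) (chart n p p)) :
    ContMDiffAt (𝓡 n) 𝓘(ℝ, E) ∞ f p := by
  have h1 : ContMDiffAt (𝓡 n) (𝓡 n) ∞ (chart n p) p :=
    contMDiffAt_of_mem_maximalAtlas (IsManifold.chart_mem_maximalAtlas p) (mem_chart_source _ p)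
  have h2 := hf.contMDiffAt.comp p h1
  refine h2.congr_of_eventuallyEq ?_
  filter_upwards [(chart n p).open_source.mem_nhds (mem_chart_source _ p)] with q hq
  simp [(chart n p).left_inv hq]

theorem IsSmooth.contDiffAt {η : OneForm n M} (hη : IsSmooth η)
    {e : OpenPartialHomeomorph M (EuclideanSpace ℝ (Fin n))}
    (he : e ∈ atlas (EuclideanSpace ℝ (Fin n)) M) {u : EuclideanSpace ℝ (Fin n)}
    (hu : u ∈ e.target) : ContDiffAt ℝ ∞ (inChart η e) u :=
  (hη e he).contDiffAt (e.open_target.mem_nhds hu)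

theorem isSmooth_of_contDiffAt {η : OneForm n M}
    (h : ∀ e ∈ atlas (EuclideanSpace ℝ (Fin n)) M, ∀ u ∈ e.target,
      ContDiffAt ℝ ∞ (inChart η e) u) : IsSmooth η :=
  fun e he u hu => (h e he u hu).contDiffWithinAt

theorem inChart_diff [IsManifold (𝓡 n) ∞ M] {f : M → ℝ}
    {e : OpenPartialHomeomorph M (EuclideanSpace ℝ (Fin n))}
    (he : e ∈ atlas (EuclideanSpace ℝ (Fin n)) M) {u : EuclideanSpace ℝ (Fin n)}
    (hu : u ∈ e.target) (hf : MDifferentiableAt (𝓡 n) 𝓘(ℝ) f (e.symm u)) :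
    inChart (diff f) e u = fderiv ℝ (f ∘ e.symm) u := by
  have h1 := mdifferentiableAt_chart_symm he hu
  have e1 : mfderiv (𝓡 n) 𝓘(ℝ) (f ∘ e.symm) u
      = (mfderiv (𝓡 n) 𝓘(ℝ) f (e.symm u)).comp (mfderiv (𝓡 n) (𝓡 n) e.symm u) :=
    mfderiv_comp u hf h1
  exact e1.symm.trans mfderiv_eq_fderiv

theorem inChart_diff_eventuallyEq [IsManifold (𝓡 n) ∞ M] {f : M → ℝ}
    (hf : ContMDiff (𝓡 n) 𝓘(ℝ) ∞ f)
    {e : OpenPartialHomeomorph M (EuclideanSpace ℝ (Fin n))}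
    (he : e ∈ atlas (EuclideanSpace ℝ (Fin n)) M) {u : EuclideanSpace ℝ (Fin n)}
    (hu : u ∈ e.target) : inChart (diff f) e =ᶠ[nhds u] fderiv ℝ (f ∘ e.symm) := by
  filter_upwards [e.open_target.mem_nhds hu] with z hz
  exact inChart_diff he hz (hf.mdifferentiable (by simp) _)

theorem IsSmooth.diff [IsManifold (𝓡 n) ∞ M] {f : M → ℝ} (hf : ContMDiff (𝓡 n) 𝓘(ℝ) ∞ f) :
    IsSmooth (diff (n := n) f) :=
  isSmooth_of_contDiffAt fun e he u hu => by
    refine ContDiffAt.congr_of_eventuallyEq ?_ (inChart_diff_eventuallyEq hf he hu)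
    exact (contDiffAt_comp_atlas_symm he hu (hf _)).fderiv_right (m := ∞) (by simp)

theorem IsSmooth.add {η η' : OneForm n M} (h : IsSmooth η) (h' : IsSmooth η') :
    IsSmooth (η + η') :=
  fun e he => (h e he).add (h' e he)

theorem IsSmooth.neg {η : OneForm n M} (h : IsSmooth η) : IsSmooth (-η) :=
  fun e he => (h e he).neg

theorem IsSmooth.sub {η η' : OneForm n M} (h : IsSmooth η) (h' : IsSmooth η') :
    IsSmooth (η - η') :=
  fun e he => (h e he).sub (h' e he)

theorem IsSmooth.smul [IsManifold (𝓡 n) ∞ M] {f : M → ℝ} (hf : ContMDiff (𝓡 n) 𝓘(ℝ) ∞ f) {η : OneForm n M}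
    (h : IsSmooth η) : IsSmooth (fun p => f p • η p : OneForm n M) :=
  isSmooth_of_contDiffAt fun _ he _ hu =>
    (contDiffAt_comp_atlas_symm he hu (hf _)).smul (h.contDiffAt he hu)

theorem IsSmooth.pullback [IsManifold (𝓡 n) ∞ M] [IsManifold (𝓡 m) ∞ N] {F : M → N} (hF : ContMDiff (𝓡 n) (𝓡 m) ∞ F) {η : OneForm m N}
    (h : IsSmooth η) : IsSmooth (pullback (n := n) F η) :=
  isSmooth_of_contDiffAt fun e he u hu => by
    set e' := chart m (F (e.symm u))
    have hm : e' ∈ atlas (EuclideanSpace ℝ (Fin m)) N := chart_mem_atlas _ _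
    have hs : F (e.symm u) ∈ e'.source := mem_chart_source _ _
    have h1 : ContMDiffAt (𝓡 n) (𝓡 n) ∞ e.symm u :=
      contMDiffAt_symm_of_mem_maximalAtlas (IsManifold.subset_maximalAtlas he) hu
    have h2 : ContMDiffAt (𝓡 n) (𝓡 m) ∞ (F ∘ e.symm) u := (hF _).comp u h1
    have h3 : ContMDiffAt (𝓡 m) (𝓡 m) ∞ e' (F (e.symm u)) :=
      contMDiffAt_of_mem_maximalAtlas (IsManifold.subset_maximalAtlas hm) hs
    have h4 : ContDiffAt ℝ ∞ (e' ∘ F ∘ e.symm) u := (h3.comp u h2).contDiffAt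
    have hev : inChart (ParaCR.pullback (n := n) F η) e =ᶠ[nhds u] fun z =>
        (inChart η e' ((e' ∘ F ∘ e.symm) z)).comp (fderiv ℝ (e' ∘ F ∘ e.symm) z) := by
      filter_upwards [e.open_target.mem_nhds hu,
        h2.continuousAt.preimage_mem_nhds (e'.open_source.mem_nhds hs)] with z hz hz'
      exact inChart_pullback he hm hz (hF.mdifferentiable (by simp) _) hz'
    refine ContDiffAt.congr_of_eventuallyEq ?_ hev
    have h5 : ContDiffAt ℝ ∞ (inChart η e') ((e' ∘ F ∘ e.symm) u) :=
      h.contDiffAt hm (e'.map_source hs)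
    exact (ContDiffAt.comp u h5 h4).clm_comp (h4.fderiv_right (m := ∞) (by simp))

/-- `η` is differentiable at `p`, with exterior derivative `ρ`. -/
def HasExtDerivAt (η : OneForm n M) (p : M)
    (ρ : TangentSpace (𝓡 n) p → TangentSpace (𝓡 n) p → ℝ) : Prop :=
  DifferentiableAt ℝ (inChart η (chart n p)) (chart n p p) ∧ ∀ v w, extD η p v w = ρ v w

theorem IsSmooth.hasExtDerivAt {η : OneForm n M} (h : IsSmooth η) (p : M) :
    HasExtDerivAt η p (extD η p) :=
  ⟨(h.contDiffAt (chart_mem_atlas _ p) (mem_chart_target _ p)).differentiableAt (by simp),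
    fun _ _ => rfl⟩

/-- Differentiability travels with the value because `extD` is built on `fderiv`, which is 0 at
points without a derivative. Without it the sum and product rules would fail. -/
theorem hasExtDerivAt_of_hasFDerivAt {η : OneForm n M} {p : M}
    {D : EuclideanSpace ℝ (Fin n) →L[ℝ] EuclideanSpace ℝ (Fin n) →L[ℝ] ℝ}
    {ρ : EuclideanSpace ℝ (Fin n) → EuclideanSpace ℝ (Fin n) → ℝ}
    (h : HasFDerivAt (inChart η (chart n p)) D (chart n p p))
    (hρ : ∀ v w, D v w - D w v = ρ v w) : HasExtDerivAt η p ρ := by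
  refine ⟨h.differentiableAt, fun v w => ?_⟩
  simp only [extD]
  rw [h.fderiv]
  exact hρ v w

namespace HasExtDerivAt

variable {p : M} {η η' : OneForm n M} {ρ ρ' : TangentSpace (𝓡 n) p → TangentSpace (𝓡 n) p → ℝ}

theorem fderiv_sub_eq (h : HasExtDerivAt η p ρ) (v w : EuclideanSpace ℝ (Fin n)) :
    fderiv ℝ (inChart η (chart n p)) (chart n p p) v w
      - fderiv ℝ (inChart η (chart n p)) (chart n p p) w v = ρ v w :=
  h.2 v w

theorem add (h : HasExtDerivAt η p ρ) (h' : HasExtDerivAt η' p ρ') :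
    HasExtDerivAt (η + η') p (fun v w => ρ v w + ρ' v w) :=
  hasExtDerivAt_of_hasFDerivAt (h.1.hasFDerivAt.add h'.1.hasFDerivAt) fun v w => by
    rw [← h.fderiv_sub_eq, ← h'.fderiv_sub_eq]
    simp only [add_apply]
    ring

theorem neg (h : HasExtDerivAt η p ρ) : HasExtDerivAt (-η) p (fun v w => -ρ v w) :=
  hasExtDerivAt_of_hasFDerivAt h.1.hasFDerivAt.neg fun v w => by
    rw [← h.fderiv_sub_eq]
    simp only [neg_apply]
    ring

theorem sub (h : HasExtDerivAt η p ρ) (h' : HasExtDerivAt η' p ρ') :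
    HasExtDerivAt (η - η') p (fun v w => ρ v w - ρ' v w) := by
  have := h.add h'.neg
  rw [← sub_eq_add_neg] at this
  exact ⟨this.1, fun v w => by rw [this.2]; ring⟩

theorem smul [IsManifold (𝓡 n) ∞ M] {f : M → ℝ} (hf : MDifferentiableAt (𝓡 n) 𝓘(ℝ) f p)
    (h : HasExtDerivAt η p ρ) :
    HasExtDerivAt (fun q => f q • η q : OneForm n M) p (fun v w =>
      diff f p v * η p w - diff f p w * η p v + f p * ρ v w) := by
  obtain ⟨df, hdf, hd⟩ : ∃ df : EuclideanSpace ℝ (Fin n) →L[ℝ] ℝ, (∀ z, df z = diff f p z) ∧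
      HasFDerivAt (f ∘ (chart n p).symm) df (chart n p p) :=
    ⟨_, fun _ => rfl, hasFDerivAt_comp_chart_symm hf⟩
  have hs : HasFDerivAt (fun u => (f ∘ (chart n p).symm) u • inChart η (chart n p) u) _ _ :=
    hd.smul h.1.hasFDerivAt
  refine hasExtDerivAt_of_hasFDerivAt hs fun v w => ?_
  rw [← h.fderiv_sub_eq]
  have e0 : (f ∘ (chart n p).symm) (chart n p p) = f p := by
    simp [(chart n p).left_inv (mem_chart_source _ p)]
  have e1 : ∀ z : EuclideanSpace ℝ (Fin n), inChart η (chart n p) (chart n p p) z = η p z :=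
    fun z => by rw [inChart_chart_apply]; rfl
  rw [e0]
  simp only [add_apply, smul_apply, ContinuousLinearMap.smulRight_apply, smul_eq_mul, e1, hdf]
  ring

theorem diff [IsManifold (𝓡 n) ∞ M] {f : M → ℝ} (hf : ContMDiff (𝓡 n) 𝓘(ℝ) ∞ f) :
    HasExtDerivAt (ParaCR.diff (n := n) f) p (fun _ _ => 0) := by
  have hev := inChart_diff_eventuallyEq hf (chart_mem_atlas (EuclideanSpace ℝ (Fin n)) p)
    (mem_chart_target _ p)
  have hc : ContDiffAt ℝ ∞ (f ∘ (chart n p).symm) (chart n p p) :=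
    contDiffAt_comp_atlas_symm (chart_mem_atlas _ p) (mem_chart_target _ p) (hf _)
  refine hasExtDerivAt_of_hasFDerivAt (((hc.fderiv_right (m := 1) (by norm_cast)).differentiableAt
    (by simp)).hasFDerivAt.congr_of_eventuallyEq hev) fun v w => ?_
  exact sub_eq_zero.2 ((hc.isSymmSndFDerivAt (by simp; norm_cast)) v w)

end HasExtDerivAt

/-- The exterior derivative can be computed in any chart. -/
theorem extD_eq_inChart [IsManifold (𝓡 n) ∞ M] {η : OneForm n M} (hη : IsSmooth η)
    {e : OpenPartialHomeomorph M (EuclideanSpace ℝ (Fin n))}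
    (he : e ∈ atlas (EuclideanSpace ℝ (Fin n)) M) {u : EuclideanSpace ℝ (Fin n)}
    (hu : u ∈ e.target) (v w : EuclideanSpace ℝ (Fin n)) :
    extD η (e.symm u) (mfderiv (𝓡 n) (𝓡 n) e.symm u v) (mfderiv (𝓡 n) (𝓡 n) e.symm u w)
      = fderiv ℝ (inChart η e) u v w - fderiv ℝ (inChart η e) u w v := by
  set q := e.symm u with hq
  set e' := chart n q with he'
  have hm : e' ∈ atlas (EuclideanSpace ℝ (Fin n)) M := chart_mem_atlas _ _
  have hs : q ∈ e'.source := mem_chart_source _ _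
  have h1 : ContMDiffAt (𝓡 n) (𝓡 n) ∞ e.symm u :=
    contMDiffAt_symm_of_mem_maximalAtlas (IsManifold.subset_maximalAtlas he) hu
  have h3 : ContMDiffAt (𝓡 n) (𝓡 n) ∞ e' q :=
    contMDiffAt_of_mem_maximalAtlas (IsManifold.subset_maximalAtlas hm) hs
  have h4 : ContDiffAt ℝ ∞ (e' ∘ e.symm) u := (h3.comp u h1).contDiffAt
  have hev : inChart η e =ᶠ[nhds u] fun z =>
      (inChart η e' ((e' ∘ e.symm) z)).comp (fderiv ℝ (e' ∘ e.symm) z) := by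
    filter_upwards [e.open_target.mem_nhds hu,
      h1.continuousAt.preimage_mem_nhds (e'.open_source.mem_nhds hs)] with z hz hz'
    -- A change of charts is the pullback by the identity.
    have hp : pullback (id : M → M) η = η := by
      funext q
      simp only [pullback, mfderiv_id]
      rfl
    have := inChart_pullback (F := (id : M → M)) (η := η) he hm hz mdifferentiableAt_id hz'
    rw [hp] at this
    exact this
  have h5 : ContDiffAt ℝ ∞ (inChart η e') ((e' ∘ e.symm) u) :=
    hη.contDiffAt hm (e'.map_source hs)
  rw [hev.fderiv_eq]
  have key := fderiv_pullback_antisymm (h5.differentiableAt (by simp))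
    (h4.of_le (by norm_cast)) v w
  have hmf : mfderiv (𝓡 n) (𝓡 n) e.symm u = fderiv ℝ (e' ∘ e.symm) u := by
    refine (h1.mdifferentiableAt (by simp)).mfderiv.trans ?_
    simp only [writtenInExtChartAt, extChartAt, mfld_simps, fderivWithin_univ]
    rfl
  rw [key, hmf]
  rfl

end Calculus

section Differentials

open Set

set_option maxSynthPendingDepth 3

/-! ### Differentials of functions -/

variable {m n : ℕ}
  {M : Type*} [TopologicalSpace M] [ChartedSpace (EuclideanSpace ℝ (Fin n)) M]
  {N : Type*} [TopologicalSpace N] [ChartedSpace (EuclideanSpace ℝ (Fin m)) N]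

theorem diff_eq_of_hasFDerivAt {f : M → ℝ} {p : M} (hf : MDifferentiableAt (𝓡 n) 𝓘(ℝ) f p)
    {D : EuclideanSpace ℝ (Fin n) →L[ℝ] ℝ}
    (h : HasFDerivAt (f ∘ (chart n p).symm) D (chart n p p)) (v : TangentSpace (𝓡 n) p) :
    diff f p v = D v := by
  obtain ⟨df, hdf, hd⟩ : ∃ df : EuclideanSpace ℝ (Fin n) →L[ℝ] ℝ, (∀ z, df z = diff f p z) ∧
      HasFDerivAt (f ∘ (chart n p).symm) df (chart n p p) :=
    ⟨_, fun _ => rfl, hasFDerivAt_comp_chart_symm hf⟩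
  rw [← hd.unique h]
  exact (hdf v).symm

theorem diff_congr {f g : M → ℝ} {p : M} (h : f =ᶠ[nhds p] g) :
    diff (n := n) f p = diff g p := by
  have := h.mfderiv_eq (I := 𝓡 n) (I' := 𝓘(ℝ))
  exact this

theorem diff_const (c : ℝ) (p : M) (v : TangentSpace (𝓡 n) p) :
    diff (fun _ : M => c) p v = 0 := by
  have h : mfderiv (𝓡 n) 𝓘(ℝ) (fun _ : M => c) p = 0 := mfderiv_const
  exact congrArg (fun L : EuclideanSpace ℝ (Fin n) →L[ℝ] ℝ => L v) h

section Rules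

variable {f g : M → ℝ} {p : M}

theorem comp_chart_symm_apply (f : M → ℝ) (p : M) :
    (f ∘ (chart n p).symm) (chart n p p) = f p := by
  simp [(chart n p).left_inv (mem_chart_source _ p)]

theorem diff_add_apply (hf : MDifferentiableAt (𝓡 n) 𝓘(ℝ) f p)
    (hg : MDifferentiableAt (𝓡 n) 𝓘(ℝ) g p) (v : TangentSpace (𝓡 n) p) :
    diff (fun q => f q + g q) p v = diff f p v + diff g p v :=
  diff_eq_of_hasFDerivAt (hf.add hg)
    ((hasFDerivAt_comp_chart_symm hf).add (hasFDerivAt_comp_chart_symm hg)) v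

theorem diff_neg_apply (hf : MDifferentiableAt (𝓡 n) 𝓘(ℝ) f p) (v : TangentSpace (𝓡 n) p) :
    diff (fun q => -f q) p v = -diff f p v :=
  diff_eq_of_hasFDerivAt hf.neg (hasFDerivAt_comp_chart_symm hf).neg v

theorem diff_sub_apply (hf : MDifferentiableAt (𝓡 n) 𝓘(ℝ) f p)
    (hg : MDifferentiableAt (𝓡 n) 𝓘(ℝ) g p) (v : TangentSpace (𝓡 n) p) :
    diff (fun q => f q - g q) p v = diff f p v - diff g p v :=
  diff_eq_of_hasFDerivAt (hf.sub hg)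
    ((hasFDerivAt_comp_chart_symm hf).sub (hasFDerivAt_comp_chart_symm hg)) v

theorem diff_mul_apply (hf : MDifferentiableAt (𝓡 n) 𝓘(ℝ) f p)
    (hg : MDifferentiableAt (𝓡 n) 𝓘(ℝ) g p) (v : TangentSpace (𝓡 n) p) :
    diff (fun q => f q * g q) p v = f p * diff g p v + g p * diff f p v := by
  have h := (hasFDerivAt_comp_chart_symm hf).mul (hasFDerivAt_comp_chart_symm hg)
  rw [comp_chart_symm_apply, comp_chart_symm_apply] at h
  exact diff_eq_of_hasFDerivAt (hf.mul hg) h v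

theorem diff_inv_apply (hf : MDifferentiableAt (𝓡 n) 𝓘(ℝ) f p) (h0 : f p ≠ 0)
    (v : TangentSpace (𝓡 n) p) :
    diff (fun q => (f q)⁻¹) p v = -(f p ^ 2)⁻¹ * diff f p v := by
  have h := ((hasDerivAt_inv (x := (f ∘ (chart n p).symm) (chart n p p))
    (by rwa [comp_chart_symm_apply])).comp_hasFDerivAt (chart n p p)
      (hasFDerivAt_comp_chart_symm hf))
  rw [comp_chart_symm_apply] at h
  exact diff_eq_of_hasFDerivAt (((hasDerivAt_inv h0).hasFDerivAt.hasMFDerivAt.comp p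
    hf.hasMFDerivAt).mdifferentiableAt) h v

end Rules

theorem pullback_diff [IsManifold (𝓡 n) ∞ M] [IsManifold (𝓡 m) ∞ N] {F : M → N} {f : N → ℝ} {p : M}
    (hF : MDifferentiableAt (𝓡 n) (𝓡 m) F p) (hf : MDifferentiableAt (𝓡 m) 𝓘(ℝ) f (F p)) :
    pullback (n := n) F (diff (n := m) f) p = diff (n := n) (f ∘ F) p :=
  (mfderiv_comp p hf hF).symm

/-! ### Dual vectors and coefficients -/

/-- Independence of finitely many functions on `V` means that their joint values span ℝ^ι. For
linear functions the set of joint values is already a subspace, so every vector of ℝ^ι is attained.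
-/
theorem exists_dual_vectors {V ι : Type*} [AddCommGroup V] [Module ℝ V] [TopologicalSpace V]
    [Finite ι] [DecidableEq ι] {ρ : ι → V →L[ℝ] ℝ} (h : LinearIndependent ℝ ρ) :
    ∃ v : ι → V, ∀ i j, ρ i (v j) = if i = j then 1 else 0 := by
  have h' : LinearIndependent ℝ (fun i => (ρ i : V → ℝ)) :=
    h.map' (⟨⟨fun f => f, fun _ _ => rfl⟩, fun _ _ => rfl⟩ : (V →L[ℝ] ℝ) →ₗ[ℝ] V → ℝ)
      (LinearMap.ker_eq_bot.2 DFunLike.coe_injective)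
  rw [← span_flip_eq_top_iff_linearIndependent] at h'
  have hr : Set.range (fun (x : V) (i : ι) => ρ i x)
      = (LinearMap.range (LinearMap.pi fun i => (ρ i : V →ₗ[ℝ] ℝ)) : Set (ι → ℝ)) := by
    ext; simp [funext_iff]
  have hs : ∀ c : ι → ℝ, ∃ x : V, ∀ i, ρ i x = c i := by
    intro c
    have hc : c ∈ Submodule.span ℝ (Set.range (fun (x : V) (i : ι) => ρ i x)) := by
      have : Submodule.span ℝ (Set.range (fun (x : V) (i : ι) => ρ i x)) = ⊤ := h'
      rw [this]; trivial
    rw [hr, Submodule.span_eq] at hc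
    obtain ⟨x, hx⟩ := hc
    exact ⟨x, fun i => congrFun hx i⟩
  choose v hv using fun j : ι => hs (fun i => if i = j then 1 else 0)
  exact ⟨v, fun i j => hv j i⟩

theorem contDiffAt_matrix_det {E ι : Type*} [NormedAddCommGroup E] [NormedSpace ℝ E] [Fintype ι]
    [DecidableEq ι] {W : E → Matrix ι ι ℝ} {u : E}
    (h : ∀ i j, ContDiffAt ℝ ∞ (fun z => W z i j) u) : ContDiffAt ℝ ∞ (fun z => (W z).det) u := by
  simp only [Matrix.det_apply]
  refine ContDiffAt.sum fun σ _ => ContDiffAt.const_smul _ ?_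
  exact contDiffAt_prod fun i _ => h _ _

/-- The coefficients of a smooth form with respect to independent smooth forms are smooth. -/
theorem contMDiff_coefficient [IsManifold (𝓡 n) ∞ M] {ι : Type*} [Fintype ι] [DecidableEq ι]
    {ρ : ι → OneForm n M} (hρ : ∀ i, IsSmooth (ρ i))
    (hi : ∀ p, LinearIndependent ℝ (fun i => ρ i p)) {η : OneForm n M} (hη : IsSmooth η)
    {s : ι → M → ℝ} (hs : ∀ p, η p = ∑ i, s i p • ρ i p) (i : ι) :
    ContMDiff (𝓡 n) 𝓘(ℝ) ∞ (s i) := by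
  intro p
  apply contMDiffAt_of_contDiffAt_comp_chart_symm
  obtain ⟨v, hv⟩ : ∃ v : ι → EuclideanSpace ℝ (Fin n),
      ∀ i j, ρ i p (v j) = if i = j then 1 else 0 := exists_dual_vectors (hi p)
  set e := chart n p with he
  set u := e p with hu
  have hm : e ∈ atlas (EuclideanSpace ℝ (Fin n)) M := chart_mem_atlas _ p
  have ht : u ∈ e.target := mem_chart_target _ p
  set W : EuclideanSpace ℝ (Fin n) → Matrix ι ι ℝ := fun z i j => inChart (ρ i) e z (v j) with hW
  have hWs : ∀ i j, ContDiffAt ℝ ∞ (fun z => W z i j) u := fun i j =>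
    ((hρ i).contDiffAt hm ht).clm_apply contDiffAt_const
  have hys : ∀ j, ContDiffAt ℝ ∞ (fun z => inChart η e z (v j)) u := fun j =>
    (hη.contDiffAt hm ht).clm_apply contDiffAt_const
  have hW1 : W u = 1 := by
    ext i j
    rw [Matrix.one_apply, ← hv i j]
    exact congrArg (fun L : EuclideanSpace ℝ (Fin n) →L[ℝ] ℝ => L (v j)) (inChart_chart_apply _ p)
  have hdet := contDiffAt_matrix_det hWs
  have hdet0 : (W u).det ≠ 0 := by rw [hW1]; simp
  -- Cramer's rule. The vectors `v j` are dual at `p` and kept constant in the chart, so the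
  -- coefficient is a quotient of two determinants of smooth functions, with denominator 1 at `p`.
  have hnum : ContDiffAt ℝ ∞
      (fun z => ((W z).updateRow i (fun j => inChart η e z (v j))).det) u := by
    refine contDiffAt_matrix_det fun k j => ?_
    by_cases hk : k = i
    · subst hk
      simpa using hys j
    · simpa [Matrix.updateRow_ne hk] using hWs k j
  refine (hnum.mul (hdet.inv hdet0)).congr_of_eventuallyEq ?_
  filter_upwards [hdet.continuousAt.eventually_ne hdet0] with z hz
  have hrow : (fun j => inChart η e z (v j)) = ∑ k, s k (e.symm z) • W z k := by
    funext j
    have := congrArg (fun L : EuclideanSpace ℝ (Fin n) →L[ℝ] ℝ =>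
      (L.comp (mfderiv (𝓡 n) (𝓡 n) e.symm z :
        EuclideanSpace ℝ (Fin n) →L[ℝ] EuclideanSpace ℝ (Fin n))) (v j)) (hs (e.symm z))
    refine Eq.trans this ?_
    rw [Finset.sum_apply]
    exact sum_apply (F := EuclideanSpace ℝ (Fin n) →L[ℝ] ℝ) _ _ _
  rw [hrow, Matrix.det_updateRow_sum]
  simp [hz]

/-! ### The inverse function theorem on manifolds -/

variable {N' : Type*} [TopologicalSpace N'] [ChartedSpace (EuclideanSpace ℝ (Fin n)) N']

/-- An injective endomorphism of ℝⁿ is invertible, so the inverse function theorem applies to the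
expression of `F` in charts. -/
theorem exists_openPartialHomeomorph_of_mfderiv_injective [IsManifold (𝓡 n) ∞ M]
    [IsManifold (𝓡 n) ∞ N'] {F : M → N'} {p : M} {U : Set M} (hU : IsOpen U) (hp : p ∈ U)
    (hF : ContMDiffOn (𝓡 n) (𝓡 n) ∞ F U)
    (hi : Function.Injective (mfderiv (𝓡 n) (𝓡 n) F p)) :
    ∃ Φ : OpenPartialHomeomorph M N', p ∈ Φ.source ∧ Φ.source ⊆ U ∧ EqOn F Φ Φ.source ∧
      ContMDiffOn (𝓡 n) (𝓡 n) ∞ Φ Φ.source ∧ ContMDiffOn (𝓡 n) (𝓡 n) ∞ Φ.symm Φ.target := by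
  set e := chart n p
  set e' := chart n (F p)
  have hm : e ∈ atlas (EuclideanSpace ℝ (Fin n)) M := chart_mem_atlas _ _
  have hm' : e' ∈ atlas (EuclideanSpace ℝ (Fin n)) N' := chart_mem_atlas _ _
  set V : Set M := U ∩ F ⁻¹' e'.source
  have hV : IsOpen V := hF.continuousOn.isOpen_inter_preimage hU e'.open_source
  set W : Set (EuclideanSpace ℝ (Fin n)) := e.target ∩ e.symm ⁻¹' V
  have hW : IsOpen W := e.symm.isOpen_inter_preimage hV
  set g : EuclideanSpace ℝ (Fin n) → EuclideanSpace ℝ (Fin n) := e' ∘ F ∘ e.symm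
  have hFat : ∀ q ∈ U, ContMDiffAt (𝓡 n) (𝓡 n) ∞ F q := fun q hq =>
    hF.contMDiffAt (hU.mem_nhds hq)
  have hg : ∀ z ∈ W, ContDiffAt ℝ ∞ g z := fun z hz =>
    ((contMDiffAt_of_mem_maximalAtlas (IsManifold.subset_maximalAtlas hm') hz.2.2).comp z
      ((hFat _ hz.2.1).comp z (contMDiffAt_symm_of_mem_maximalAtlas
        (IsManifold.subset_maximalAtlas hm) hz.1))).contDiffAt
  have hpW : e p ∈ W := by
    refine ⟨mem_chart_target _ p, ?_⟩
    rw [mem_preimage, e.left_inv (mem_chart_source _ p)]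
    exact ⟨hp, mem_chart_source _ _⟩
  have hd0 : fderiv ℝ g (e p) = mfderiv (𝓡 n) (𝓡 n) F p := by
    refine Eq.symm (((hFat p hp).mdifferentiableAt (by simp)).mfderiv.trans ?_)
    simp only [writtenInExtChartAt, extChartAt, mfld_simps, fderivWithin_univ]
    rfl
  have hinj : Function.Injective (fderiv ℝ g (e p)) := by rw [hd0]; exact hi
  have hunit : IsUnit (fderiv ℝ g (e p)) := by
    let L := (LinearEquiv.ofInjectiveEndo (fderiv ℝ g (e p) : EuclideanSpace ℝ (Fin n) →ₗ[ℝ]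
      EuclideanSpace ℝ (Fin n)) hinj).toContinuousLinearEquiv
    have : fderiv ℝ g (e p) = L := by ext v; rfl
    rw [this]
    exact ⟨ContinuousLinearEquiv.toUnit L, rfl⟩
  have hcont : ContinuousOn (fderiv ℝ g) W := fun z hz =>
    ((hg z hz).fderiv_right (m := 0) (by simp)).continuousAt.continuousWithinAt
  -- The source is cut down to points with invertible derivative, so that the inverse is smooth on
  -- the whole target and not only at the image of `p`.
  set W' : Set (EuclideanSpace ℝ (Fin n)) := W ∩ fderiv ℝ g ⁻¹' {L | IsUnit L}
  have hW' : IsOpen W' := hcont.isOpen_inter_preimage hW Units.isOpen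
  have hequiv : ∀ z ∈ W', ∃ L : EuclideanSpace ℝ (Fin n) ≃L[ℝ] EuclideanSpace ℝ (Fin n),
      HasFDerivAt g (L : EuclideanSpace ℝ (Fin n) →L[ℝ] EuclideanSpace ℝ (Fin n)) z := by
    intro z hz
    obtain ⟨x, hx⟩ := hz.2
    refine ⟨ContinuousLinearEquiv.ofUnit x, ?_⟩
    have h2 := ((hg z hz.1).differentiableAt (by simp)).hasFDerivAt
    rw [← hx] at h2
    exact h2
  obtain ⟨L₀, hL₀⟩ := hequiv (e p) ⟨hpW, hunit⟩
  set G := ((hg _ hpW).toOpenPartialHomeomorph g hL₀ (by simp)).restrOpen W' hW' with hG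
  have hGs : ∀ z ∈ G.source, z ∈ W' := fun z hz => hz.2
  have hGe : ∀ z, G z = g z := fun z => rfl
  set Φ := (e.trans G).trans e'.symm with hΦ
  have hsrc : ∀ q ∈ Φ.source, q ∈ e.source ∧ e q ∈ G.source ∧ q ∈ V := by
    intro q hq
    have h1 : q ∈ e.source ∧ e q ∈ G.source := hq.1
    refine ⟨h1.1, h1.2, ?_⟩
    have := (hGs _ h1.2).1.2
    rwa [mem_preimage, e.left_inv h1.1] at this
  have heq : EqOn F Φ Φ.source := by
    intro q hq
    obtain ⟨h1, h2, h3⟩ := hsrc q hq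
    change F q = e'.symm (e' (F (e.symm (e q))))
    rw [e.left_inv h1, e'.left_inv h3.2]
  refine ⟨Φ, ?_, fun q hq => (hsrc q hq).2.2.1, heq, ?_, ?_⟩
  · refine ⟨⟨mem_chart_source _ p, ?_, hpW, hunit⟩, ?_⟩
    · exact (hg _ hpW).mem_toOpenPartialHomeomorph_source hL₀ (by simp)
    · change e' (F (e.symm (e p))) ∈ e'.target
      rw [e.left_inv (mem_chart_source _ p)]
      exact mem_chart_target _ _
  · exact (hF.mono fun q hq => (hsrc q hq).2.2.1).congr fun q hq => (heq hq).symm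
  · intro y hy
    have h1 : y ∈ e'.source := hy.1
    have h2 : e' y ∈ G.target := hy.2.1
    have h3 : G.symm (e' y) ∈ e.target := hy.2.2
    obtain ⟨L, hL⟩ := hequiv _ (hGs _ (G.map_target h2))
    have hGsymm : ContDiffAt ℝ ∞ G.symm (e' y) :=
      G.contDiffAt_symm h2 hL (hg _ (hGs _ (G.map_target h2)).1)
    exact ((contMDiffAt_symm_of_mem_maximalAtlas (IsManifold.subset_maximalAtlas hm) h3).comp y
      (hGsymm.contMDiffAt.comp y (contMDiffAt_of_mem_maximalAtlas
        (IsManifold.subset_maximalAtlas hm') h1))).contMDiffWithinAt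

theorem isLocalDiffeomorph_of_mfderiv_injective [IsManifold (𝓡 n) ∞ M]
    [IsManifold (𝓡 n) ∞ N'] {F : M → N'} (hF : ContMDiff (𝓡 n) (𝓡 n) ∞ F)
    (hi : ∀ p, Function.Injective (mfderiv (𝓡 n) (𝓡 n) F p)) :
    IsLocalDiffeomorph (𝓡 n) (𝓡 n) ∞ F := by
  intro p
  obtain ⟨Φ, hp, -, heq, h1, h2⟩ := exists_openPartialHomeomorph_of_mfderiv_injective isOpen_univ
    (mem_univ p) hF.contMDiffOn (hi p)
  exact ⟨⟨Φ.toPartialEquiv, Φ.open_source, Φ.open_target, h1, h2⟩, hp, heq⟩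

end Differentials

section Etale

open Set

/-! ### Manifolds étale over a Euclidean space -/

variable {n : ℕ} {X : Type*} [TopologicalSpace X] {f : X → EuclideanSpace ℝ (Fin n)}

/-- The charted space structure in which the charts are the local restrictions of `f`. -/
@[reducible] def etaleChartedSpace (hf : IsLocalHomeomorph f) :
    ChartedSpace (EuclideanSpace ℝ (Fin n)) X where
  atlas := {e | f = e}
  chartAt x := (hf x).choose
  mem_chart_source x := (hf x).choose_spec.1
  chart_mem_atlas x := (hf x).choose_spec.2

/-- All charts are restrictions of the one map `f`, so the transition maps are identities. -/
theorem isManifold_etale (hf : IsLocalHomeomorph f) :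
    @IsManifold ℝ _ _ _ _ _ _ (𝓡 n) ∞ X _ (etaleChartedSpace hf) := by
  let := etaleChartedSpace hf
  refine isManifold_of_contDiffOn _ _ _ fun e e' he he' => ?_
  refine contDiffOn_id.congr fun u hu => ?_
  have he : f = e := he
  have he' : f = e' := he'
  simp only [mfld_simps] at hu ⊢
  rw [← he', he]
  exact e.right_inv hu.1

theorem contMDiff_etale (hf : IsLocalHomeomorph f) :
    @ContMDiff ℝ _ _ _ _ _ _ (𝓡 n) X _ (etaleChartedSpace hf) _ _ _ _ _ (𝓡 n) _ _ _ ∞ f := by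
  let := etaleChartedSpace hf
  have := isManifold_etale hf
  intro p
  have h : f = chart n p := (hf p).choose_spec.2
  have := contMDiffAt_of_mem_maximalAtlas (I := 𝓡 n) (n := ∞) (IsManifold.chart_mem_maximalAtlas p)
    (mem_chart_source (EuclideanSpace ℝ (Fin n)) p)
  exact this.congr_of_eventuallyEq (.of_forall fun q => congrFun h q)

theorem mfderiv_etale_injective (hf : IsLocalHomeomorph f) (p : X) :
    letI := etaleChartedSpace hf
    Function.Injective (mfderiv (𝓡 n) (𝓡 n) f p) := by
  let := etaleChartedSpace hf
  have := isManifold_etale hf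
  have : IsManifold (𝓡 n) 1 X := IsManifold.of_le (n := ∞) (by simp)
  have h : f = chart n p := (hf p).choose_spec.2
  have hi := (mdifferentiable_chart (I := 𝓡 n) p).mfderiv_injective
    (mem_chart_source (EuclideanSpace ℝ (Fin n)) p)
  have heq : (mfderiv (𝓡 n) (𝓡 n) f p : EuclideanSpace ℝ (Fin n) →L[ℝ] EuclideanSpace ℝ (Fin n))
      = mfderiv (𝓡 n) (𝓡 n) (chart n p) p :=
    Filter.EventuallyEq.mfderiv_eq (.of_forall fun q => congrFun h q)
  intro v w hvw
  refine hi ?_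
  have := congrArg (fun L : EuclideanSpace ℝ (Fin n) →L[ℝ] EuclideanSpace ℝ (Fin n) => L v) heq
  have h2 := congrArg (fun L : EuclideanSpace ℝ (Fin n) →L[ℝ] EuclideanSpace ℝ (Fin n) => L w) heq
  exact this.symm.trans (Eq.trans hvw h2)

/-- A family of open subsets of a Euclidean space, as a disjoint union. -/
def Sheets (n : ℕ) {I : Type*} (U : I → TopologicalSpace.Opens (EuclideanSpace ℝ (Fin n))) :
    Type _ := Σ i, U i

namespace Sheets

variable {I : Type*} {U : I → TopologicalSpace.Opens (EuclideanSpace ℝ (Fin n))}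

instance : TopologicalSpace (Sheets n U) := inferInstanceAs (TopologicalSpace (Σ i, U i))

instance : T2Space (Sheets n U) := inferInstanceAs (T2Space (Σ i, U i))

instance [Countable I] : SecondCountableTopology (Sheets n U) :=
  inferInstanceAs (SecondCountableTopology (Σ i, U i))

/-- The étale map to the Euclidean space. -/
def pt (x : Sheets n U) : EuclideanSpace ℝ (Fin n) := x.2

/-- The sheet of a point. -/
def idx (x : Sheets n U) : I := x.1

theorem pt_mem (x : Sheets n U) : x.pt ∈ U x.idx := x.2.2

theorem isOpen_idx_eq (s : Set I) : IsOpen {x : Sheets n U | x.idx ∈ s} := by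
  refine isOpen_sigma_iff.2 fun i => ?_
  by_cases h : i ∈ s
  · convert isOpen_univ
    exact eq_univ_of_forall fun _ => h
  · convert isOpen_empty
    exact eq_empty_of_forall_notMem fun _ h' => h h'

theorem isLocalHomeomorph_pt : IsLocalHomeomorph (pt : Sheets n U → EuclideanSpace ℝ (Fin n)) := by
  apply IsLocalHomeomorph.mk
  rintro ⟨i, u⟩
  have h1 := Topology.IsOpenEmbedding.sigmaMk (σ := fun i => ↥(U i)) (i := i)
  have h2 : Topology.IsOpenEmbedding (Subtype.val : U i → EuclideanSpace ℝ (Fin n)) :=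
    (U i).isOpen.isOpenEmbedding_subtypeVal
  have : Nonempty (U i) := ⟨u⟩
  refine ⟨(h1.toOpenPartialHomeomorph _).symm.trans (h2.toOpenPartialHomeomorph _), ?_, ?_⟩
  · simp only [mfld_simps]
    exact ⟨u, rfl⟩
  · rintro x hx
    obtain ⟨j, z⟩ := x
    have hj : (⟨j, z⟩ : Σ i, U i) ∈ range (Sigma.mk i) := by simpa only [mfld_simps] using hx.1
    obtain rfl : j = i := by rwa [range_sigmaMk] at hj
    change z.1 = ((h1.toOpenPartialHomeomorph _).symm ⟨j, z⟩).1
    have := (h1.toOpenPartialHomeomorph _).left_inv (x := z) (by simp)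
    simp only [Topology.IsOpenEmbedding.toOpenPartialHomeomorph_apply] at this
    rw [this]

instance : ChartedSpace (EuclideanSpace ℝ (Fin n)) (Sheets n U) :=
  etaleChartedSpace isLocalHomeomorph_pt

instance : IsManifold (𝓡 n) ∞ (Sheets n U) := isManifold_etale isLocalHomeomorph_pt

theorem contMDiff_pt : ContMDiff (𝓡 n) (𝓡 n) ∞ (pt : Sheets n U → EuclideanSpace ℝ (Fin n)) :=
  contMDiff_etale isLocalHomeomorph_pt

theorem mfderiv_pt_injective (x : Sheets n U) :
    Function.Injective (mfderiv (𝓡 n) (𝓡 n) (pt : Sheets n U → EuclideanSpace ℝ (Fin n)) x) :=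
  mfderiv_etale_injective isLocalHomeomorph_pt x

theorem contMDiff_coord (k : Fin n) : ContMDiff (𝓡 n) 𝓘(ℝ) ∞ (fun x : Sheets n U => x.pt k) :=
  (EuclideanSpace.proj k : EuclideanSpace ℝ (Fin n) →L[ℝ] ℝ).contDiff.contMDiff.comp contMDiff_pt

theorem eq_zero_of_diff_coord (x : Sheets n U) {v : TangentSpace (𝓡 n) x}
    (h : ∀ k, diff (fun x : Sheets n U => x.pt k) x v = 0) : v = 0 := by
  refine (injective_iff_map_eq_zero _).1 (mfderiv_pt_injective x) v ?_
  have key : ∀ k, (mfderiv (𝓡 n) (𝓡 n) (pt : Sheets n U → EuclideanSpace ℝ (Fin n)) x v :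
      EuclideanSpace ℝ (Fin n)).ofLp k = 0 := by
    intro k
    rw [← h k]
    have h1 : MDifferentiableAt (𝓡 n) (𝓡 n) (pt : Sheets n U → EuclideanSpace ℝ (Fin n)) x :=
      contMDiff_pt.mdifferentiable (by simp) x
    have h2 := ((EuclideanSpace.proj k : EuclideanSpace ℝ (Fin n) →L[ℝ] ℝ).hasFDerivAt
      (x := x.pt)).hasMFDerivAt.comp x h1.hasMFDerivAt
    exact congrArg (fun L : EuclideanSpace ℝ (Fin n) →L[ℝ] ℝ => L v) h2.mfderiv.symm
  exact PiLp.ext key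

/-- Assemble a map into a disjoint union of open sets from its sheet and its value. -/
def mk (i : I) (u : EuclideanSpace ℝ (Fin n)) (h : u ∈ U i) : Sheets n U := ⟨i, u, h⟩

theorem ext_of_eq {x y : Sheets n U} (h : x.idx = y.idx) (h' : x.pt = y.pt) : x = y := by
  obtain ⟨i, u⟩ := x
  obtain ⟨j, w⟩ := y
  obtain rfl : i = j := h
  obtain rfl : u = w := Subtype.ext h'
  rfl

theorem nhds_eq (x : Sheets n U) : nhds x = Filter.comap pt (nhds x.pt) ⊓
    Filter.principal {y | y.idx = x.idx} := by
  obtain ⟨i, u⟩ := x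
  have h1 := Topology.IsOpenEmbedding.sigmaMk (σ := fun i => ↥(U i)) (i := i)
  refine (h1.map_nhds_eq u).symm.trans ?_
  rw [nhds_subtype_eq_comap]
  ext s
  rw [Filter.mem_map, Filter.mem_comap]
  refine Iff.trans ?_ Filter.mem_inf_principal.symm
  rw [Filter.mem_comap]
  constructor
  · rintro ⟨t, ht, hts⟩
    refine ⟨t, ht, ?_⟩
    rintro ⟨j, w⟩ hw (rfl : j = i)
    exact hts hw
  · rintro ⟨t, ht, hts⟩
    exact ⟨t, ht, fun w hw => @hts (⟨i, w⟩ : Σ i, U i) hw rfl⟩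

variable {m : ℕ} {M : Type*} [TopologicalSpace M] [ChartedSpace (EuclideanSpace ℝ (Fin m)) M]

/-- A map that stays locally on one sheet is as smooth as its composition with the étale map, whose
local inverses are charts. -/
theorem contMDiff_of_pt {F : M → Sheets n U} (hF : ContMDiff (𝓡 m) (𝓡 n) ∞ fun q => (F q).pt)
    (hi : ∀ q, ∀ᶠ q' in nhds q, (F q').idx = (F q).idx) : ContMDiff (𝓡 m) (𝓡 n) ∞ F := by
  intro q
  have hc : ContinuousAt F q := by
    rw [ContinuousAt, nhds_eq, Filter.tendsto_inf, Filter.tendsto_comap_iff,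
      Filter.tendsto_principal]
    exact ⟨(hF q).continuousAt, hi q⟩
  set e := chart n (F q)
  have he : (pt : Sheets n U → EuclideanSpace ℝ (Fin n)) = e :=
    ((isLocalHomeomorph_pt (U := U)) (F q)).choose_spec.2
  have hs : F q ∈ e.source := mem_chart_source _ _
  have h1 : ContMDiffAt (𝓡 n) (𝓡 n) ∞ e.symm (e (F q)) :=
    contMDiffAt_symm_of_mem_maximalAtlas (IsManifold.chart_mem_maximalAtlas _) (e.map_source hs)
  have h2 : ContMDiffAt (𝓡 m) (𝓡 n) ∞ (fun q => e (F q)) q := by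
    have := hF q
    rwa [show (fun q => (F q).pt) = fun q => e (F q) from funext fun q => congrFun he (F q)] at this
  refine (h1.comp q h2).congr_of_eventuallyEq ?_
  filter_upwards [hc.preimage_mem_nhds (e.open_source.mem_nhds hs)] with z hz
  exact (e.left_inv hz).symm

end Sheets

end Etale

section FlatEquations

variable {P : Type*} [TopologicalSpace P] [ChartedSpace (EuclideanSpace ℝ (Fin 11)) P]

/-! ### The structure equations, written out -/

theorem HasExtDerivAt.const_smul {n : ℕ} {M : Type*} [TopologicalSpace M]
    [ChartedSpace (EuclideanSpace ℝ (Fin n)) M] {p : M} {η : OneForm n M}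
    {ρ : TangentSpace (𝓡 n) p → TangentSpace (𝓡 n) p → ℝ} (h : HasExtDerivAt η p ρ) (c : ℝ) :
    HasExtDerivAt (c • η) p (fun v w => c * ρ v w) :=
  hasExtDerivAt_of_hasFDerivAt (h.1.hasFDerivAt.const_smul c) fun v w => by
    rw [← h.fderiv_sub_eq]
    simp only [smul_apply, smul_eq_mul]
    ring

theorem IsSmooth.const_smul {n : ℕ} {M : Type*} [TopologicalSpace M]
    [ChartedSpace (EuclideanSpace ℝ (Fin n)) M] {η : OneForm n M} (h : IsSmooth η) (c : ℝ) :
    IsSmooth (c • η) :=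
  fun e he => (h e he).const_smul c

theorem isSmooth_zero {n : ℕ} {M : Type*} [TopologicalSpace M]
    [ChartedSpace (EuclideanSpace ℝ (Fin n)) M] : IsSmooth (0 : OneForm n M) := by
  intro e he
  refine (contDiffOn_const (c := 0)).congr fun u hu => ?_
  ext v
  rfl

theorem hasExtDerivAt_zero {n : ℕ} {M : Type*} [TopologicalSpace M]
    [ChartedSpace (EuclideanSpace ℝ (Fin n)) M] {p : M} :
    HasExtDerivAt (0 : OneForm n M) p (fun _ _ => 0) := by
  have h : inChart (0 : OneForm n M) (chart n p) = fun _ => 0 := by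
    funext u; ext v; rfl
  refine hasExtDerivAt_of_hasFDerivAt (D := 0) ?_ (by simp)
  rw [h]
  exact hasFDerivAt_const _ _

/-- Raising an index with the split metric exchanges rows 1 and 2, and rows 3 and 4. -/
theorem gamma_eq (Ω : Fin 6 → OneForm 11 P) (A : OneForm 11 P) :
    gamma Ω A = ![![-Ω 0 + (1 / 2 : ℝ) • A, 0, Ω 2, Ω 4],
      ![0, Ω 0 + (1 / 2 : ℝ) • A, Ω 1, Ω 3],
      ![-Ω 3, -Ω 4, -Ω 5 + (1 / 2 : ℝ) • A, 0],
      ![-Ω 1, -Ω 2, 0, Ω 5 + (1 / 2 : ℝ) • A]] := by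
  funext i j
  fin_cases i <;> fin_cases j <;>
    simp [gamma, gammaLow, gammaSkew, splitMetric, Fin.sum_univ_four]

/-- The structure equations, written out on pairs of tangent vectors. -/
structure ExplicitFlat (θ : Fin 4 → OneForm 11 P) (Ω : Fin 6 → OneForm 11 P) (A : OneForm 11 P) :
    Prop where
  dθ0 : ∀ q v w, extD (θ 0) q v w = wedge (Ω 0) (θ 0) q v w - 1 / 2 * wedge A (θ 0) q v w
    - wedge (Ω 2) (θ 2) q v w - wedge (Ω 4) (θ 3) q v w
  dθ1 : ∀ q v w, extD (θ 1) q v w = -wedge (Ω 0) (θ 1) q v w - 1 / 2 * wedge A (θ 1) q v w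
    - wedge (Ω 1) (θ 2) q v w - wedge (Ω 3) (θ 3) q v w
  dθ2 : ∀ q v w, extD (θ 2) q v w = wedge (Ω 3) (θ 0) q v w + wedge (Ω 4) (θ 1) q v w
    + wedge (Ω 5) (θ 2) q v w - 1 / 2 * wedge A (θ 2) q v w
  dθ3 : ∀ q v w, extD (θ 3) q v w = wedge (Ω 1) (θ 0) q v w + wedge (Ω 2) (θ 1) q v w
    - wedge (Ω 5) (θ 3) q v w - 1 / 2 * wedge A (θ 3) q v w
  dΩ0 : ∀ q v w, extD (Ω 0) q v w = wedge (Ω 1) (Ω 4) q v w + wedge (Ω 3) (Ω 2) q v w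
  dΩ1 : ∀ q v w, extD (Ω 1) q v w = -wedge (Ω 0) (Ω 1) q v w + wedge (Ω 1) (Ω 5) q v w
  dΩ2 : ∀ q v w, extD (Ω 2) q v w = wedge (Ω 0) (Ω 2) q v w + wedge (Ω 2) (Ω 5) q v w
  dΩ3 : ∀ q v w, extD (Ω 3) q v w = -wedge (Ω 0) (Ω 3) q v w - wedge (Ω 3) (Ω 5) q v w
  dΩ4 : ∀ q v w, extD (Ω 4) q v w = wedge (Ω 0) (Ω 4) q v w - wedge (Ω 4) (Ω 5) q v w
  dΩ5 : ∀ q v w, extD (Ω 5) q v w = wedge (Ω 1) (Ω 4) q v w + wedge (Ω 2) (Ω 3) q v w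
  dA : ∀ q v w, extD A q v w = 0

variable {θ : Fin 4 → OneForm 11 P} {Ω : Fin 6 → OneForm 11 P} {A : OneForm 11 P}

theorem forall_fin_four {p : Fin 4 → Prop} : (∀ i, p i) ↔ p 0 ∧ p 1 ∧ p 2 ∧ p 3 := by
  constructor
  · exact fun h => ⟨h 0, h 1, h 2, h 3⟩
  · rintro ⟨h0, h1, h2, h3⟩ i
    fin_cases i <;> assumption

theorem twoForm_add_eq_zero_iff {a b : TwoForm 11 P} :
    a + b = 0 ↔ ∀ q v w, a q v w + b q v w = 0 := by
  constructor
  · intro h q v w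
    exact congrFun (congrFun (congrFun h q) v) w
  · intro h
    funext q v w
    exact h q v w

theorem sum_wedge_apply (a b : Fin 4 → OneForm 11 P) (q : P) (v w : TangentSpace (𝓡 11) q) :
    (∑ j, wedge (a j) (b j)) q v w = wedge (a 0) (b 0) q v w + wedge (a 1) (b 1) q v w
      + wedge (a 2) (b 2) q v w + wedge (a 3) (b 3) q v w := by
  rw [Fin.sum_univ_four]
  rfl

/-- The sixteen equations for Γ repeat each other because Γ is skew up to its trace, and eleven
equations remain in all. Smoothness is used to expand `extD` of the combinations of Ω and A. -/
theorem flatEquations_iff (hΩ : ∀ μ, IsSmooth (Ω μ)) (hA : IsSmooth A) :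
    FlatEquations θ Ω A ↔ ExplicitFlat θ Ω A := by
  have eΩ : ∀ μ q, HasExtDerivAt (Ω μ) q (extD (Ω μ) q) := fun μ q => (hΩ μ).hasExtDerivAt q
  have eA : ∀ q, HasExtDerivAt ((1 / 2 : ℝ) • A) q _ := fun q =>
    (hA.hasExtDerivAt q).const_smul (1 / 2)
  have z0 : ∀ q v w, extD (0 : OneForm 11 P) q v w = 0 := fun q => hasExtDerivAt_zero.2
  have eneg : ∀ μ q v w, extD (-Ω μ) q v w = -extD (Ω μ) q v w := fun μ q => (eΩ μ q).neg.2
  have eadd : ∀ μ q v w, extD (Ω μ + (1 / 2 : ℝ) • A) q v w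
      = extD (Ω μ) q v w + 1 / 2 * extD A q v w := fun μ q => ((eΩ μ q).add (eA q)).2
  have esub : ∀ μ q v w, extD (-Ω μ + (1 / 2 : ℝ) • A) q v w
      = -extD (Ω μ) q v w + 1 / 2 * extD A q v w := fun μ q => ((eΩ μ q).neg.add (eA q)).2
  have w1 : ∀ (a b : OneForm 11 P) q v w, wedge (-a) b q v w = -wedge a b q v w := by
    intro a b q v w
    change -a q v * b q w - -a q w * b q v = -(a q v * b q w - a q w * b q v)
    ring
  have w2 : ∀ (a b : OneForm 11 P) q v w, wedge a (-b) q v w = -wedge a b q v w := by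
    intro a b q v w
    change a q v * -b q w - a q w * -b q v = -(a q v * b q w - a q w * b q v)
    ring
  have w3 : ∀ (a b c : OneForm 11 P) q v w,
      wedge (a + b) c q v w = wedge a c q v w + wedge b c q v w := by
    intro a b c q v w
    change (a q v + b q v) * c q w - (a q w + b q w) * c q v
      = (a q v * c q w - a q w * c q v) + (b q v * c q w - b q w * c q v)
    ring
  have w4 : ∀ (a b c : OneForm 11 P) q v w,
      wedge c (a + b) q v w = wedge c a q v w + wedge c b q v w := by
    intro a b c q v w
    change c q v * (a q w + b q w) - c q w * (a q v + b q v)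
      = (c q v * a q w - c q w * a q v) + (c q v * b q w - c q w * b q v)
    ring
  have w5 : ∀ (r : ℝ) (a b : OneForm 11 P) q v w, wedge (r • a) b q v w = r * wedge a b q v w := by
    intro r a b q v w
    change (r * a q v) * b q w - (r * a q w) * b q v = r * (a q v * b q w - a q w * b q v)
    ring
  have w6 : ∀ (r : ℝ) (a b : OneForm 11 P) q v w, wedge a (r • b) q v w = r * wedge a b q v w := by
    intro r a b q v w
    change a q v * (r * b q w) - a q w * (r * b q v) = r * (a q v * b q w - a q w * b q v)
    ring
  have w7 : ∀ (a : OneForm 11 P) q v w, wedge 0 a q v w = 0 := by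
    intro a q v w
    change 0 * a q w - 0 * a q v = 0
    ring
  have w8 : ∀ (a : OneForm 11 P) q v w, wedge a 0 q v w = 0 := by
    intro a q v w
    change a q v * 0 - a q w * 0 = 0
    ring
  have w9 : ∀ (a : OneForm 11 P) q v w, wedge a a q v w = 0 := by
    intro a q v w
    change a q v * a q w - a q w * a q v = 0
    ring
  have w10 : ∀ (a b : OneForm 11 P) q v w, wedge a b q v w = -wedge b a q v w := by
    intro a b q v w
    change a q v * b q w - a q w * b q v = -(b q v * a q w - b q w * a q v)
    ring
  unfold FlatEquations
  simp only [twoForm_add_eq_zero_iff, sum_wedge_apply, gamma_eq, forall_fin_four, Fin.isValue,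
    Matrix.cons_val, Matrix.cons_val_zero, Matrix.cons_val_one,
    w1, w2, w3, w4, w5, w6, w7, w8, w9, eneg, eadd, esub, z0]
  constructor
  · rintro ⟨⟨t0, t1, t2, t3⟩, ⟨g00, g01, g02, g03⟩, ⟨g10, g11, g12, g13⟩, ⟨g20, g21, g22, g23⟩,
      g30, g31, g32, g33⟩
    -- In the sum of the first two diagonal equations Ω₁ and all quadratic terms cancel, which
    -- leaves dA = 0.
    have hdA : ∀ q v w, extD A q v w = 0 := fun q v w => by
      linarith [g00 q v w, g11 q v w, w10 (Ω 2) (Ω 3) q v w, w10 (Ω 4) (Ω 1) q v w,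
        w10 A (Ω 0) q v w]
    constructor
    · intro q v w; linarith [t0 q v w]
    · intro q v w; linarith [t1 q v w]
    · intro q v w; linarith [t2 q v w]
    · intro q v w; linarith [t3 q v w]
    · intro q v w; linarith [g11 q v w, hdA q v w, w10 A (Ω 0) q v w]
    · intro q v w; linarith [g12 q v w, w10 A (Ω 1) q v w]
    · intro q v w; linarith [g02 q v w, w10 A (Ω 2) q v w]
    · intro q v w; linarith [g13 q v w, w10 A (Ω 3) q v w]
    · intro q v w; linarith [g03 q v w, w10 A (Ω 4) q v w]
    · intro q v w; linarith [g33 q v w, hdA q v w, w10 A (Ω 5) q v w]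
    · exact hdA
  · intro h
    refine ⟨⟨?_, ?_, ?_, ?_⟩, ⟨?_, ?_, ?_, ?_⟩, ⟨?_, ?_, ?_, ?_⟩, ⟨?_, ?_, ?_, ?_⟩, ?_, ?_, ?_, ?_⟩ <;>
      intro q v w <;>
      linarith [h.dθ0 q v w, h.dθ1 q v w, h.dθ2 q v w, h.dθ3 q v w, h.dΩ0 q v w, h.dΩ1 q v w,
        h.dΩ2 q v w, h.dΩ3 q v w, h.dΩ4 q v w, h.dΩ5 q v w, h.dA q v w, w10 (Ω 0) A q v w,
        w10 (Ω 5) A q v w, w10 (Ω 1) A q v w,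
        w10 (Ω 2) A q v w, w10 (Ω 3) A q v w, w10 (Ω 4) A q v w, w10 (Ω 2) (Ω 3) q v w,
        w10 (Ω 4) (Ω 1) q v w, w10 (Ω 0) (Ω 1) q v w, w10 (Ω 0) (Ω 2) q v w, w10 (Ω 0) (Ω 3) q v w,
        w10 (Ω 0) (Ω 4) q v w, w10 (Ω 5) (Ω 1) q v w, w10 (Ω 5) (Ω 2) q v w, w10 (Ω 5) (Ω 3) q v w,
        w10 (Ω 5) (Ω 4) q v w, w10 (Ω 1) (Ω 2) q v w, w10 (Ω 3) (Ω 4) q v w,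
        w10 (Ω 2) (Ω 4) q v w, w10 (Ω 1) (Ω 3) q v w]

end FlatEquations

/-! ### The model forms in coordinates -/

/-- The model forms are built from terms f dg, so df ∧ dg and the product rule are all that is
needed to differentiate them. -/
theorem HasExtDerivAt.smul_diff {n : ℕ} {M : Type*} [TopologicalSpace M]
    [ChartedSpace (EuclideanSpace ℝ (Fin n)) M] [IsManifold (𝓡 n) ∞ M] {f g : M → ℝ} {p : M}
    (hf : ContMDiff (𝓡 n) 𝓘(ℝ) ∞ f) (hg : ContMDiff (𝓡 n) 𝓘(ℝ) ∞ g) :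
    HasExtDerivAt (fun q => f q • ParaCR.diff g q : OneForm n M) p
      (fun v w => ParaCR.diff f p v * ParaCR.diff g p w - ParaCR.diff f p w * ParaCR.diff g p v) := by
  have h := HasExtDerivAt.smul (p := p) (hf.mdifferentiable (by simp) p) (HasExtDerivAt.diff hg)
  exact ⟨h.1, fun v w => by rw [h.2]; ring⟩

/-- Functions which serve as the coordinates of the eleven-dimensional model. -/
structure ModelCoords (Q : Type*) where
  (X Y A0 A1 A2 A3 a p q m n : Q → ℝ)

namespace ModelCoords

section Forms

variable {Q : Type*} [TopologicalSpace Q] [ChartedSpace (EuclideanSpace ℝ (Fin 11)) Q]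

/-- Smoothness of the coordinates, and nonvanishing of `a`, `p`, `q`. -/
structure IsAdmissible (c : ModelCoords Q) : Prop where
  X : ContMDiff (𝓡 11) 𝓘(ℝ) ∞ c.X
  Y : ContMDiff (𝓡 11) 𝓘(ℝ) ∞ c.Y
  A0 : ContMDiff (𝓡 11) 𝓘(ℝ) ∞ c.A0
  A1 : ContMDiff (𝓡 11) 𝓘(ℝ) ∞ c.A1
  A2 : ContMDiff (𝓡 11) 𝓘(ℝ) ∞ c.A2
  A3 : ContMDiff (𝓡 11) 𝓘(ℝ) ∞ c.A3
  a : ContMDiff (𝓡 11) 𝓘(ℝ) ∞ c.a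
  p : ContMDiff (𝓡 11) 𝓘(ℝ) ∞ c.p
  q : ContMDiff (𝓡 11) 𝓘(ℝ) ∞ c.q
  m : ContMDiff (𝓡 11) 𝓘(ℝ) ∞ c.m
  n : ContMDiff (𝓡 11) 𝓘(ℝ) ∞ c.n
  a_ne : ∀ z, c.a z ≠ 0
  p_ne : ∀ z, c.p z ≠ 0
  q_ne : ∀ z, c.q z ≠ 0

variable (c : ModelCoords Q)

/-- The function `r = -pq/a`. -/
def r : Q → ℝ := fun z => -(c.p z * c.q z * (c.a z)⁻¹)

/-- `λ = dA₀ + X dA₁ + Y dA₂ + XY dA₃`. -/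
def lam : OneForm 11 Q :=
  diff c.A0 + (fun z => c.X z • diff c.A1 z) + (fun z => c.Y z • diff c.A2 z)
    + (fun z => (c.X z * c.Y z) • diff c.A3 z)

/-- `dA₁ + Y dA₃ + mλ`. -/
def zeta1 : OneForm 11 Q :=
  diff c.A1 + (fun z => c.Y z • diff c.A3 z) + (fun z => c.m z • c.lam z)

/-- `dA₂ + X dA₃ + nλ`. -/
def zeta2 : OneForm 11 Q :=
  diff c.A2 + (fun z => c.X z • diff c.A3 z) + (fun z => c.n z • c.lam z)

/-- `dA₃ + n (dA₁ + Y dA₃) + m (dA₂ + X dA₃) + mnλ`. -/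
def zeta3 : OneForm 11 Q :=
  diff c.A3 + (fun z => c.n z • diff c.A1 z) + (fun z => (c.n z * c.Y z) • diff c.A3 z)
    + (fun z => c.m z • c.zeta2 z)

/-- The model forms `(θ¹, θ², θ³, θ⁴)`. -/
def theta : Fin 4 → OneForm 11 Q :=
  ![fun z => c.p z • c.zeta1 z, fun z => c.q z • c.zeta2 z, fun z => c.r z • c.zeta3 z,
    fun z => c.a z • c.lam z]

/-- The form `d log p`. -/
def dlogp : OneForm 11 Q := fun z => (c.p z)⁻¹ • diff c.p z

/-- The form `d log q`. -/
def dlogq : OneForm 11 Q := fun z => (c.q z)⁻¹ • diff c.q z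

/-- The model forms `(Ω₁, …, Ω₆)`. -/
def Omega : Fin 6 → OneForm 11 Q :=
  ![(1 / 2 : ℝ) • c.dlogp - (1 / 2 : ℝ) • c.dlogq + (fun z => c.m z • diff c.X z)
      - (fun z => c.n z • diff c.Y z),
    fun z => (c.a z * (c.p z)⁻¹) • diff c.X z,
    fun z => (c.a z * (c.q z)⁻¹) • diff c.Y z,
    -((fun z => (c.q z * (c.a z)⁻¹) • diff c.n z)
      - fun z => (c.q z * (c.a z)⁻¹ * (c.n z * c.n z)) • diff c.Y z),
    -((fun z => (c.p z * (c.a z)⁻¹) • diff c.m z)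
      - fun z => (c.p z * (c.a z)⁻¹ * (c.m z * c.m z)) • diff c.X z),
    (1 / 2 : ℝ) • c.dlogp + (1 / 2 : ℝ) • c.dlogq + (fun z => c.m z • diff c.X z)
      + (fun z => c.n z • diff c.Y z) - fun z => (c.a z)⁻¹ • diff c.a z]

/-- The model form `A`. -/
def A : OneForm 11 Q := -(c.dlogp + c.dlogq)

variable {c}

theorem contMDiff_inv {f : Q → ℝ} (hf : ContMDiff (𝓡 11) 𝓘(ℝ) ∞ f) (h : ∀ z, f z ≠ 0) :
    ContMDiff (𝓡 11) 𝓘(ℝ) ∞ (fun z => (f z)⁻¹) :=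
  fun z => (contDiffAt_inv ℝ (h z)).contMDiffAt.comp z (hf z)

namespace IsAdmissible

theorem ainv (hc : c.IsAdmissible) : ContMDiff (𝓡 11) 𝓘(ℝ) ∞ (fun z => (c.a z)⁻¹) := contMDiff_inv hc.a hc.a_ne

theorem pinv (hc : c.IsAdmissible) : ContMDiff (𝓡 11) 𝓘(ℝ) ∞ (fun z => (c.p z)⁻¹) := contMDiff_inv hc.p hc.p_ne

theorem qinv (hc : c.IsAdmissible) : ContMDiff (𝓡 11) 𝓘(ℝ) ∞ (fun z => (c.q z)⁻¹) := contMDiff_inv hc.q hc.q_ne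

theorem r (hc : c.IsAdmissible) : ContMDiff (𝓡 11) 𝓘(ℝ) ∞ c.r := ((hc.p.mul hc.q).mul hc.ainv).neg

theorem dX (hc : c.IsAdmissible) (z : Q) : MDifferentiableAt (𝓡 11) 𝓘(ℝ) c.X z :=
  hc.X.mdifferentiable (by simp) z

theorem dY (hc : c.IsAdmissible) (z : Q) : MDifferentiableAt (𝓡 11) 𝓘(ℝ) c.Y z :=
  hc.Y.mdifferentiable (by simp) z

theorem da (hc : c.IsAdmissible) (z : Q) : MDifferentiableAt (𝓡 11) 𝓘(ℝ) c.a z :=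
  hc.a.mdifferentiable (by simp) z

theorem dp (hc : c.IsAdmissible) (z : Q) : MDifferentiableAt (𝓡 11) 𝓘(ℝ) c.p z :=
  hc.p.mdifferentiable (by simp) z

theorem dq (hc : c.IsAdmissible) (z : Q) : MDifferentiableAt (𝓡 11) 𝓘(ℝ) c.q z :=
  hc.q.mdifferentiable (by simp) z

theorem dm (hc : c.IsAdmissible) (z : Q) : MDifferentiableAt (𝓡 11) 𝓘(ℝ) c.m z :=
  hc.m.mdifferentiable (by simp) z

theorem dn (hc : c.IsAdmissible) (z : Q) : MDifferentiableAt (𝓡 11) 𝓘(ℝ) c.n z :=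
  hc.n.mdifferentiable (by simp) z

/-- Logarithmic derivative of -pq/a. -/
theorem diff_r (hc : c.IsAdmissible) (z : Q) (v : TangentSpace (𝓡 11) z) :
    diff c.r z v = c.r z * ((c.p z)⁻¹ * diff c.p z v + (c.q z)⁻¹ * diff c.q z v
      - (c.a z)⁻¹ * diff c.a z v) := by
  have h1 : MDifferentiableAt (𝓡 11) 𝓘(ℝ) (fun z => c.p z * c.q z) z := (hc.dp z).mul (hc.dq z)
  have h2 : MDifferentiableAt (𝓡 11) 𝓘(ℝ) (fun z => (c.a z)⁻¹) z :=
    hc.ainv.mdifferentiable (by simp) z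
  have h3 : MDifferentiableAt (𝓡 11) 𝓘(ℝ) (fun z => c.p z * c.q z * (c.a z)⁻¹) z := h1.mul h2
  have ha := hc.a_ne z
  have hp := hc.p_ne z
  have hq := hc.q_ne z
  unfold ModelCoords.r
  rw [diff_neg_apply h3, diff_mul_apply h1 h2, diff_mul_apply (hc.dp z) (hc.dq z),
    diff_inv_apply (hc.da z) ha]
  field_simp
  ring

variable [IsManifold (𝓡 11) ∞ Q]

theorem isSmooth_lam (hc : c.IsAdmissible) : IsSmooth c.lam :=
  (((IsSmooth.diff hc.A0).add ((IsSmooth.diff hc.A1).smul hc.X)).add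
    ((IsSmooth.diff hc.A2).smul hc.Y)).add ((IsSmooth.diff hc.A3).smul (hc.X.mul hc.Y))

theorem isSmooth_dlogp (hc : c.IsAdmissible) : IsSmooth c.dlogp := (IsSmooth.diff hc.p).smul hc.pinv

theorem isSmooth_dlogq (hc : c.IsAdmissible) : IsSmooth c.dlogq := (IsSmooth.diff hc.q).smul hc.qinv

theorem isSmooth_A (hc : c.IsAdmissible) : IsSmooth c.A := (hc.isSmooth_dlogp.add hc.isSmooth_dlogq).neg

theorem isSmooth_Omega (hc : c.IsAdmissible) (μ : Fin 6) : IsSmooth (c.Omega μ) := by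
  have sX := IsSmooth.diff hc.X
  have sY := IsSmooth.diff hc.Y
  have sp := hc.isSmooth_dlogp.const_smul (1 / 2)
  have sq := hc.isSmooth_dlogq.const_smul (1 / 2)
  fin_cases μ
  · exact ((sp.sub sq).add (sX.smul hc.m)).sub (sY.smul hc.n)
  · exact sX.smul (hc.a.mul hc.pinv)
  · exact sY.smul (hc.a.mul hc.qinv)
  · exact (((IsSmooth.diff hc.n).smul (hc.q.mul hc.ainv)).sub
      (sY.smul ((hc.q.mul hc.ainv).mul (hc.n.mul hc.n)))).neg
  · exact (((IsSmooth.diff hc.m).smul (hc.p.mul hc.ainv)).sub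
      (sX.smul ((hc.p.mul hc.ainv).mul (hc.m.mul hc.m)))).neg
  · exact (((sp.add sq).add (sX.smul hc.m)).add (sY.smul hc.n)).sub
      ((IsSmooth.diff hc.a).smul hc.ainv)

theorem hasExtDerivAt_lam (hc : c.IsAdmissible) (z : Q) :
    HasExtDerivAt c.lam z fun v w =>
      diff c.X z v * (diff c.A1 z w + c.Y z * diff c.A3 z w)
        - diff c.X z w * (diff c.A1 z v + c.Y z * diff c.A3 z v)
        + diff c.Y z v * (diff c.A2 z w + c.X z * diff c.A3 z w)
        - diff c.Y z w * (diff c.A2 z v + c.X z * diff c.A3 z v) := by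
  have h := (((HasExtDerivAt.diff (p := z) hc.A0).add (HasExtDerivAt.smul_diff hc.X hc.A1)).add
    (HasExtDerivAt.smul_diff hc.Y hc.A2)).add 
      (HasExtDerivAt.smul_diff (f := fun z => c.X z * c.Y z) (hc.X.mul hc.Y) hc.A3)
  refine ⟨h.1, fun v w => (h.2 v w).trans ?_⟩
  beta_reduce
  rw [diff_mul_apply (hc.dX z) (hc.dY z), diff_mul_apply (hc.dX z) (hc.dY z)]
  ring

end IsAdmissible

end Forms

end ModelCoords

theorem wedge_apply {n : ℕ} {M : Type*} [TopologicalSpace M]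
    [ChartedSpace (EuclideanSpace ℝ (Fin n)) M] (α β : OneForm n M) (z : M)
    (v w : TangentSpace (𝓡 n) z) : wedge α β z v w = α z v * β z w - α z w * β z v := rfl

namespace ModelCoords

variable {Q : Type*} [TopologicalSpace Q] [ChartedSpace (EuclideanSpace ℝ (Fin 11)) Q]
  {c : ModelCoords Q}

theorem lam_apply (z : Q) (v : TangentSpace (𝓡 11) z) : c.lam z v = diff c.A0 z v
    + c.X z * diff c.A1 z v + c.Y z * diff c.A2 z v + (c.X z * c.Y z) * diff c.A3 z v := rfl

theorem zeta1_apply (z : Q) (v : TangentSpace (𝓡 11) z) : c.zeta1 z v = diff c.A1 z v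
    + c.Y z * diff c.A3 z v + c.m z * c.lam z v := rfl

theorem zeta2_apply (z : Q) (v : TangentSpace (𝓡 11) z) : c.zeta2 z v = diff c.A2 z v
    + c.X z * diff c.A3 z v + c.n z * c.lam z v := rfl

theorem zeta3_apply (z : Q) (v : TangentSpace (𝓡 11) z) : c.zeta3 z v = diff c.A3 z v
    + c.n z * diff c.A1 z v + (c.n z * c.Y z) * diff c.A3 z v + c.m z * c.zeta2 z v := rfl

theorem theta0_apply (z : Q) (v : TangentSpace (𝓡 11) z) :
    c.theta 0 z v = c.p z * c.zeta1 z v := rfl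

theorem theta1_apply (z : Q) (v : TangentSpace (𝓡 11) z) :
    c.theta 1 z v = c.q z * c.zeta2 z v := rfl

theorem theta2_apply (z : Q) (v : TangentSpace (𝓡 11) z) :
    c.theta 2 z v = c.r z * c.zeta3 z v := rfl

theorem theta3_apply (z : Q) (v : TangentSpace (𝓡 11) z) :
    c.theta 3 z v = c.a z * c.lam z v := rfl

theorem Omega0_apply (z : Q) (v : TangentSpace (𝓡 11) z) :
    c.Omega 0 z v = 1 / 2 * ((c.p z)⁻¹ * diff c.p z v) - 1 / 2 * ((c.q z)⁻¹ * diff c.q z v)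
      + c.m z * diff c.X z v - c.n z * diff c.Y z v := rfl

theorem Omega1_apply (z : Q) (v : TangentSpace (𝓡 11) z) :
    c.Omega 1 z v = c.a z * (c.p z)⁻¹ * diff c.X z v := rfl

theorem Omega2_apply (z : Q) (v : TangentSpace (𝓡 11) z) :
    c.Omega 2 z v = c.a z * (c.q z)⁻¹ * diff c.Y z v := rfl

theorem Omega3_apply (z : Q) (v : TangentSpace (𝓡 11) z) :
    c.Omega 3 z v = -(c.q z * (c.a z)⁻¹ * diff c.n z v
      - c.q z * (c.a z)⁻¹ * (c.n z * c.n z) * diff c.Y z v) := rfl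

theorem Omega4_apply (z : Q) (v : TangentSpace (𝓡 11) z) :
    c.Omega 4 z v = -(c.p z * (c.a z)⁻¹ * diff c.m z v
      - c.p z * (c.a z)⁻¹ * (c.m z * c.m z) * diff c.X z v) := rfl

theorem Omega5_apply (z : Q) (v : TangentSpace (𝓡 11) z) :
    c.Omega 5 z v = 1 / 2 * ((c.p z)⁻¹ * diff c.p z v) + 1 / 2 * ((c.q z)⁻¹ * diff c.q z v)
      + c.m z * diff c.X z v + c.n z * diff c.Y z v - (c.a z)⁻¹ * diff c.a z v := rfl

theorem A_apply (z : Q) (v : TangentSpace (𝓡 11) z) :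
    c.A z v = -((c.p z)⁻¹ * diff c.p z v + (c.q z)⁻¹ * diff c.q z v) := rfl

/-! ### Verification of the structure equations for the model forms. -/

namespace IsAdmissible

theorem dainv (hc : c.IsAdmissible) (z : Q) :
    MDifferentiableAt (𝓡 11) 𝓘(ℝ) (fun z => (c.a z)⁻¹) z :=
  hc.ainv.mdifferentiable (by simp) z

theorem dpinv (hc : c.IsAdmissible) (z : Q) :
    MDifferentiableAt (𝓡 11) 𝓘(ℝ) (fun z => (c.p z)⁻¹) z :=
  hc.pinv.mdifferentiable (by simp) z

theorem dqinv (hc : c.IsAdmissible) (z : Q) :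
    MDifferentiableAt (𝓡 11) 𝓘(ℝ) (fun z => (c.q z)⁻¹) z :=
  hc.qinv.mdifferentiable (by simp) z

variable [IsManifold (𝓡 11) ∞ Q]

theorem isSmooth_zeta1 (hc : c.IsAdmissible) : IsSmooth c.zeta1 :=
  ((IsSmooth.diff hc.A1).add ((IsSmooth.diff hc.A3).smul hc.Y)).add (hc.isSmooth_lam.smul hc.m)

theorem isSmooth_zeta2 (hc : c.IsAdmissible) : IsSmooth c.zeta2 :=
  ((IsSmooth.diff hc.A2).add ((IsSmooth.diff hc.A3).smul hc.X)).add (hc.isSmooth_lam.smul hc.n)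

theorem hasExtDerivAt_zeta1 (hc : c.IsAdmissible) (z : Q) :
    HasExtDerivAt c.zeta1 z fun v w =>
      diff c.Y z v * diff c.A3 z w - diff c.Y z w * diff c.A3 z v
        + diff c.m z v * c.lam z w - diff c.m z w * c.lam z v + c.m z * extD c.lam z v w := by
  have h := ((HasExtDerivAt.diff (p := z) hc.A1).add (HasExtDerivAt.smul_diff hc.Y hc.A3)).add
    ((hc.isSmooth_lam.hasExtDerivAt z).smul (hc.dm z))
  exact ⟨h.1, fun v w => (h.2 v w).trans (by ring)⟩

theorem hasExtDerivAt_zeta2 (hc : c.IsAdmissible) (z : Q) :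
    HasExtDerivAt c.zeta2 z fun v w =>
      diff c.X z v * diff c.A3 z w - diff c.X z w * diff c.A3 z v
        + diff c.n z v * c.lam z w - diff c.n z w * c.lam z v + c.n z * extD c.lam z v w := by
  have h := ((HasExtDerivAt.diff (p := z) hc.A2).add (HasExtDerivAt.smul_diff hc.X hc.A3)).add
    ((hc.isSmooth_lam.hasExtDerivAt z).smul (hc.dn z))
  exact ⟨h.1, fun v w => (h.2 v w).trans (by ring)⟩

theorem hasExtDerivAt_zeta3 (hc : c.IsAdmissible) (z : Q) :
    HasExtDerivAt c.zeta3 z fun v w =>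
      diff c.n z v * (diff c.A1 z w + c.Y z * diff c.A3 z w)
        - diff c.n z w * (diff c.A1 z v + c.Y z * diff c.A3 z v)
        + c.n z * (diff c.Y z v * diff c.A3 z w - diff c.Y z w * diff c.A3 z v)
        + diff c.m z v * c.zeta2 z w - diff c.m z w * c.zeta2 z v
        + c.m z * extD c.zeta2 z v w := by
  have h := (((HasExtDerivAt.diff (p := z) hc.A3).add (HasExtDerivAt.smul_diff hc.n hc.A1)).add
    (HasExtDerivAt.smul_diff (f := fun z => c.n z * c.Y z) (hc.n.mul hc.Y) hc.A3)).add
    ((hc.isSmooth_zeta2.hasExtDerivAt z).smul (hc.dm z))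
  refine ⟨h.1, fun v w => (h.2 v w).trans ?_⟩
  beta_reduce
  rw [diff_mul_apply (hc.dn z) (hc.dY z), diff_mul_apply (hc.dn z) (hc.dY z)]
  ring

theorem isSmooth_zeta3 (hc : c.IsAdmissible) : IsSmooth c.zeta3 :=
  (((IsSmooth.diff hc.A3).add ((IsSmooth.diff hc.A1).smul hc.n)).add
    ((IsSmooth.diff hc.A3).smul (hc.n.mul hc.Y))).add (hc.isSmooth_zeta2.smul hc.m)

theorem isSmooth_theta (hc : c.IsAdmissible) (i : Fin 4) : IsSmooth (c.theta i) := by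
  fin_cases i
  · exact hc.isSmooth_zeta1.smul hc.p
  · exact hc.isSmooth_zeta2.smul hc.q
  · exact hc.isSmooth_zeta3.smul hc.r
  · exact hc.isSmooth_lam.smul hc.a

/-- Once every form is written through the differentials of the coordinates and the denominators a,
p, q are cleared, both sides are the same polynomial in the values of these differentials on `v` and
`w`. -/
theorem extD_theta (hc : c.IsAdmissible) (z : Q) (v w : TangentSpace (𝓡 11) z) :
    (extD (c.theta 0) z v w = wedge (c.Omega 0) (c.theta 0) z v w
      - 1 / 2 * wedge c.A (c.theta 0) z v w
      - wedge (c.Omega 2) (c.theta 2) z v w - wedge (c.Omega 4) (c.theta 3) z v w) ∧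
    (extD (c.theta 1) z v w = -wedge (c.Omega 0) (c.theta 1) z v w
      - 1 / 2 * wedge c.A (c.theta 1) z v w
      - wedge (c.Omega 1) (c.theta 2) z v w - wedge (c.Omega 3) (c.theta 3) z v w) := by
  have ha := hc.a_ne z
  have hp := hc.p_ne z
  have hq := hc.q_ne z
  have e0 := ((hc.isSmooth_zeta1.hasExtDerivAt z).smul (hc.dp z)).2 v w
  have e1 := ((hc.isSmooth_zeta2.hasExtDerivAt z).smul (hc.dq z)).2 v w
  constructor
  · refine e0.trans ?_
    beta_reduce
    simp only [(hc.hasExtDerivAt_zeta1 z).2, (hc.hasExtDerivAt_lam z).2,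
      wedge_apply, theta0_apply, theta2_apply, theta3_apply, Omega0_apply, Omega2_apply,
      Omega4_apply, A_apply, zeta1_apply, zeta3_apply, zeta2_apply, lam_apply, ModelCoords.r]
    field_simp
    ring
  · refine e1.trans ?_
    beta_reduce
    simp only [(hc.hasExtDerivAt_zeta2 z).2, (hc.hasExtDerivAt_lam z).2,
      wedge_apply, theta1_apply, theta2_apply, theta3_apply, Omega0_apply, Omega1_apply,
      Omega3_apply, A_apply, zeta3_apply, zeta2_apply, lam_apply, ModelCoords.r]
    field_simp
    ring

theorem extD_theta' (hc : c.IsAdmissible) (z : Q) (v w : TangentSpace (𝓡 11) z) :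
    (extD (c.theta 2) z v w = wedge (c.Omega 3) (c.theta 0) z v w
      + wedge (c.Omega 4) (c.theta 1) z v w
      + wedge (c.Omega 5) (c.theta 2) z v w - 1 / 2 * wedge c.A (c.theta 2) z v w) ∧
    (extD (c.theta 3) z v w = wedge (c.Omega 1) (c.theta 0) z v w
      + wedge (c.Omega 2) (c.theta 1) z v w
      - wedge (c.Omega 5) (c.theta 3) z v w - 1 / 2 * wedge c.A (c.theta 3) z v w) := by
  have ha := hc.a_ne z
  have hp := hc.p_ne z
  have hq := hc.q_ne z
  have e2 := ((hc.isSmooth_zeta3.hasExtDerivAt z).smul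
    (hc.r.mdifferentiable (by simp) z)).2 v w
  have e3 := ((hc.isSmooth_lam.hasExtDerivAt z).smul (hc.da z)).2 v w
  constructor
  · refine e2.trans ?_
    beta_reduce
    simp only [(hc.hasExtDerivAt_zeta3 z).2, (hc.hasExtDerivAt_zeta2 z).2,
      (hc.hasExtDerivAt_lam z).2, hc.diff_r, wedge_apply, theta0_apply, theta1_apply, theta2_apply,
      Omega3_apply, Omega4_apply, Omega5_apply, A_apply, zeta1_apply, zeta3_apply, zeta2_apply,
      lam_apply, ModelCoords.r]
    field_simp
    ring
  · refine e3.trans ?_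
    beta_reduce
    simp only [(hc.hasExtDerivAt_lam z).2, wedge_apply, theta0_apply, theta1_apply, theta3_apply,
      Omega1_apply, Omega2_apply, Omega5_apply, A_apply, zeta1_apply, zeta2_apply, lam_apply]
    field_simp
    ring

theorem hasExtDerivAt_dlogp (hc : c.IsAdmissible) (z : Q) :
    HasExtDerivAt c.dlogp z fun _ _ => 0 := by
  have h := HasExtDerivAt.smul_diff (p := z) hc.pinv hc.p
  refine ⟨h.1, fun v w => (h.2 v w).trans ?_⟩
  simp only [diff_inv_apply (hc.dp z) (hc.p_ne z)]
  ring

theorem hasExtDerivAt_dlogq (hc : c.IsAdmissible) (z : Q) :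
    HasExtDerivAt c.dlogq z fun _ _ => 0 := by
  have h := HasExtDerivAt.smul_diff (p := z) hc.qinv hc.q
  refine ⟨h.1, fun v w => (h.2 v w).trans ?_⟩
  simp only [diff_inv_apply (hc.dq z) (hc.q_ne z)]
  ring

theorem extD_A (hc : c.IsAdmissible) (z : Q) (v w : TangentSpace (𝓡 11) z) :
    extD c.A z v w = 0 :=
  (((hc.hasExtDerivAt_dlogp z).add (hc.hasExtDerivAt_dlogq z)).neg.2 v w).trans (by simp)

theorem extD_Omega05 (hc : c.IsAdmissible) (z : Q) (v w : TangentSpace (𝓡 11) z) :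
    (extD (c.Omega 0) z v w = wedge (c.Omega 1) (c.Omega 4) z v w
      + wedge (c.Omega 3) (c.Omega 2) z v w) ∧
    (extD (c.Omega 5) z v w = wedge (c.Omega 1) (c.Omega 4) z v w
      + wedge (c.Omega 2) (c.Omega 3) z v w) := by
  have ha := hc.a_ne z
  have hp := hc.p_ne z
  have hq := hc.q_ne z
  have ep := (hc.hasExtDerivAt_dlogp z).const_smul (1 / 2)
  have eq := (hc.hasExtDerivAt_dlogq z).const_smul (1 / 2)
  have e0 := ((ep.sub eq).add (HasExtDerivAt.smul_diff hc.m hc.X)).sub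
    (HasExtDerivAt.smul_diff hc.n hc.Y)
  have e5 := (((ep.add eq).add (HasExtDerivAt.smul_diff hc.m hc.X)).add
    (HasExtDerivAt.smul_diff hc.n hc.Y)).sub (HasExtDerivAt.smul_diff hc.ainv hc.a)
  constructor
  · refine (e0.2 v w).trans ?_
    simp only [wedge_apply, Omega1_apply, Omega2_apply, Omega3_apply, Omega4_apply]
    field_simp
    ring
  · refine (e5.2 v w).trans ?_
    simp only [wedge_apply, Omega1_apply, Omega2_apply, Omega3_apply, Omega4_apply,
      diff_inv_apply (hc.da z) ha]
    field_simp
    ring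

theorem extD_Omega12 (hc : c.IsAdmissible) (z : Q) (v w : TangentSpace (𝓡 11) z) :
    (extD (c.Omega 1) z v w = -wedge (c.Omega 0) (c.Omega 1) z v w
      + wedge (c.Omega 1) (c.Omega 5) z v w) ∧
    (extD (c.Omega 2) z v w = wedge (c.Omega 0) (c.Omega 2) z v w
      + wedge (c.Omega 2) (c.Omega 5) z v w) := by
  have ha := hc.a_ne z
  have hp := hc.p_ne z
  have hq := hc.q_ne z
  have e1 := HasExtDerivAt.smul_diff (p := z) (f := fun z => c.a z * (c.p z)⁻¹)
    (hc.a.mul hc.pinv) hc.X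
  have e2 := HasExtDerivAt.smul_diff (p := z) (f := fun z => c.a z * (c.q z)⁻¹)
    (hc.a.mul hc.qinv) hc.Y
  constructor
  · refine (e1.2 v w).trans ?_
    simp only [wedge_apply, Omega0_apply, Omega1_apply, Omega5_apply,
      diff_mul_apply (hc.da z) (hc.dpinv z), diff_inv_apply (hc.dp z) hp]
    field_simp
    ring
  · refine (e2.2 v w).trans ?_
    simp only [wedge_apply, Omega0_apply, Omega2_apply, Omega5_apply,
      diff_mul_apply (hc.da z) (hc.dqinv z), diff_inv_apply (hc.dq z) hq]
    field_simp
    ring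

theorem extD_Omega34 (hc : c.IsAdmissible) (z : Q) (v w : TangentSpace (𝓡 11) z) :
    (extD (c.Omega 3) z v w = -wedge (c.Omega 0) (c.Omega 3) z v w
      - wedge (c.Omega 3) (c.Omega 5) z v w) ∧
    (extD (c.Omega 4) z v w = wedge (c.Omega 0) (c.Omega 4) z v w
      - wedge (c.Omega 4) (c.Omega 5) z v w) := by
  have ha := hc.a_ne z
  have hp := hc.p_ne z
  have hq := hc.q_ne z
  have hqa : MDifferentiableAt (𝓡 11) 𝓘(ℝ) (fun z => c.q z * (c.a z)⁻¹) z :=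
    (hc.dq z).mul (hc.dainv z)
  have hpa : MDifferentiableAt (𝓡 11) 𝓘(ℝ) (fun z => c.p z * (c.a z)⁻¹) z :=
    (hc.dp z).mul (hc.dainv z)
  have hnn : MDifferentiableAt (𝓡 11) 𝓘(ℝ) (fun z => c.n z * c.n z) z := (hc.dn z).mul (hc.dn z)
  have hmm : MDifferentiableAt (𝓡 11) 𝓘(ℝ) (fun z => c.m z * c.m z) z := (hc.dm z).mul (hc.dm z)
  have e3 := ((HasExtDerivAt.smul_diff (p := z) (f := fun z => c.q z * (c.a z)⁻¹)
    (hc.q.mul hc.ainv) hc.n).sub (HasExtDerivAt.smul_diff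
      (f := fun z => c.q z * (c.a z)⁻¹ * (c.n z * c.n z))
      ((hc.q.mul hc.ainv).mul (hc.n.mul hc.n)) hc.Y)).neg
  have e4 := ((HasExtDerivAt.smul_diff (p := z) (f := fun z => c.p z * (c.a z)⁻¹)
    (hc.p.mul hc.ainv) hc.m).sub (HasExtDerivAt.smul_diff
      (f := fun z => c.p z * (c.a z)⁻¹ * (c.m z * c.m z))
      ((hc.p.mul hc.ainv).mul (hc.m.mul hc.m)) hc.X)).neg
  constructor
  · refine (e3.2 v w).trans ?_
    simp only [wedge_apply, Omega0_apply, Omega3_apply, Omega5_apply, diff_mul_apply hqa hnn,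
      diff_mul_apply (hc.dq z) (hc.dainv z), diff_mul_apply (hc.dn z) (hc.dn z),
      diff_inv_apply (hc.da z) ha]
    field_simp
    ring
  · refine (e4.2 v w).trans ?_
    simp only [wedge_apply, Omega0_apply, Omega4_apply, Omega5_apply, diff_mul_apply hpa hmm,
      diff_mul_apply (hc.dp z) (hc.dainv z), diff_mul_apply (hc.dm z) (hc.dm z),
      diff_inv_apply (hc.da z) ha]
    field_simp
    ring

/-- The reason behind the computation is that λζ₃ - ζ₁ζ₂ = dA₀dA₃ - dA₁dA₂, whatever X, Y, m, n are.
With r = -pq/a this gives 2θ¹θ² + 2θ³θ⁴ = -2pq (dA₀dA₃ - dA₁dA₂). Thus θ is a null coframe of a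
multiple of a constant metric, Γ is the flat connection of ℝ⁴ in this frame, and A = -d log(pq)
records the conformal factor. -/
theorem explicitFlat (hc : c.IsAdmissible) : ExplicitFlat c.theta c.Omega c.A where
  dθ0 q v w := (hc.extD_theta q v w).1
  dθ1 q v w := (hc.extD_theta q v w).2
  dθ2 q v w := (hc.extD_theta' q v w).1
  dθ3 q v w := (hc.extD_theta' q v w).2
  dΩ0 q v w := (hc.extD_Omega05 q v w).1
  dΩ1 q v w := (hc.extD_Omega12 q v w).1
  dΩ2 q v w := (hc.extD_Omega12 q v w).2
  dΩ3 q v w := (hc.extD_Omega34 q v w).1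
  dΩ4 q v w := (hc.extD_Omega34 q v w).2
  dΩ5 q v w := (hc.extD_Omega05 q v w).2
  dA q v w := hc.extD_A q v w

end IsAdmissible

end ModelCoords

/-! ### The model coframe -/

/-- With n forms on ℝⁿ the joint evaluation map is injective if and only if it is surjective. -/
theorem linearIndependent_iff_forall_eq_zero {n : ℕ} {ι : Type*} [Fintype ι]
    {ρ : ι → EuclideanSpace ℝ (Fin n) →L[ℝ] ℝ} (hn : Fintype.card ι = n) :
    LinearIndependent ℝ ρ ↔ ∀ v, (∀ i, ρ i v = 0) → v = 0 := by
  classical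
  have hd : Module.finrank ℝ (EuclideanSpace ℝ (Fin n)) = Module.finrank ℝ (ι → ℝ) := by
    simp [hn]
  let T : EuclideanSpace ℝ (Fin n) →ₗ[ℝ] (ι → ℝ) := LinearMap.pi fun i => (ρ i).toLinearMap
  have hT : (∀ v, (∀ i, ρ i v = 0) → v = 0) ↔ Function.Injective T := by
    rw [injective_iff_map_eq_zero]
    exact forall_congr' fun v => ⟨fun h h0 => h fun i => congrFun h0 i,
      fun h h0 => h (funext fun i => h0 i)⟩
  rw [hT, LinearMap.injective_iff_surjective_of_finrank_eq_finrank hd]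
  constructor
  · intro h f
    obtain ⟨v, hv⟩ := exists_dual_vectors h
    refine ⟨∑ j, f j • v j, funext fun i => ?_⟩
    change ρ i (∑ j, f j • v j) = f i
    simp [hv]
  · intro h
    rw [Fintype.linearIndependent_iff]
    intro g hg i
    obtain ⟨v, hv⟩ := h (Pi.single i 1)
    have h1 := congrArg (fun L : EuclideanSpace ℝ (Fin n) →L[ℝ] ℝ => L v) hg
    have h2 : ∀ j, ρ j v = (Pi.single i 1 : ι → ℝ) j := fun j => congrFun hv j
    simpa [h2, Pi.single_apply] using h1

namespace ModelCoords

variable {Q : Type*} [TopologicalSpace Q] [ChartedSpace (EuclideanSpace ℝ (Fin 11)) Q]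
  {c : ModelCoords Q}

/-- The differentials of the coordinates have no common kernel. -/
def IsIndependent (c : ModelCoords Q) : Prop :=
  ∀ z (v : TangentSpace (𝓡 11) z), diff c.X z v = 0 → diff c.Y z v = 0 → diff c.A0 z v = 0 →
    diff c.A1 z v = 0 → diff c.A2 z v = 0 → diff c.A3 z v = 0 → diff c.a z v = 0 →
    diff c.p z v = 0 → diff c.q z v = 0 → diff c.m z v = 0 → diff c.n z v = 0 → v = 0

/-- The forms are triangular in the differentials: Ω₂ and Ω₃ give dX and dY, then Ω₄ and Ω₅ give dn
and dm, then Ω₁, A and Ω₆ give dp, dq, da, and the θ give the dAᵢ. -/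
theorem IsIndependent.eq_zero (hi : c.IsIndependent) (hc : c.IsAdmissible) (z : Q)
    (v : TangentSpace (𝓡 11) z) (hθ : ∀ i, c.theta i z v = 0) (hΩ : ∀ μ, c.Omega μ z v = 0)
    (hA : c.A z v = 0) : v = 0 := by
  have ha := hc.a_ne z
  have hp := hc.p_ne z
  have hq := hc.q_ne z
  have hr : c.r z ≠ 0 := by simp [ModelCoords.r, ha, hp, hq]
  have t0 := (theta0_apply z v).symm.trans (hθ 0)
  have t1 := (theta1_apply z v).symm.trans (hθ 1)
  have t2 := (theta2_apply z v).symm.trans (hθ 2)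
  have t3 := (theta3_apply z v).symm.trans (hθ 3)
  have o0 := (Omega0_apply z v).symm.trans (hΩ 0)
  have o1 := (Omega1_apply z v).symm.trans (hΩ 1)
  have o2 := (Omega2_apply z v).symm.trans (hΩ 2)
  have o3 := (Omega3_apply z v).symm.trans (hΩ 3)
  have o4 := (Omega4_apply z v).symm.trans (hΩ 4)
  have o5 := (Omega5_apply z v).symm.trans (hΩ 5)
  have oA := (A_apply z v).symm.trans hA
  have l0 : c.lam z v = 0 := by simpa [ha] using t3
  have l1 : c.zeta1 z v = 0 := by simpa [hp] using t0
  have l2 : c.zeta2 z v = 0 := by simpa [hq] using t1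
  have l3 : c.zeta3 z v = 0 := by simpa [hr] using t2
  have x0 : diff c.X z v = 0 := by simpa [ha, hp] using o1
  have y0 : diff c.Y z v = 0 := by simpa [ha, hq] using o2
  have n0 : diff c.n z v = 0 := by simpa [ha, hq, y0] using o3
  have m0 : diff c.m z v = 0 := by simpa [ha, hp, x0] using o4
  rw [x0, y0] at o0 o5
  -- Ω₁ now gives the difference of d log p and d log q, and A gives their sum.
  have lp : (c.p z)⁻¹ * diff c.p z v = 0 := by linarith
  have lq : (c.q z)⁻¹ * diff c.q z v = 0 := by linarith
  rw [lp, lq] at o5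
  have p0 : diff c.p z v = 0 := by simpa [hp] using lp
  have q0 : diff c.q z v = 0 := by simpa [hq] using lq
  have a0 : diff c.a z v = 0 := by simpa [ha] using o5
  rw [zeta1_apply, l0] at l1
  rw [zeta3_apply, l2] at l3
  rw [zeta2_apply, l0] at l2
  have h3 : diff c.A3 z v = 0 := by linear_combination l3 - c.n z * l1
  have h1 : diff c.A1 z v = 0 := by linear_combination l1 - c.Y z * h3
  have h2 : diff c.A2 z v = 0 := by linear_combination l2 - c.X z * h3
  rw [lam_apply, h1, h2, h3] at l0
  exact hi z v x0 y0 (by linarith) h1 h2 h3 a0 p0 q0 m0 n0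

theorem IsIndependent.linearIndependent (hi : c.IsIndependent) (hc : c.IsAdmissible) (z : Q) :
    LinearIndependent ℝ (Sum.elim (fun i => c.theta i z)
      (Sum.elim (fun μ => c.Omega μ z) (fun _ : Unit => c.A z))) :=
  (linearIndependent_iff_forall_eq_zero (by simp)).2 fun v hv => hi.eq_zero hc z v
    (fun i => hv (Sum.inl i)) (fun μ => hv (Sum.inr (Sum.inl μ))) (hv (Sum.inr (Sum.inr ())))

/-- The coordinates pulled back under a map. -/
def comp {Q' : Type*} (c : ModelCoords Q') (F : Q → Q') : ModelCoords Q :=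
  ⟨c.X ∘ F, c.Y ∘ F, c.A0 ∘ F, c.A1 ∘ F, c.A2 ∘ F, c.A3 ∘ F, c.a ∘ F, c.p ∘ F, c.q ∘ F, c.m ∘ F,
    c.n ∘ F⟩

/-! ### Naturality of the model forms under smooth maps. -/

section Pullback

variable {Q' : Type*} [TopologicalSpace Q'] [ChartedSpace (EuclideanSpace ℝ (Fin 11)) Q']
  {c : ModelCoords Q'} {F : Q → Q'}

variable [IsManifold (𝓡 11) ∞ Q] [IsManifold (𝓡 11) ∞ Q']

/-- The pullbacks of the differentials of the coordinates. -/
theorem diff_comp_apply {f : Q' → ℝ} (hf : ContMDiff (𝓡 11) 𝓘(ℝ) ∞ f)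
    (hF : ContMDiff (𝓡 11) (𝓡 11) ∞ F) (z : Q) (v : TangentSpace (𝓡 11) z) :
    diff (f ∘ F) z v = diff f (F z) (mfderiv (𝓡 11) (𝓡 11) F z v) :=
  (congrArg (fun L : EuclideanSpace ℝ (Fin 11) →L[ℝ] ℝ => L v) (pullback_diff
    (hF.mdifferentiable (by simp) z) (hf.mdifferentiable (by simp) _))).symm

theorem lam_comp_apply (hc : c.IsAdmissible) (hF : ContMDiff (𝓡 11) (𝓡 11) ∞ F) (z : Q)
    (v : TangentSpace (𝓡 11) z) :
    (c.comp F).lam z v = c.lam (F z) (mfderiv (𝓡 11) (𝓡 11) F z v) := by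
  rw [lam_apply, lam_apply, ← diff_comp_apply hc.A0 hF, ← diff_comp_apply hc.A1 hF,
    ← diff_comp_apply hc.A2 hF, ← diff_comp_apply hc.A3 hF]
  rfl

theorem zeta1_comp_apply (hc : c.IsAdmissible) (hF : ContMDiff (𝓡 11) (𝓡 11) ∞ F) (z : Q)
    (v : TangentSpace (𝓡 11) z) :
    (c.comp F).zeta1 z v = c.zeta1 (F z) (mfderiv (𝓡 11) (𝓡 11) F z v) := by
  rw [zeta1_apply, zeta1_apply, lam_comp_apply hc hF, ← diff_comp_apply hc.A1 hF,
    ← diff_comp_apply hc.A3 hF]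
  rfl

theorem zeta2_comp_apply (hc : c.IsAdmissible) (hF : ContMDiff (𝓡 11) (𝓡 11) ∞ F) (z : Q)
    (v : TangentSpace (𝓡 11) z) :
    (c.comp F).zeta2 z v = c.zeta2 (F z) (mfderiv (𝓡 11) (𝓡 11) F z v) := by
  rw [zeta2_apply, zeta2_apply, lam_comp_apply hc hF, ← diff_comp_apply hc.A2 hF,
    ← diff_comp_apply hc.A3 hF]
  rfl

theorem zeta3_comp_apply (hc : c.IsAdmissible) (hF : ContMDiff (𝓡 11) (𝓡 11) ∞ F) (z : Q)
    (v : TangentSpace (𝓡 11) z) :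
    (c.comp F).zeta3 z v = c.zeta3 (F z) (mfderiv (𝓡 11) (𝓡 11) F z v) := by
  rw [zeta3_apply, zeta3_apply, zeta2_comp_apply hc hF, ← diff_comp_apply hc.A1 hF,
    ← diff_comp_apply hc.A3 hF]
  rfl

theorem pullback_theta (hc : c.IsAdmissible) (hF : ContMDiff (𝓡 11) (𝓡 11) ∞ F) (i : Fin 4) :
    pullback F (c.theta i) = (c.comp F).theta i := by
  funext z
  refine ContinuousLinearMap.ext fun v => ?_
  change c.theta i (F z) (mfderiv (𝓡 11) (𝓡 11) F z v) = _
  fin_cases i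
  · exact congrArg (c.p (F z) * ·) (zeta1_comp_apply hc hF z v).symm
  · exact congrArg (c.q (F z) * ·) (zeta2_comp_apply hc hF z v).symm
  · exact congrArg (c.r (F z) * ·) (zeta3_comp_apply hc hF z v).symm
  · exact congrArg (c.a (F z) * ·) (lam_comp_apply hc hF z v).symm

theorem pullback_Omega (hc : c.IsAdmissible) (hF : ContMDiff (𝓡 11) (𝓡 11) ∞ F) (μ : Fin 6) :
    pullback F (c.Omega μ) = (c.comp F).Omega μ := by
  funext z
  refine ContinuousLinearMap.ext fun v => ?_
  change c.Omega μ (F z) (mfderiv (𝓡 11) (𝓡 11) F z v) = _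
  fin_cases μ
  · refine (Omega0_apply _ _).trans (Eq.trans ?_ (Omega0_apply _ _).symm)
    rw [← diff_comp_apply hc.X hF, ← diff_comp_apply hc.Y hF, ← diff_comp_apply hc.p hF,
      ← diff_comp_apply hc.q hF]
    rfl
  · refine (Omega1_apply _ _).trans (Eq.trans ?_ (Omega1_apply _ _).symm)
    rw [← diff_comp_apply hc.X hF]
    rfl
  · refine (Omega2_apply _ _).trans (Eq.trans ?_ (Omega2_apply _ _).symm)
    rw [← diff_comp_apply hc.Y hF]
    rfl
  · refine (Omega3_apply _ _).trans (Eq.trans ?_ (Omega3_apply _ _).symm)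
    rw [← diff_comp_apply hc.n hF, ← diff_comp_apply hc.Y hF]
    rfl
  · refine (Omega4_apply _ _).trans (Eq.trans ?_ (Omega4_apply _ _).symm)
    rw [← diff_comp_apply hc.m hF, ← diff_comp_apply hc.X hF]
    rfl
  · refine (Omega5_apply _ _).trans (Eq.trans ?_ (Omega5_apply _ _).symm)
    rw [← diff_comp_apply hc.X hF, ← diff_comp_apply hc.Y hF, ← diff_comp_apply hc.p hF,
      ← diff_comp_apply hc.q hF, ← diff_comp_apply hc.a hF]
    rfl

theorem pullback_A (hc : c.IsAdmissible) (hF : ContMDiff (𝓡 11) (𝓡 11) ∞ F) :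
    pullback F c.A = (c.comp F).A := by
  funext z
  refine ContinuousLinearMap.ext fun v => ?_
  change c.A (F z) (mfderiv (𝓡 11) (𝓡 11) F z v) = _
  refine (A_apply _ _).trans (Eq.trans ?_ (A_apply _ _).symm)
  rw [← diff_comp_apply hc.p hF, ← diff_comp_apply hc.q hF]
  rfl

end Pullback

end ModelCoords

/-! ### Lifts of the flat structure in coordinates -/

/-- The positions of the possibly nonzero entries of a para-CR matrix. -/
def paraCRSupport (i j : Fin 6) : Bool :=
  decide (j = 0) || (decide (i ∈ ({1, 2, 3} : Finset (Fin 6))) &&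
    decide (j ∈ ({1, 2, 3} : Finset (Fin 6)))) || (decide (i ∈ ({4, 5} : Finset (Fin 6))) &&
    decide (j ∈ ({4, 5} : Finset (Fin 6))))

/-- The allowed positions form a transitive relation on the indices, stated in contrapositive form.
This is why the para-CR matrices are closed under products. -/
theorem paraCRSupport_trans {i k : Fin 6} (h : paraCRSupport i k = false) (j : Fin 6) :
    paraCRSupport i j = false ∨ paraCRSupport j k = false := by
  revert i j k
  decide

theorem isParaCRMatrix_iff {G : Matrix (Fin 6) (Fin 6) ℝ} : IsParaCRMatrix G ↔
    (∀ i j, paraCRSupport i j = false → G i j = 0) ∧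
    G.det ≠ 0 := by
  refine and_congr_left fun _ => ⟨?_, fun h => ?_⟩
  · rintro ⟨a, b₁, b₂, b₃, c₁, c₂, f₁₁, f₁₂, f₁₃, f₂₁, f₂₂, f₂₃, f₃₁, f₃₂, f₃₃, h₁₁, h₁₂, h₂₁, h₂₂,
      rfl⟩ i j hij
    fin_cases i <;> fin_cases j <;> first | rfl | exact absurd hij (by decide)
  · refine ⟨G 0 0, G 1 0, G 2 0, G 3 0, G 4 0, G 5 0, G 1 1, G 1 2, G 1 3, G 2 1, G 2 2, G 2 3,
      G 3 1, G 3 2, G 3 3, G 4 4, G 4 5, G 5 4, G 5 5, ?_⟩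
    ext i j
    fin_cases i <;> fin_cases j <;> first | rfl | exact h _ _ (by decide)

theorem IsParaCRMatrix.apply_eq_zero {G : Matrix (Fin 6) (Fin 6) ℝ} (h : IsParaCRMatrix G)
    {i j : Fin 6}
    (hij : paraCRSupport i j = false) : G i j = 0 :=
  (isParaCRMatrix_iff.1 h).1 i j hij

theorem IsParaCRMatrix.mul {G H : Matrix (Fin 6) (Fin 6) ℝ} (hG : IsParaCRMatrix G)
    (hH : IsParaCRMatrix H) : IsParaCRMatrix (G * H) := by
  rw [isParaCRMatrix_iff] at *
  refine ⟨fun i k hik => ?_, by rw [Matrix.det_mul]; exact mul_ne_zero hG.2 hH.2⟩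
  rw [Matrix.mul_apply]
  refine Finset.sum_eq_zero fun j _ => ?_
  rcases paraCRSupport_trans hik j with h | h
  · rw [hG.1 i j h, zero_mul]
  · rw [hH.1 j k h, mul_zero]

/-- Left multiplication by `G` maps the finite-dimensional space of matrices with the allowed
support to itself injectively, hence onto. The preimage of 1 is the inverse. -/
theorem IsParaCRMatrix.inv {G : Matrix (Fin 6) (Fin 6) ℝ} (hG : IsParaCRMatrix G) :
    IsParaCRMatrix G⁻¹ := by
  rw [isParaCRMatrix_iff] at *
  have hu : IsUnit G.det := hG.2.isUnit
  refine ⟨?_, by simpa using hG.2⟩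
  let W : Submodule ℝ (Matrix (Fin 6) (Fin 6) ℝ) :=
    { carrier := {H | ∀ i j, paraCRSupport i j = false → H i j = 0}
      zero_mem' := fun _ _ _ => rfl
      add_mem' := fun {H K} hH hK i j hij => by
        rw [Matrix.add_apply, hH i j hij, hK i j hij, add_zero]
      smul_mem' := fun c H hH i j hij => by rw [Matrix.smul_apply, hH i j hij, smul_zero] }
  have hmul : ∀ H ∈ W, G * H ∈ W := by
    intro H hH i k hik
    rw [Matrix.mul_apply]
    refine Finset.sum_eq_zero fun j _ => ?_
    rcases paraCRSupport_trans hik j with h | h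
    · rw [hG.1 i j h, zero_mul]
    · rw [hH j k h, mul_zero]
  have hone : (1 : Matrix (Fin 6) (Fin 6) ℝ) ∈ W := by
    intro i j hij
    refine Matrix.one_apply_ne ?_
    rintro rfl
    exact absurd hij (by revert i; decide)
  let T : W →ₗ[ℝ] W := (LinearMap.mulLeft ℝ G).restrict hmul
  have hT : Function.Injective T := by
    rw [injective_iff_map_eq_zero]
    rintro ⟨H, hH⟩ h0
    have h1 : G * H = 0 := congrArg Subtype.val h0
    have h2 : G⁻¹ * (G * H) = 0 := by rw [h1, Matrix.mul_zero]
    rw [← Matrix.mul_assoc, Matrix.nonsing_inv_mul _ hu, Matrix.one_mul] at h2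
    exact Subtype.ext h2
  obtain ⟨⟨H, hH⟩, h1⟩ := LinearMap.injective_iff_surjective.1 hT ⟨1, hone⟩
  have h2 : G * H = 1 := congrArg Subtype.val h1
  rw [Matrix.inv_eq_right_inv h2]
  exact hH

/-- The coefficients of the model forms with respect to the flat forms; `ε` tells whether the
roles of `x` and `y` are kept or interchanged. -/
def liftMatrix (ε : Bool) (X Y a p q m n : ℝ) : Matrix (Fin 6) (Fin 6) ℝ :=
  bif ε then
    !![a, 0, 0, 0, 0, 0;
       p * m, p, 0, p * Y, 0, 0;
       q * n, 0, q, q * X, 0, 0;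
       -(p * q * a⁻¹) * (m * n), -(p * q * a⁻¹) * n, -(p * q * a⁻¹) * m,
         -(p * q * a⁻¹) * (1 + n * Y + m * X), 0, 0;
       0, 0, 0, 0, 0, a * q⁻¹;
       0, 0, 0, 0, a * p⁻¹, 0]
  else
    !![a, 0, 0, 0, 0, 0;
       p * m, 0, p, p * Y, 0, 0;
       q * n, q, 0, q * X, 0, 0;
       -(p * q * a⁻¹) * (m * n), -(p * q * a⁻¹) * m, -(p * q * a⁻¹) * n,
         -(p * q * a⁻¹) * (1 + n * Y + m * X), 0, 0;
       0, 0, 0, 0, a * q⁻¹, 0;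
       0, 0, 0, 0, 0, a * p⁻¹]

/-- Invertibility is shown by solving `liftMatrix` · v = 0. The fourth row, less multiples of the
second and third, isolates the component of ν₃. -/
theorem isParaCRMatrix_liftMatrix (ε : Bool) (X Y : ℝ) {a p q : ℝ} (m n : ℝ) (ha : a ≠ 0)
    (hp : p ≠ 0) (hq : q ≠ 0) : IsParaCRMatrix (liftMatrix ε X Y a p q m n) := by
  constructor
  · cases ε <;> exact ⟨_, _, _, _, _, _, _, _, _, _, _, _, _, _, _, _, _, _, _, rfl⟩
  · intro h
    obtain ⟨v, hv, h0⟩ := Matrix.exists_mulVec_eq_zero_iff.2 h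
    apply hv
    have e0 := congrFun h0 0
    have e1 := congrFun h0 1
    have e2 := congrFun h0 2
    have e3 := congrFun h0 3
    have e4 := congrFun h0 4
    have e5 := congrFun h0 5
    cases ε
    · simp [liftMatrix, Matrix.mulVec, dotProduct, Fin.sum_univ_six, ha, hp, hq] at e0 e1 e2 e3 e4 e5
      simp only [e0] at e1 e2 e3
      have f1 : v 2 + Y * v 3 = 0 := mul_left_cancel₀ hp (by linarith)
      have f2 : v 1 + X * v 3 = 0 := mul_left_cancel₀ hq (by linarith)
      have f3 : m * v 1 + n * v 2 + (1 + n * Y + m * X) * v 3 = 0 := by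
        refine mul_left_cancel₀ (mul_ne_zero (mul_ne_zero hp hq) (inv_ne_zero ha)) ?_
        linarith
      have g3 : v 3 = 0 := by linear_combination f3 - m * f2 - n * f1
      rw [g3] at f1 f2
      funext i
      fin_cases i <;> simp <;> linarith
    · simp [liftMatrix, Matrix.mulVec, dotProduct, Fin.sum_univ_six, ha, hp, hq] at e0 e1 e2 e3 e4 e5
      simp only [e0] at e1 e2 e3
      have f1 : v 1 + Y * v 3 = 0 := mul_left_cancel₀ hp (by linarith)
      have f2 : v 2 + X * v 3 = 0 := mul_left_cancel₀ hq (by linarith)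
      have f3 : n * v 1 + m * v 2 + (1 + n * Y + m * X) * v 3 = 0 := by
        refine mul_left_cancel₀ (mul_ne_zero (mul_ne_zero hp hq) (inv_ne_zero ha)) ?_
        linarith
      have g3 : v 3 = 0 := by linear_combination f3 - m * f2 - n * f1
      rw [g3] at f1 f2
      funext i
      fin_cases i <;> simp <;> linarith

/-! ### Model coordinates over a map to ℝ⁶. -/

section Base

variable {Q : Type*} [TopologicalSpace Q] [ChartedSpace (EuclideanSpace ℝ (Fin 11)) Q]

theorem diff_coord_apply {F : Q → EuclideanSpace ℝ (Fin 6)} {z : Q}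
    (hF : MDifferentiableAt (𝓡 11) (𝓡 6) F z) (k : Fin 6) (v : TangentSpace (𝓡 11) z) :
    diff (fun z => F z k) z v
      = coord k (mfderiv (𝓡 11) (𝓡 6) F z v) := by
  have h := mfderiv_comp z (I' := 𝓡 6) (I'' := 𝓘(ℝ)) (g := coord k) (f := F)
    (coord k).mdifferentiableAt hF
  rw [(coord k).mfderiv_eq] at h
  exact congrArg (fun L : EuclideanSpace ℝ (Fin 11) →L[ℝ] ℝ => L v) h

theorem pullback_flatForm_apply {F : Q → EuclideanSpace ℝ (Fin 6)} {z : Q}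
    (hF : MDifferentiableAt (𝓡 11) (𝓡 6) F z) (v : TangentSpace (𝓡 11) z) :
    (fun j => pullback (n := 11) F (flatForm j) z v) =
      ![diff (fun z => F z 2) z v + F z 0 * diff (fun z => F z 3) z v
          + F z 1 * diff (fun z => F z 4) z v + (F z 0 * F z 1) * diff (fun z => F z 5) z v,
        diff (fun z => F z 3) z v, diff (fun z => F z 4) z v, diff (fun z => F z 5) z v,
        diff (fun z => F z 0) z v, diff (fun z => F z 1) z v] := by
  funext j
  simp only [diff_coord_apply hF]
  fin_cases j <;> rfl

/-- The model coordinates over a map to `ℝ⁶`. -/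
def ModelCoords.ofBase (ε : Q → Bool) (F : Q → EuclideanSpace ℝ (Fin 6)) (a p q m n : Q → ℝ) :
    ModelCoords Q where
  X z := bif ε z then F z 0 else F z 1
  Y z := bif ε z then F z 1 else F z 0
  A0 z := F z 2
  A1 z := bif ε z then F z 3 else F z 4
  A2 z := bif ε z then F z 4 else F z 3
  A3 z := F z 5
  a := a
  p := p
  q := q
  m := m
  n := n

variable {ε : Q → Bool} {F : Q → EuclideanSpace ℝ (Fin 6)} {a p q m n : Q → ℝ}

/-- Since `ε` is locally constant, the choice of sheet does not interfere with differentiation. -/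
theorem diff_cond (hε : ∀ z, ∀ᶠ z' in nhds z, ε z' = ε z) (f g : Q → ℝ) (z : Q)
    (v : TangentSpace (𝓡 11) z) :
    diff (fun z => bif ε z then f z else g z) z v = bif ε z then diff f z v else diff g z v := by
  have h : (fun z => bif ε z then f z else g z) =ᶠ[nhds z] bif ε z then f else g := by
    filter_upwards [hε z] with z' hz'
    rw [hz']
    cases ε z <;> rfl
  rw [diff_congr h]
  cases ε z <;> rfl

theorem contMDiff_cond (hε : ∀ z, ∀ᶠ z' in nhds z, ε z' = ε z) {f g : Q → ℝ}
    (hf : ContMDiff (𝓡 11) 𝓘(ℝ) ∞ f) (hg : ContMDiff (𝓡 11) 𝓘(ℝ) ∞ g) :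
    ContMDiff (𝓡 11) 𝓘(ℝ) ∞ (fun z => bif ε z then f z else g z) := by
  intro z
  have h : (fun z => bif ε z then f z else g z) =ᶠ[nhds z] bif ε z then f else g := by
    filter_upwards [hε z] with z' hz'
    rw [hz']
    cases ε z <;> rfl
  refine ContMDiffAt.congr_of_eventuallyEq ?_ h
  cases ε z
  · exact hg z
  · exact hf z

theorem contMDiff_coord_comp (hF : ContMDiff (𝓡 11) (𝓡 6) ∞ F) (k : Fin 6) :
    ContMDiff (𝓡 11) 𝓘(ℝ) ∞ (fun z => F z k) :=
  (coord k).contDiff.contMDiff.comp hF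

theorem ModelCoords.ofBase_isAdmissible (hε : ∀ z, ∀ᶠ z' in nhds z, ε z' = ε z)
    (hF : ContMDiff (𝓡 11) (𝓡 6) ∞ F) (ha : ContMDiff (𝓡 11) 𝓘(ℝ) ∞ a)
    (hp : ContMDiff (𝓡 11) 𝓘(ℝ) ∞ p) (hq : ContMDiff (𝓡 11) 𝓘(ℝ) ∞ q)
    (hm : ContMDiff (𝓡 11) 𝓘(ℝ) ∞ m) (hn : ContMDiff (𝓡 11) 𝓘(ℝ) ∞ n) (ha0 : ∀ z, a z ≠ 0)
    (hp0 : ∀ z, p z ≠ 0) (hq0 : ∀ z, q z ≠ 0) :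
    (ModelCoords.ofBase ε F a p q m n).IsAdmissible where
  X := contMDiff_cond hε (contMDiff_coord_comp hF 0) (contMDiff_coord_comp hF 1)
  Y := contMDiff_cond hε (contMDiff_coord_comp hF 1) (contMDiff_coord_comp hF 0)
  A0 := contMDiff_coord_comp hF 2
  A1 := contMDiff_cond hε (contMDiff_coord_comp hF 3) (contMDiff_coord_comp hF 4)
  A2 := contMDiff_cond hε (contMDiff_coord_comp hF 4) (contMDiff_coord_comp hF 3)
  A3 := contMDiff_coord_comp hF 5
  a := ha
  p := hp
  q := hq
  m := hm
  n := hn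
  a_ne := ha0
  p_ne := hp0
  q_ne := hq0

/-- This justifies the entries of `liftMatrix`. The order on the right is that of the lifted forms,
(θ⁴, θ¹, θ², θ³, Ω₃, Ω₂). -/
theorem ModelCoords.sum_liftMatrix_smul (hε : ∀ z, ∀ᶠ z' in nhds z, ε z' = ε z)
    (hF : ContMDiff (𝓡 11) (𝓡 6) ∞ F) (z : Q) (i : Fin 6) :
    ∑ j, liftMatrix (ε z) (bif ε z then F z 0 else F z 1) (bif ε z then F z 1 else F z 0)
      (a z) (p z) (q z) (m z) (n z) i j • pullback (n := 11) F (flatForm j) z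
    = ![(ofBase ε F a p q m n).theta 3 z, (ofBase ε F a p q m n).theta 0 z,
        (ofBase ε F a p q m n).theta 1 z, (ofBase ε F a p q m n).theta 2 z,
        (ofBase ε F a p q m n).Omega 2 z, (ofBase ε F a p q m n).Omega 1 z] i := by
  set c := ofBase ε F a p q m n with hc
  refine ContinuousLinearMap.ext fun v => ?_
  have hd := hF.mdifferentiable (by simp) z
  have hfl := pullback_flatForm_apply hd v
  have hX : diff c.X z v
      = bif ε z then diff (fun z => F z 0) z v else diff (fun z => F z 1) z v :=
    diff_cond hε _ _ z v
  have hY : diff c.Y z v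
      = bif ε z then diff (fun z => F z 1) z v else diff (fun z => F z 0) z v :=
    diff_cond hε _ _ z v
  have hA1 : diff c.A1 z v
      = bif ε z then diff (fun z => F z 3) z v else diff (fun z => F z 4) z v :=
    diff_cond hε _ _ z v
  have hA2 : diff c.A2 z v
      = bif ε z then diff (fun z => F z 4) z v else diff (fun z => F z 3) z v :=
    diff_cond hε _ _ z v
  have hA0 : diff c.A0 z v = diff (fun z => F z 2) z v := rfl
  have hA3 : diff c.A3 z v = diff (fun z => F z 5) z v := rfl
  have hx : c.X z = bif ε z then F z 0 else F z 1 := rfl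
  have hy : c.Y z = bif ε z then F z 1 else F z 0 := rfl
  have hr : c.r z = -(p z * q z * (a z)⁻¹) := rfl
  have hsum : ∀ g : Fin 6 → ℝ,
      (∑ j, g j • pullback (n := 11) F (flatForm j) z : EuclideanSpace ℝ (Fin 11) →L[ℝ] ℝ) v
        = ∑ j, g j * pullback (n := 11) F (flatForm j) z v := by
    intro g
    exact sum_apply _ _ _
  refine (hsum _).trans ?_
  have h0 := congrFun hfl 0
  have h1 := congrFun hfl 1
  have h2 := congrFun hfl 2
  have h3 := congrFun hfl 3
  have h4 := congrFun hfl 4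
  have h5 := congrFun hfl 5
  simp only [Fin.isValue, Matrix.cons_val] at h0 h1 h2 h3 h4 h5
  rw [Fin.sum_univ_six, h0, h1, h2, h3, h4, h5]
  fin_cases i
  · refine Eq.trans ?_ (theta3_apply (c := c) z v).symm
    rw [lam_apply, hA0, hA1, hA2, hA3, hx, hy]
    change _ = a z * _
    cases ε z
    · simp [liftMatrix, -mul_eq_mul_left_iff]
      ring
    · simp [liftMatrix, -mul_eq_mul_left_iff]
  · refine Eq.trans ?_ (theta0_apply (c := c) z v).symm
    rw [zeta1_apply, lam_apply, hA0, hA1, hA2, hA3, hx, hy]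
    change _ = p z * (_ + m z * _)
    cases ε z <;> simp [liftMatrix] <;> ring
  · refine Eq.trans ?_ (theta1_apply (c := c) z v).symm
    rw [zeta2_apply, lam_apply, hA0, hA1, hA2, hA3, hx, hy]
    change _ = q z * (_ + n z * _)
    cases ε z <;> simp [liftMatrix] <;> ring
  · refine Eq.trans ?_ (theta2_apply (c := c) z v).symm
    rw [zeta3_apply, zeta2_apply, lam_apply, hA0, hA1, hA2, hA3, hx, hy, hr]
    change _ = -(p z * q z * (a z)⁻¹) * (_ + n z * _ + (n z * _) * _ + m z * (_ + n z * _))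
    cases ε z <;> simp [liftMatrix] <;> ring
  · refine Eq.trans ?_ (Omega2_apply (c := c) z v).symm
    rw [hY]
    change _ = a z * (q z)⁻¹ * _
    cases ε z <;> simp [liftMatrix]
  · refine Eq.trans ?_ (Omega1_apply (c := c) z v).symm
    rw [hX]
    change _ = a z * (p z)⁻¹ * _
    cases ε z <;> simp [liftMatrix]

end Base

/-! ### Rigidity of flat coframes -/

/-- The pointwise consequences of the structure equations for the difference of two flat coframes
which have `θ¹, θ², θ⁴` in common. The functions are the values of forms on tangent vectors at a
point: `α = δ(Ω₁ - A/2)`, `β = -δ(Ω₁ + A/2)`, `μ = -δ(Ω₆ + A/2)`, `d3 = δΩ₄`, `d4 = δΩ₅`; the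
vectors `T0, …, V1` are dual vectors. -/
theorem rigidity_aux {V : Type*} (t0 t1 t2 t3 w1 w2 α β μ d3 d4 ρ : V → ℝ)
    (κ γ2 γ3 : ℝ) (T0 T1 T2 T3 V1 : V)
    (hT0 : t0 T0 = 1 ∧ t1 T0 = 0 ∧ t2 T0 = 0 ∧ t3 T0 = 0 ∧ w1 T0 = 0 ∧ w2 T0 = 0)
    (hT1 : t0 T1 = 0 ∧ t1 T1 = 1 ∧ t2 T1 = 0 ∧ t3 T1 = 0 ∧ w1 T1 = 0 ∧ w2 T1 = 0)
    (hT2 : t0 T2 = 0 ∧ t1 T2 = 0 ∧ t2 T2 = 1 ∧ t3 T2 = 0 ∧ w1 T2 = 0 ∧ w2 T2 = 0)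
    (hT3 : t0 T3 = 0 ∧ t1 T3 = 0 ∧ t2 T3 = 0 ∧ t3 T3 = 1 ∧ w1 T3 = 0 ∧ w2 T3 = 0)
    (hV1 : t0 V1 = 0 ∧ t1 V1 = 0 ∧ t2 V1 = 0 ∧ t3 V1 = 0 ∧ w1 V1 = 1 ∧ w2 V1 = 0)
    (E0 : ∀ v w, α v * t0 w - α w * t0 v - κ * (w2 v * t3 w - w2 w * t3 v)
      - γ3 * (t3 v * t2 w - t3 w * t2 v) - (d4 v * t3 w - d4 w * t3 v) = 0)
    (E1 : ∀ v w, β v * t1 w - β w * t1 v - κ * (w1 v * t3 w - w1 w * t3 v)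
      - γ2 * (t3 v * t2 w - t3 w * t2 v) - (d3 v * t3 w - d3 w * t3 v) = 0)
    (E3 : ∀ v w, γ2 * (t3 v * t0 w - t3 w * t0 v) + γ3 * (t3 v * t1 w - t3 w * t1 v)
      + (μ v * t3 w - μ w * t3 v) = 0)
    (E2 : ∀ v w, ρ v * t3 w - ρ w * t3 v
        + κ * ((w1 v * t0 w - w1 w * t0 v) + (w2 v * t1 w - w2 w * t1 v))
      = (d3 v * t0 w - d3 w * t0 v) + (d4 v * t1 w - d4 w * t1 v)
        + (-μ v + α v + β v) * t2 w - (-μ w + α w + β w) * t2 v) :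
    κ = 0 ∧ ((∀ v, ρ v = 0) → ∃ x : ℝ, ∀ v, α v = 2 * γ2 * t0 v - x * t3 v ∧ β v = 2 * γ3 * t1 v - x * t3 v ∧
      μ v = γ2 * t0 v + γ3 * t1 v - 2 * x * t3 v ∧
      d3 v = γ2 * t2 v + x * t1 v ∧ d4 v = γ3 * t2 v + x * t0 v) := by
  obtain ⟨T00, T01, T02, T03, T04, T05⟩ := hT0
  obtain ⟨T10, T11, T12, T13, T14, T15⟩ := hT1
  obtain ⟨T20, T21, T22, T23, T24, T25⟩ := hT2
  obtain ⟨T30, T31, T32, T33, T34, T35⟩ := hT3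
  obtain ⟨V10, V11, V12, V13, V14, V15⟩ := hV1
  -- Cartan's lemma by hand: inserting one dual vector in an identity between 2-forms expresses the
  -- unknown form through the known ones.
  have hα : ∀ v, α v = α T0 * t0 v - d4 T0 * t3 v := fun v => by
    have := E0 v T0
    rw [T00, T02, T03, T05] at this
    linarith
  have hβ : ∀ v, β v = β T1 * t1 v - d3 T1 * t3 v := fun v => by
    have := E1 v T1
    rw [T11, T12, T13, T14] at this
    linarith
  have hμ : ∀ v, μ v = γ2 * t0 v + γ3 * t1 v + μ T3 * t3 v := fun v => by
    have := E3 v T3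
    rw [T30, T31, T33] at this
    linarith
  have hα3 : α T3 = -d4 T0 := by have := hα T3; rw [T30, T33] at this; linarith
  have hβ3 : β T3 = -d3 T1 := by have := hβ T3; rw [T31, T33] at this; linarith
  have hd4 : ∀ v, d4 v = d4 T0 * t0 v - κ * w2 v + γ3 * t2 v + d4 T3 * t3 v := fun v => by
    have := E0 v T3
    rw [T30, T32, T33, T35, hα3] at this
    linarith
  have hd3 : ∀ v, d3 v = d3 T1 * t1 v - κ * w1 v + γ2 * t2 v + d3 T3 * t3 v := fun v => by
    have := E1 v T3
    rw [T31, T32, T33, T34, hβ3] at this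
    linarith
  -- On (`V1`, `T0`) equation `E2` reads κ = d3(V1), whereas `hd3` gives d3(V1) = -κ.
  have hκ : κ = 0 := by
    have h1 := E2 V1 T0
    have h2 := hd3 V1
    rw [V10, V11, V12, V13, V14, V15, T00, T01, T02, T03] at h1
    rw [V11, V12, V13, V14] at h2
    linarith
  subst hκ
  refine ⟨rfl, fun hρ => ?_⟩
  simp only [hρ] at E2
  have f3 : d3 T3 = 0 := by
    have h1 := E2 T3 T0
    rw [T00, T01, T02, T03, T30, T31, T32, T33] at h1
    linarith
  have f4 : d4 T3 = 0 := by
    have h1 := E2 T3 T1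
    rw [T10, T11, T12, T13, T30, T31, T32, T33] at h1
    linarith
  have g1 : d3 T1 = d4 T0 := by
    have h1 := E2 T1 T0
    rw [T10, T11, T12, T13, T00, T01, T02, T03] at h1
    linarith
  have g2 : α T0 = 2 * γ2 := by
    have h1 := E2 T0 T2
    have h2 := hd3 T2
    have h3 := hμ T0
    have h4 := hβ T0
    rw [T20, T21, T22, T23, T00, T01, T02, T03] at h1
    rw [T21, T22, T23] at h2
    rw [T00, T01, T03] at h3
    rw [T01, T03] at h4
    linarith
  have g3 : β T1 = 2 * γ3 := by
    have h1 := E2 T1 T2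
    have h2 := hd4 T2
    have h3 := hμ T1
    have h4 := hα T1
    rw [T20, T21, T22, T23, T10, T11, T12, T13] at h1
    rw [T20, T22, T23] at h2
    rw [T10, T11, T13] at h3
    rw [T10, T13] at h4
    linarith
  have g4 : μ T3 = -2 * d4 T0 := by
    have h1 := E2 T3 T2
    rw [T20, T21, T22, T23, T30, T31, T32, T33] at h1
    linarith
  -- The coefficient `d4 T0` is the one unknown that these pointwise equations leave free, besides
  -- γ2 and γ3.
  refine ⟨d4 T0, fun v => ⟨?_, ?_, ?_, ?_, ?_⟩⟩
  · rw [hα v, g2]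
  · rw [hβ v, g3, g1]
  · rw [hμ v, g4]; ring
  · rw [hd3 v, g1, f3]; ring
  · rw [hd4 v, f4]; ring

section FlatCoframe

variable {P : Type*} [TopologicalSpace P] [ChartedSpace (EuclideanSpace ℝ (Fin 11)) P]

/-- Smooth forms which satisfy the flat structure equations. -/
structure SmoothFlat (θ : Fin 4 → OneForm 11 P) (Ω : Fin 6 → OneForm 11 P) (A : OneForm 11 P) :
    Prop where
  smooth_theta : ∀ i, IsSmooth (θ i)
  smooth_Omega : ∀ μ, IsSmooth (Ω μ)
  smooth_A : IsSmooth A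
  flat : ExplicitFlat θ Ω A

theorem contMDiff_of_eq_smul {n : ℕ} {M : Type*} [TopologicalSpace M]
    [ChartedSpace (EuclideanSpace ℝ (Fin n)) M] [IsManifold (𝓡 n) ∞ M] {ι : Type*} [Fintype ι]
    [DecidableEq ι] {ρ : ι → OneForm n M} (hρ : ∀ i, IsSmooth (ρ i))
    (hi : ∀ p, LinearIndependent ℝ (fun i => ρ i p)) {η : OneForm n M} (hη : IsSmooth η)
    {f : M → ℝ} (j : ι) (h : ∀ p, η p = f p • ρ j p) : ContMDiff (𝓡 n) 𝓘(ℝ) ∞ f := by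
  have := contMDiff_coefficient hρ hi hη (s := fun i p => if i = j then f p else 0)
    (fun p => by simp [h p]) j
  simpa using this

variable [IsManifold (𝓡 11) ∞ P] {θ θ' : Fin 4 → OneForm 11 P} {Ω Ω' : Fin 6 → OneForm 11 P}
  {A A' : OneForm 11 P}

/-- Subtracting the equations for dθ of the two coframes leaves pointwise linear equations for the
differences of Ω and A. The conclusion has two stages because dκ enters through dθ³: κ vanishes
without any knowledge of dκ, and only afterwards may dκ = 0 be used. -/
theorem SmoothFlat.difference (h : SmoothFlat θ Ω A) (h' : SmoothFlat θ' Ω' A')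
    (e0 : θ' 0 = θ 0) (e1 : θ' 1 = θ 1) (e3 : θ' 3 = θ 3) {κ γ2 γ3 : P → ℝ}
    (hκ : ContMDiff (𝓡 11) 𝓘(ℝ) ∞ κ)
    (e2 : ∀ q, θ' 2 q = θ 2 q + κ q • θ 3 q) (f1 : ∀ q, Ω' 1 q = Ω 1 q + γ2 q • θ 3 q)
    (f2 : ∀ q, Ω' 2 q = Ω 2 q + γ3 q • θ 3 q) (q : P)
    (hi : LinearIndependent ℝ (Sum.elim (fun i => θ i q)
      (Sum.elim (fun μ => Ω μ q) (fun _ : Unit => A q)))) :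
    κ q = 0 ∧ ((∀ v : TangentSpace (𝓡 11) q, diff κ q v = 0) → ∃ x : ℝ, ∀ v,
      (Ω' 0 q v - Ω 0 q v) - 1 / 2 * (A' q v - A q v) = 2 * γ2 q * θ 0 q v - x * θ 3 q v ∧
      -(Ω' 0 q v - Ω 0 q v) - 1 / 2 * (A' q v - A q v) = 2 * γ3 q * θ 1 q v - x * θ 3 q v ∧
      -(Ω' 5 q v - Ω 5 q v) - 1 / 2 * (A' q v - A q v)
        = γ2 q * θ 0 q v + γ3 q * θ 1 q v - 2 * x * θ 3 q v ∧
      Ω' 3 q v - Ω 3 q v = γ2 q * θ 2 q v + x * θ 1 q v ∧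
      Ω' 4 q v - Ω 4 q v = γ3 q * θ 2 q v + x * θ 0 q v) := by
  obtain ⟨e, he⟩ := exists_dual_vectors hi
  have hθ : ∀ i j, θ i q (e (Sum.inl j)) = if i = j then 1 else 0 := fun i j => by
    simpa using he (Sum.inl i) (Sum.inl j)
  have hθΩ : ∀ i μ, θ i q (e (Sum.inr (Sum.inl μ))) = 0 := fun i μ => by
    simpa using he (Sum.inl i) (Sum.inr (Sum.inl μ))
  have hΩ : ∀ μ ν, Ω μ q (e (Sum.inr (Sum.inl ν))) = if μ = ν then 1 else 0 := fun μ ν => by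
    simpa using he (Sum.inr (Sum.inl μ)) (Sum.inr (Sum.inl ν))
  have hΩθ : ∀ μ i, Ω μ q (e (Sum.inl i)) = 0 := fun μ i => by
    simpa using he (Sum.inr (Sum.inl μ)) (Sum.inl i)
  have e2v : ∀ v, θ' 2 q v = θ 2 q v + κ q * θ 3 q v := fun v => by rw [e2 q]; rfl
  have f1v : ∀ v, Ω' 1 q v = Ω 1 q v + γ2 q * θ 3 q v := fun v => by rw [f1 q]; rfl
  have f2v : ∀ v, Ω' 2 q v = Ω 2 q v + γ3 q * θ 3 q v := fun v => by rw [f2 q]; rfl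
  have e2' : θ' 2 = θ 2 + fun q => κ q • θ 3 q := funext e2
  have d2 : ∀ v w, extD (θ' 2) q v w = extD (θ 2) q v w
      + (diff κ q v * θ 3 q w - diff κ q w * θ 3 q v + κ q * extD (θ 3) q v w) := by
    rw [e2']
    exact (((h.smooth_theta 2).hasExtDerivAt q).add (((h.smooth_theta 3).hasExtDerivAt q).smul
      (hκ.mdifferentiable (by simp) q))).2
  -- The form ρ collects dκ and all terms with a factor κ that are multiples of θ⁴. It reduces to dκ
  -- where κ = 0.
  suffices hρ : κ q = 0 ∧ ((∀ v, diff κ q v + κ q * (-Ω 5 q v - 1 / 2 * A q v - Ω' 5 q v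
      + 1 / 2 * A' q v) = 0) → _) from
    ⟨hρ.1, fun hd => hρ.2 fun v => by rw [hρ.1, hd, zero_mul, add_zero]⟩
  refine rigidity_aux (θ 0 q) (θ 1 q) (θ 2 q) (θ 3 q) (Ω 1 q) (Ω 2 q)
    (fun v => (Ω' 0 q v - Ω 0 q v) - 1 / 2 * (A' q v - A q v))
    (fun v => -(Ω' 0 q v - Ω 0 q v) - 1 / 2 * (A' q v - A q v))
    (fun v => -(Ω' 5 q v - Ω 5 q v) - 1 / 2 * (A' q v - A q v))
    (fun v => Ω' 3 q v - Ω 3 q v) (fun v => Ω' 4 q v - Ω 4 q v) (fun v => diff κ q v + κ q * (-Ω 5 q v - 1 / 2 * A q v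
      - Ω' 5 q v + 1 / 2 * A' q v))
    (κ q) (γ2 q) (γ3 q) (e (Sum.inl 0)) (e (Sum.inl 1)) (e (Sum.inl 2)) (e (Sum.inl 3))
    (e (Sum.inr (Sum.inl 1))) ?_ ?_ ?_ ?_ ?_ ?_ ?_ ?_ ?_
  · simp [hθ, hΩθ]
  · simp [hθ, hΩθ]
  · simp [hθ, hΩθ]
  · simp [hθ, hΩθ]
  · simp [hθΩ, hΩ]
  · intro v w
    have a := h.flat.dθ0 q v w
    have b := h'.flat.dθ0 q v w
    rw [e0, e3] at b
    simp only [wedge_apply, e2v, f2v] at a b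
    linear_combination a - b
  · intro v w
    have a := h.flat.dθ1 q v w
    have b := h'.flat.dθ1 q v w
    rw [e1, e3] at b
    simp only [wedge_apply, e2v, f1v] at a b
    linear_combination a - b
  · intro v w
    have a := h.flat.dθ3 q v w
    have b := h'.flat.dθ3 q v w
    rw [e0, e1, e3] at b
    simp only [wedge_apply, f1v, f2v] at a b
    linear_combination a - b
  · intro v w
    have a := h.flat.dθ2 q v w
    have b := h'.flat.dθ2 q v w
    have c := h.flat.dθ3 q v w
    rw [d2 v w, e0, e1] at b
    simp only [wedge_apply, e2v] at a b c
    linear_combination b - a - κ q * c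

/-- Two flat coframes coincide if `θ¹`, `θ²`, `θ⁴` coincide, and `θ³`, `Ω₂`, `Ω₃` coincide modulo
`θ⁴`. -/
theorem SmoothFlat.rigid (h : SmoothFlat θ Ω A) (h' : SmoothFlat θ' Ω' A')
    (hi : ∀ q, LinearIndependent ℝ (Sum.elim (fun i => θ i q)
      (Sum.elim (fun μ => Ω μ q) (fun _ : Unit => A q))))
    (e0 : θ' 0 = θ 0) (e1 : θ' 1 = θ 1) (e3 : θ' 3 = θ 3) {κ γ2 γ3 : P → ℝ}
    (e2 : ∀ q, θ' 2 q = θ 2 q + κ q • θ 3 q) (f1 : ∀ q, Ω' 1 q = Ω 1 q + γ2 q • θ 3 q)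
    (f2 : ∀ q, Ω' 2 q = Ω 2 q + γ3 q • θ 3 q) : θ' = θ ∧ Ω' = Ω ∧ A' = A := by
  -- The functions κ, γ2, γ3 and later x are not assumed smooth. They are coefficients of smooth
  -- forms in a coframe, which makes them so.
  have smooth_of : ∀ {η η' : OneForm 11 P} {f : P → ℝ}, IsSmooth η → IsSmooth η' →
      (∀ q, η' q = η q + f q • θ 3 q) → ContMDiff (𝓡 11) 𝓘(ℝ) ∞ f := by
    intro η η' f hη hη' hf
    refine contMDiff_of_eq_smul (ρ := Sum.elim θ (Sum.elim Ω fun _ : Unit => A)) ?_ ?_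
      (hη'.sub hη) (Sum.inl 3) ?_
    · rintro (i | μ | _)
      exacts [h.smooth_theta i, h.smooth_Omega μ, h.smooth_A]
    · intro q
      convert hi q using 1
      funext i
      rcases i with i | μ | _ <;> rfl
    · intro q
      change η' q - η q = f q • θ 3 q
      rw [hf, add_sub_cancel_left]
  have hκ := smooth_of (h.smooth_theta 2) (h'.smooth_theta 2) e2
  -- The pointwise result holds everywhere, so κ is identically 0, its differential vanishes, and
  -- the second stage is available.
  have κ0 : κ = fun _ => 0 :=
    funext fun q => (h.difference h' e0 e1 e3 hκ e2 f1 f2 q (hi q)).1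
  subst κ0
  have hx : ∀ q, ∃ x : ℝ, _ := fun q =>
    (h.difference h' e0 e1 e3 hκ e2 f1 f2 q (hi q)).2 (diff_const 0 q)
  choose x hx using hx
  have s2 := smooth_of (h.smooth_Omega 1) (h'.smooth_Omega 1) f1
  have s3 := smooth_of (h.smooth_Omega 2) (h'.smooth_Omega 2) f2
  have f5 : ∀ q, Ω' 5 q = Ω 5 q + x q • θ 3 q := fun q => by
    refine ContinuousLinearMap.ext fun v => ?_
    obtain ⟨a, b, c, -⟩ := hx q v
    change Ω' 5 q v = Ω 5 q v + x q * θ 3 q v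
    linarith
  have sx := smooth_of (h.smooth_Omega 5) (h'.smooth_Omega 5) f5
  have smul_ext : ∀ {f : P → ℝ} (i : Fin 4) (q : P), ContMDiff (𝓡 11) 𝓘(ℝ) ∞ f →
      HasExtDerivAt (fun q => f q • θ i q : OneForm 11 P) q _ := fun i q hf =>
    ((h.smooth_theta i).hasExtDerivAt q).smul (hf.mdifferentiable (by simp) q)
  -- The whole difference is governed by a 1-form xθ⁴ - γ2θ¹ - γ3θ². The torsion equations leave it
  -- free, and the closedness of A and A' remains to be used.
  have hA : A' = A + (2 : ℝ) • ((fun q => x q • θ 3 q) - (fun q => γ2 q • θ 0 q)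
      - fun q => γ3 q • θ 1 q) := by
    funext q
    refine ContinuousLinearMap.ext fun v => ?_
    obtain ⟨a, b, -⟩ := hx q v
    change A' q v = A q v + 2 * (x q * θ 3 q v - γ2 q * θ 0 q v - γ3 q * θ 1 q v)
    linarith
  have hd : ∀ q v w, diff x q v * θ 3 q w - diff x q w * θ 3 q v + x q * extD (θ 3) q v w
      - (diff γ2 q v * θ 0 q w - diff γ2 q w * θ 0 q v + γ2 q * extD (θ 0) q v w)
      - (diff γ3 q v * θ 1 q w - diff γ3 q w * θ 1 q v + γ3 q * extD (θ 1) q v w) = 0 := by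
    intro q v w
    have a := ((h.smooth_A.hasExtDerivAt q).add
      ((((smul_ext 3 q sx).sub (smul_ext 0 q s2)).sub (smul_ext 1 q s3)).const_smul 2)).2 v w
    rw [← hA, h'.flat.dA] at a
    beta_reduce at a
    rw [h.flat.dA] at a
    linarith
  -- No derivative of x, γ2, γ3 survives on these vectors. The term -Ω₃ ∧ θ³ of dθ¹ isolates γ2, and
  -- -Ω₂ ∧ θ³ of dθ² isolates γ3.
  have key : ∀ q, γ2 q = 0 ∧ γ3 q = 0 := by
    intro q
    obtain ⟨e, he⟩ := exists_dual_vectors (hi q)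
    have hθ : ∀ i j, θ i q (e (Sum.inl j)) = if i = j then 1 else 0 := fun i j => by
      simpa using he (Sum.inl i) (Sum.inl j)
    have hθΩ : ∀ i μ, θ i q (e (Sum.inr (Sum.inl μ))) = 0 := fun i μ => by
      simpa using he (Sum.inl i) (Sum.inr (Sum.inl μ))
    have hΩ : ∀ μ ν, Ω μ q (e (Sum.inr (Sum.inl ν))) = if μ = ν then 1 else 0 := fun μ ν => by
      simpa using he (Sum.inr (Sum.inl μ)) (Sum.inr (Sum.inl ν))
    have a := hd q (e (Sum.inr (Sum.inl 2))) (e (Sum.inl 2))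
    have b := hd q (e (Sum.inr (Sum.inl 1))) (e (Sum.inl 2))
    rw [h.flat.dθ0, h.flat.dθ1, h.flat.dθ3] at a b
    simp only [wedge_apply, hθ, hθΩ, hΩ] at a b
    simp at a b
    exact ⟨a, b⟩
  obtain rfl : γ2 = fun _ => 0 := funext fun q => (key q).1
  obtain rfl : γ3 = fun _ => 0 := funext fun q => (key q).2
  have x0 : ∀ q, x q = 0 := by
    intro q
    obtain ⟨e, he⟩ := exists_dual_vectors (hi q)
    have hθ : ∀ i j, θ i q (e (Sum.inl j)) = if i = j then 1 else 0 := fun i j => by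
      simpa using he (Sum.inl i) (Sum.inl j)
    have hθΩ : ∀ i μ, θ i q (e (Sum.inr (Sum.inl μ))) = 0 := fun i μ => by
      simpa using he (Sum.inl i) (Sum.inr (Sum.inl μ))
    have hΩ : ∀ μ ν, Ω μ q (e (Sum.inr (Sum.inl ν))) = if μ = ν then 1 else 0 := fun μ ν => by
      simpa using he (Sum.inr (Sum.inl μ)) (Sum.inr (Sum.inl ν))
    -- The term Ω₂ ∧ θ¹ of dθ⁴ isolates x.
    have a := hd q (e (Sum.inr (Sum.inl 1))) (e (Sum.inl 0))
    rw [h.flat.dθ3] at a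
    simp only [wedge_apply, hθ, hθΩ, hΩ, diff_const] at a
    simpa using a
  have all : ∀ q v, A' q v = A q v ∧ Ω' 0 q v = Ω 0 q v ∧ Ω' 3 q v = Ω 3 q v ∧
      Ω' 4 q v = Ω 4 q v ∧ Ω' 5 q v = Ω 5 q v := by
    intro q v
    obtain ⟨a, b, c, d, e⟩ := hx q v
    rw [x0 q] at a b c d e
    refine ⟨?_, ?_, ?_, ?_, ?_⟩ <;> linarith
  refine ⟨?_, ?_, ?_⟩
  · funext i q
    fin_cases i
    · exact congrFun e0 q
    · exact congrFun e1 q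
    · refine (e2 q).trans ?_
      simp
    · exact congrFun e3 q
  · funext μ q
    refine ContinuousLinearMap.ext fun v => ?_
    fin_cases μ
    · exact (all q v).2.1
    · simp [f1 q]
    · simp [f2 q]
    · exact (all q v).2.2.1
    · exact (all q v).2.2.2.1
    · exact (all q v).2.2.2.2
  · funext q
    exact ContinuousLinearMap.ext fun v => (all q v).1

end FlatCoframe

/-! ### The coefficients of a lift with a flat completion -/

section General

variable {M : Type*} [TopologicalSpace M] [ChartedSpace (EuclideanSpace ℝ (Fin 6)) M]
  [IsManifold (𝓡 6) ∞ M] {S : Structure123 M} {Q : Type*} [TopologicalSpace Q]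
  [ChartedSpace (EuclideanSpace ℝ (Fin 11)) Q] [IsManifold (𝓡 11) ∞ Q]

theorem Lift.isSmooth_form (K : Lift S Q) (i : Fin 6) : IsSmooth (K.form i) := by
  have h : K.form i = (fun q => K.coeff q i 0 • pullback K.proj (S.form 0) q)
      + (fun q => K.coeff q i 1 • pullback K.proj (S.form 1) q)
      + (fun q => K.coeff q i 2 • pullback K.proj (S.form 2) q)
      + (fun q => K.coeff q i 3 • pullback K.proj (S.form 3) q)
      + (fun q => K.coeff q i 4 • pullback K.proj (S.form 4) q)
      + (fun q => K.coeff q i 5 • pullback K.proj (S.form 5) q) := by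
    funext q
    exact Fin.sum_univ_six _
  have hs : ∀ j, IsSmooth (fun q => K.coeff q i j • pullback K.proj (S.form j) q : OneForm 11 Q) :=
    fun j => ((S.smooth j).pullback K.smooth_proj).smul (K.smooth_coeff i j)
  rw [h]
  exact (((((hs 0).add (hs 1)).add (hs 2)).add (hs 3)).add (hs 4)).add (hs 5)

theorem Lift.isSmooth_theta (K : Lift S Q) (i : Fin 4) : IsSmooth (K.theta i) := by
  fin_cases i
  exacts [K.isSmooth_form 1, K.isSmooth_form 2, K.isSmooth_form 3, K.isSmooth_form 0]

theorem Lift.isSmooth_Omega (K : Lift S Q) {B : Fin 5 → OneForm 11 Q} (hB : ∀ i, IsSmooth (B i))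
    (μ : Fin 6) : IsSmooth (K.Omega B μ) := by
  fin_cases μ
  exacts [hB 0, K.isSmooth_form 5, K.isSmooth_form 4, hB 1, hB 2, hB 3]

theorem Lift.IsFlatCompletion.smoothFlat {K : Lift S Q} {B : Fin 5 → OneForm 11 Q}
    (h : K.IsFlatCompletion B) : SmoothFlat K.theta (K.Omega B) (B 4) where
  smooth_theta := K.isSmooth_theta
  smooth_Omega := K.isSmooth_Omega h.1
  smooth_A := h.1 4
  flat := (flatEquations_iff (K.isSmooth_Omega h.1) (h.1 4)).1 h.2.2

end General

/-! ### Dual vectors, and the blocks of a para-CR matrix. -/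

section Dual

variable {M : Type*} [TopologicalSpace M] [ChartedSpace (EuclideanSpace ℝ (Fin 6)) M]
  {S : Structure123 M} {Q : Type*} [TopologicalSpace Q] [ChartedSpace (EuclideanSpace ℝ (Fin 11)) Q]

theorem Lift.form_apply (K : Lift S Q) (i : Fin 6) (q : Q) (v : TangentSpace (𝓡 11) q) :
    K.form i q v = ∑ j, K.coeff q i j * pullback K.proj (S.form j) q v := by
  have h : ∀ g : Fin 6 → ℝ,
      (∑ j, g j • pullback K.proj (S.form j) q : EuclideanSpace ℝ (Fin 11) →L[ℝ] ℝ) v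
        = ∑ j, g j * pullback K.proj (S.form j) q v := fun g => sum_apply _ _ _
  exact h _

theorem Lift.IsFlatCompletion.exists_dual_form {K : Lift S Q} {B : Fin 5 → OneForm 11 Q}
    (h : K.IsFlatCompletion B) (q : Q) :
    ∃ u : Fin 6 → TangentSpace (𝓡 11) q, ∀ i j, K.form i q (u j) = if i = j then 1 else 0 := by
  obtain ⟨e, he⟩ := exists_dual_vectors (h.2.1 q)
  let σ : Fin 6 → Fin 4 ⊕ Fin 6 ⊕ Unit :=
    ![Sum.inl 3, Sum.inl 0, Sum.inl 1, Sum.inl 2, Sum.inr (Sum.inl 2), Sum.inr (Sum.inl 1)]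
  have hσ : Function.Injective σ := by decide
  refine ⟨fun j => e (σ j), fun i j => ?_⟩
  have h1 := he (σ i) (σ j)
  rw [if_congr hσ.eq_iff rfl rfl] at h1
  rw [← h1]
  fin_cases i <;> rfl

/-- The lifted forms are part of a coframe, so they have dual vectors. Combining these with the
columns of the coefficient matrix gives vectors dual to the pulled back forms. In particular the
latter are independent, although nothing was assumed about the rank of the projection. -/
theorem Lift.IsFlatCompletion.exists_dual {K : Lift S Q} {B : Fin 5 → OneForm 11 Q}
    (h : K.IsFlatCompletion B) (q : Q) :
    ∃ e : Fin 6 → TangentSpace (𝓡 11) q, ∀ i j,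
      pullback K.proj (S.form i) q (e j) = if i = j then 1 else 0 := by
  obtain ⟨u, hu⟩ := h.exists_dual_form q
  have hG : IsUnit (K.coeff q).det := (K.isParaCRMatrix q).2.isUnit
  refine ⟨fun k => ∑ l, K.coeff q l k • u l, fun i k => ?_⟩
  have hf : ∀ l, K.form l q (∑ l, K.coeff q l k • u l) = K.coeff q l k := by
    intro l
    rw [map_sum]
    simp [hu]
  have h1 : ∀ v, pullback K.proj (S.form i) q v
      = ∑ l, (K.coeff q)⁻¹ i l * K.form l q v := by
    intro v
    simp only [K.form_apply, Finset.mul_sum, ← mul_assoc]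
    rw [Finset.sum_comm]
    simp only [← Finset.sum_mul, ← Matrix.mul_apply, Matrix.nonsing_inv_mul _ hG]
    simp [Matrix.one_apply]
  rw [h1]
  simp only [hf, ← Matrix.mul_apply, Matrix.nonsing_inv_mul _ hG, Matrix.one_apply]

/-- The inverse has the same shape, so the lower right block of `G` is inverted by that of `G⁻¹`,
and the two determinants multiply to 1. -/
theorem IsParaCRMatrix.det_block_ne_zero {G : Matrix (Fin 6) (Fin 6) ℝ} (h : IsParaCRMatrix G) :
    G 4 4 * G 5 5 - G 4 5 * G 5 4 ≠ 0 := by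
  have h1 := Matrix.mul_nonsing_inv G h.2.isUnit
  have e : ∀ i j, (G * G⁻¹) i j = (1 : Matrix (Fin 6) (Fin 6) ℝ) i j := fun i j => by rw [h1]
  simp only [Matrix.mul_apply, Fin.sum_univ_six] at e
  have e44 := e 4 4
  have e45 := e 4 5
  have e54 := e 5 4
  have e55 := e 5 5
  have z : ∀ {i j}, paraCRSupport i j = false → G⁻¹ i j = 0 := fun hij => h.inv.apply_eq_zero hij
  rw [z (i := 0) (j := 4) (by decide), z (i := 1) (j := 4) (by decide),
    z (i := 2) (j := 4) (by decide), z (i := 3) (j := 4) (by decide)] at e44 e54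
  rw [z (i := 0) (j := 5) (by decide), z (i := 1) (j := 5) (by decide),
    z (i := 2) (j := 5) (by decide), z (i := 3) (j := 5) (by decide)] at e45 e55
  simp at e44 e45 e54 e55
  intro h0
  have : (G 4 4 * G 5 5 - G 4 5 * G 5 4) * (G⁻¹ 4 4 * G⁻¹ 5 5 - G⁻¹ 4 5 * G⁻¹ 5 4) = 1 := by
    calc _ = (G 4 4 * G⁻¹ 4 4 + G 4 5 * G⁻¹ 5 4) * (G 5 4 * G⁻¹ 4 5 + G 5 5 * G⁻¹ 5 5)
        - (G 4 4 * G⁻¹ 4 5 + G 4 5 * G⁻¹ 5 5) * (G 5 4 * G⁻¹ 4 4 + G 5 5 * G⁻¹ 5 4) := by ring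
      _ = 1 := by rw [e44, e45, e54, e55]; ring
  rw [h0, zero_mul] at this
  exact zero_ne_one this

theorem IsParaCRMatrix.apply_zero_zero_ne_zero {G : Matrix (Fin 6) (Fin 6) ℝ}
    (h : IsParaCRMatrix G) : G 0 0 ≠ 0 := by
  intro h0
  refine h.2 (Matrix.det_eq_zero_of_row_eq_zero 0 fun j => ?_)
  fin_cases j
  · exact h0
  all_goals exact h.apply_eq_zero (by decide)

end Dual

/-! ### First-order equations for the coefficients of a lift of the flat structure. -/

section FlatLift

variable {Q : Type*} [TopologicalSpace Q] [ChartedSpace (EuclideanSpace ℝ (Fin 11)) Q]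
  {K : Lift flatModel Q} {C : Fin 5 → OneForm 11 Q}

theorem pullback_flatForm_zero (F : Q → EuclideanSpace ℝ (Fin 6))
    (hF : ContMDiff (𝓡 11) (𝓡 6) ∞ F) : pullback (n := 11) F (flatForm 0)
      = (ModelCoords.ofBase (fun _ => true) F 1 1 1 0 0).lam := by
  funext q
  exact ContinuousLinearMap.ext fun v =>
    congrFun (pullback_flatForm_apply (hF.mdifferentiable (by simp) q) v) 0

variable [IsManifold (𝓡 11) ∞ Q]

theorem Lift.extD_form_apply {M : Type*} [TopologicalSpace M]
    [ChartedSpace (EuclideanSpace ℝ (Fin 6)) M] [IsManifold (𝓡 6) ∞ M] {S : Structure123 M}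
    (K : Lift S Q) (i : Fin 6) (q : Q) (v w : TangentSpace (𝓡 11) q) :
    extD (K.form i) q v w = ∑ j, (diff (fun q => K.coeff q i j) q v * pullback K.proj (S.form j) q w
      - diff (fun q => K.coeff q i j) q w * pullback K.proj (S.form j) q v
      + K.coeff q i j * extD (pullback (n := 11) K.proj (S.form j)) q v w) := by
  have h : K.form i = (fun q => K.coeff q i 0 • pullback K.proj (S.form 0) q)
      + (fun q => K.coeff q i 1 • pullback K.proj (S.form 1) q)
      + (fun q => K.coeff q i 2 • pullback K.proj (S.form 2) q)
      + (fun q => K.coeff q i 3 • pullback K.proj (S.form 3) q)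
      + (fun q => K.coeff q i 4 • pullback K.proj (S.form 4) q)
      + (fun q => K.coeff q i 5 • pullback K.proj (S.form 5) q) := by
    funext q
    exact Fin.sum_univ_six _
  have hs : ∀ j, HasExtDerivAt
      (fun q => K.coeff q i j • pullback K.proj (S.form j) q : OneForm 11 Q) q _ :=
    fun j => (((S.smooth j).pullback K.smooth_proj).hasExtDerivAt q).smul
      ((K.smooth_coeff i j).mdifferentiable (by simp) q)
  rw [h, Fin.sum_univ_six]
  exact ((((((hs 0).add (hs 1)).add (hs 2)).add (hs 3)).add (hs 4)).add (hs 5)).2 v w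

/-- This is dλ = dx ∧ (da₁ + y da₃) + dy ∧ (da₂ + x da₃), with the differentials expressed by the
flat forms themselves so that it can be evaluated on dual vectors. -/
theorem extD_pullback_flatForm {F : Q → EuclideanSpace ℝ (Fin 6)}
    (hF : ContMDiff (𝓡 11) (𝓡 6) ∞ F) (q : Q) (v w : TangentSpace (𝓡 11) q) (j : Fin 6) :
    extD (pullback (n := 11) F (flatForm j)) q v w = if j = 0 then
      pullback F (flatForm 4) q v * (pullback F (flatForm 1) q w
          + F q 1 * pullback F (flatForm 3) q w)
        - pullback F (flatForm 4) q w * (pullback F (flatForm 1) q v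
          + F q 1 * pullback F (flatForm 3) q v)
        + pullback F (flatForm 5) q v * (pullback F (flatForm 2) q w
          + F q 0 * pullback F (flatForm 3) q w)
        - pullback F (flatForm 5) q w * (pullback F (flatForm 2) q v
          + F q 0 * pullback F (flatForm 3) q v) else 0 := by
  have hd : ∀ q, MDifferentiableAt (𝓡 11) (𝓡 6) F q := hF.mdifferentiable (by simp)
  have key : ∀ (q : Q) (v : TangentSpace (𝓡 11) q) (j : Fin 6), _ := fun q v j =>
    congrFun (pullback_flatForm_apply (hd q) v) j
  have h1 : pullback (n := 11) F (flatForm 1) = diff (fun z => F z 3) :=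
    funext fun q => ContinuousLinearMap.ext fun v => key q v 1
  have h2 : pullback (n := 11) F (flatForm 2) = diff (fun z => F z 4) :=
    funext fun q => ContinuousLinearMap.ext fun v => key q v 2
  have h3 : pullback (n := 11) F (flatForm 3) = diff (fun z => F z 5) :=
    funext fun q => ContinuousLinearMap.ext fun v => key q v 3
  have h4 : pullback (n := 11) F (flatForm 4) = diff (fun z => F z 0) :=
    funext fun q => ContinuousLinearMap.ext fun v => key q v 4
  have h5 : pullback (n := 11) F (flatForm 5) = diff (fun z => F z 1) :=
    funext fun q => ContinuousLinearMap.ext fun v => key q v 5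
  have hz : ∀ k, extD (diff (n := 11) (fun z => F z k)) q v w = 0 := fun k =>
    (HasExtDerivAt.diff (contMDiff_coord_comp hF k)).2 v w
  fin_cases j
  · simp only [Fin.zero_eta, if_true]
    rw [h1, h2, h3, h4, h5, pullback_flatForm_zero F hF]
    have hc : (ModelCoords.ofBase (fun _ => true) F 1 1 1 0 0).IsAdmissible :=
      ModelCoords.ofBase_isAdmissible (fun _ => by simp) hF contMDiff_const contMDiff_const
        contMDiff_const contMDiff_const contMDiff_const (by simp) (by simp) (by simp)
    exact (hc.hasExtDerivAt_lam q).2 v w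
  · exact (congrArg (fun η : OneForm 11 Q => extD η q v w) h1).trans (hz 3)
  · exact (congrArg (fun η : OneForm 11 Q => extD η q v w) h2).trans (hz 4)
  · exact (congrArg (fun η : OneForm 11 Q => extD η q v w) h3).trans (hz 5)
  · exact (congrArg (fun η : OneForm 11 Q => extD η q v w) h4).trans (hz 0)
  · exact (congrArg (fun η : OneForm 11 Q => extD η q v w) h5).trans (hz 1)

/-- The structure equations for `θ¹`, `θ²`, `θ⁴` on pairs of vectors dual to one of `dx`, `dy` and
to one of `da₁`, `da₂`, `da₃`. -/
theorem Lift.IsFlatCompletion.coefficient_equations (h : K.IsFlatCompletion C) (q : Q)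
    {e : Fin 6 → TangentSpace (𝓡 11) q}
    (he : ∀ i j, pullback K.proj (flatModel.form i) q (e j) = if i = j then 1 else 0) :
    ∃ ξ ξ' : Fin 6 → ℝ, ∀ a ∈ ({4, 5} : Finset (Fin 6)), ∀ b ∈ ({1, 2, 3} : Finset (Fin 6)),
      ∃ l : ℝ, l = (if a = 4 then ![0, 1, 0, K.proj q 1, 0, 0] b else
        ![0, 0, 1, K.proj q 0, 0, 0] b) ∧
      K.coeff q 0 0 * l = K.coeff q 5 a * K.coeff q 1 b + K.coeff q 4 a * K.coeff q 2 b ∧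
      diff (fun q => K.coeff q 1 b) q (e a) + K.coeff q 1 0 * l
        = ξ a * K.coeff q 1 b - K.coeff q 4 a * K.coeff q 3 b ∧
      diff (fun q => K.coeff q 2 b) q (e a) + K.coeff q 2 0 * l
        = ξ' a * K.coeff q 2 b - K.coeff q 5 a * K.coeff q 3 b := by
  have hf : ∀ i j, K.form i q (e j) = K.coeff q i j := fun i j => by
    rw [K.form_apply]
    simp [he]
  have z : ∀ {q i j}, paraCRSupport i j = false → K.coeff q i j = 0 := fun hij =>
    (K.isParaCRMatrix _).apply_eq_zero hij
  have dz : ∀ {i j} (v : TangentSpace (𝓡 11) q), paraCRSupport i j = false → diff (fun q => K.coeff q i j) q v = 0 := by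
    intro i j v hij
    rw [show (fun q => K.coeff q i j) = fun _ => 0 from funext fun q => z hij]
    exact diff_const 0 q v
  have hl : ∀ a ∈ ({4, 5} : Finset (Fin 6)), ∀ b ∈ ({1, 2, 3} : Finset (Fin 6)), ∀ j,
      extD (pullback (n := 11) K.proj (flatModel.form j)) q (e a) (e b)
        = if j = 0 then (if a = 4 then ![0, 1, 0, K.proj q 1, 0, 0] b else
        ![0, 0, 1, K.proj q 0, 0, 0] b) else 0 := by
    intro a ha b hb j
    refine (extD_pullback_flatForm K.smooth_proj q (e a) (e b) j).trans ?_
    by_cases hj : j = 0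
    · simp only [hj, if_true]
      have he' : ∀ i j, pullback K.proj (flatForm i) q (e j) = if i = j then 1 else 0 := he
      simp only [he']
      fin_cases ha <;> fin_cases hb <;> simp
    · simp [hj]
  have z4 : ∀ i ∈ ({0, 1, 2, 3} : Finset (Fin 6)), ∀ a ∈ ({4, 5} : Finset (Fin 6)),
      paraCRSupport i a = false := by decide
  have z1 : ∀ i ∈ ({0, 4, 5} : Finset (Fin 6)), ∀ b ∈ ({1, 2, 3} : Finset (Fin 6)),
      paraCRSupport i b = false := by decide
  have hD : ∀ i ∈ ({0, 1, 2, 3} : Finset (Fin 6)), ∀ a ∈ ({4, 5} : Finset (Fin 6)),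
      ∀ b ∈ ({1, 2, 3} : Finset (Fin 6)), extD (K.form i) q (e a) (e b)
        = diff (fun q => K.coeff q i b) q (e a) + K.coeff q i 0 *
          (if a = 4 then ![0, 1, 0, K.proj q 1, 0, 0] b else
            ![0, 0, 1, K.proj q 0, 0, 0] b) := by
    intro i hi a ha b hb
    rw [K.extD_form_apply]
    simp only [hl a ha b hb, he]
    simp [Finset.sum_add_distrib, dz _ (z4 i hi a ha)]
  have hs := h.smoothFlat.flat
  -- Both vectors are annihilated by θ⁴, so Ω₄, Ω₅ and Ω₆ drop out. Of the completion only Ω₁ ∓ A/2,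
  -- evaluated on `e a`, is left, and these values are independent of b.
  refine ⟨fun a => K.Omega C 0 q (e a) - 1 / 2 * C 4 q (e a),
    fun a => -K.Omega C 0 q (e a) - 1 / 2 * C 4 q (e a), fun a ha b hb => ⟨_, rfl, ?_, ?_, ?_⟩⟩
  · have e3 : extD (K.form 0) q (e a) (e b) = wedge (K.form 5) (K.form 1) q (e a) (e b)
      + wedge (K.form 4) (K.form 2) q (e a) (e b)
      - wedge (K.Omega C 5) (K.form 0) q (e a) (e b)
      - 1 / 2 * wedge (C 4) (K.form 0) q (e a) (e b) := hs.dθ3 q (e a) (e b)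
    rw [hD 0 (by decide) a ha b hb, dz _ (z1 0 (by decide) b hb)] at e3
    simp only [wedge_apply, hf, z (z4 0 (by decide) a ha), z (z4 1 (by decide) a ha),
      z (z4 2 (by decide) a ha), z (z1 0 (by decide) b hb), z (z1 4 (by decide) b hb),
      z (z1 5 (by decide) b hb)] at e3
    linear_combination e3
  · have e0 : extD (K.form 1) q (e a) (e b) = wedge (K.Omega C 0) (K.form 1) q (e a) (e b)
      - 1 / 2 * wedge (C 4) (K.form 1) q (e a) (e b) - wedge (K.form 4) (K.form 3) q (e a) (e b)
      - wedge (K.Omega C 4) (K.form 0) q (e a) (e b) := hs.dθ0 q (e a) (e b)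
    rw [hD 1 (by decide) a ha b hb] at e0
    simp only [wedge_apply, hf, z (z4 0 (by decide) a ha), z (z4 1 (by decide) a ha),
      z (z4 3 (by decide) a ha), z (z1 0 (by decide) b hb), z (z1 4 (by decide) b hb)] at e0
    linear_combination e0
  · have e1 : extD (K.form 2) q (e a) (e b) = -wedge (K.Omega C 0) (K.form 2) q (e a) (e b)
      - 1 / 2 * wedge (C 4) (K.form 2) q (e a) (e b) - wedge (K.form 5) (K.form 3) q (e a) (e b)
      - wedge (K.Omega C 3) (K.form 0) q (e a) (e b) := hs.dθ1 q (e a) (e b)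
    rw [hD 2 (by decide) a ha b hb] at e1
    simp only [wedge_apply, hf, z (z4 0 (by decide) a ha), z (z4 2 (by decide) a ha),
      z (z4 3 (by decide) a ha), z (z1 0 (by decide) b hb), z (z1 5 (by decide) b hb)] at e1
    linear_combination e1

end FlatLift

section FlatLift

variable {Q : Type*} [TopologicalSpace Q] [ChartedSpace (EuclideanSpace ℝ (Fin 11)) Q]
  [IsManifold (𝓡 11) ∞ Q] {K : Lift flatModel Q} {C : Fin 5 → OneForm 11 Q}

/-- The values of dλ satisfy l₃ = y l₁ + x l₂ for both choices of `a`. By the equation for θ⁴ the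
same combination of the coefficients of θ¹ and θ² is killed by the 2 × 2 block of Ω₃, Ω₂, which is
invertible. -/
theorem Lift.IsFlatCompletion.coeff_three_eq (h : K.IsFlatCompletion C) (q : Q) :
    K.coeff q 1 3 = K.proj q 1 * K.coeff q 1 1 + K.proj q 0 * K.coeff q 1 2 ∧
    K.coeff q 2 3 = K.proj q 1 * K.coeff q 2 1 + K.proj q 0 * K.coeff q 2 2 := by
  obtain ⟨e, he⟩ := h.exists_dual q
  obtain ⟨ξ, ξ', H⟩ := h.coefficient_equations q he
  have hd := (K.isParaCRMatrix q).det_block_ne_zero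
  obtain ⟨_, rfl, a1, -⟩ := H 4 (by decide) 1 (by decide)
  obtain ⟨_, rfl, a2, -⟩ := H 4 (by decide) 2 (by decide)
  obtain ⟨_, rfl, a3, -⟩ := H 4 (by decide) 3 (by decide)
  obtain ⟨_, rfl, b1, -⟩ := H 5 (by decide) 1 (by decide)
  obtain ⟨_, rfl, b2, -⟩ := H 5 (by decide) 2 (by decide)
  obtain ⟨_, rfl, b3, -⟩ := H 5 (by decide) 3 (by decide)
  simp at a1 a2 a3 b1 b2 b3
  constructor
  · refine sub_eq_zero.1 (mul_left_cancel₀ hd ?_)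
    linear_combination K.coeff q 4 5 * (a3 - K.proj q 1 * a1 - K.proj q 0 * a2)
      - K.coeff q 4 4 * (b3 - K.proj q 1 * b1 - K.proj q 0 * b2)
  · refine sub_eq_zero.1 (mul_left_cancel₀ hd ?_)
    linear_combination K.coeff q 5 4 * (b3 - K.proj q 1 * b1 - K.proj q 0 * b2)
      - K.coeff q 5 5 * (a3 - K.proj q 1 * a1 - K.proj q 0 * a2)

/-- The dual vectors of the flat forms, and the resulting equations for the coefficients and their
derivatives at a point. -/
theorem Lift.IsFlatCompletion.coefficient_relations (h : K.IsFlatCompletion C) (q : Q) :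
    ∃ r : ℝ, r = K.coeff q 3 3 - K.proj q 1 * K.coeff q 3 1 - K.proj q 0 * K.coeff q 3 2 ∧
      r ≠ 0 ∧ K.coeff q 1 1 = -K.coeff q 4 5 * r ∧ K.coeff q 1 2 = -K.coeff q 4 4 * r ∧
      K.coeff q 2 1 = -K.coeff q 5 5 * r ∧ K.coeff q 2 2 = -K.coeff q 5 4 * r ∧
      K.coeff q 4 4 * K.coeff q 5 4 = 0 ∧ K.coeff q 4 5 * K.coeff q 5 5 = 0 ∧
      K.coeff q 0 0 = -r * (K.coeff q 5 4 * K.coeff q 4 5 + K.coeff q 4 4 * K.coeff q 5 5) ∧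
      ((∀ v : TangentSpace (𝓡 11) q, diff (fun q => K.coeff q 1 2) q v = 0) → K.coeff q 1 2 = 0 →
        K.coeff q 1 0 = -K.coeff q 4 5 * K.coeff q 3 2) ∧
      ((∀ v : TangentSpace (𝓡 11) q, diff (fun q => K.coeff q 2 1) q v = 0) → K.coeff q 2 1 = 0 →
        K.coeff q 2 0 = -K.coeff q 5 4 * K.coeff q 3 1) ∧
      ((∀ v : TangentSpace (𝓡 11) q, diff (fun q => K.coeff q 1 1) q v = 0) → K.coeff q 1 1 = 0 →
        K.coeff q 1 0 = -K.coeff q 4 4 * K.coeff q 3 1) ∧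
      ((∀ v : TangentSpace (𝓡 11) q, diff (fun q => K.coeff q 2 2) q v = 0) → K.coeff q 2 2 = 0 →
        K.coeff q 2 0 = -K.coeff q 5 5 * K.coeff q 3 2) := by
  obtain ⟨e, he⟩ := h.exists_dual q
  obtain ⟨ξ, ξ', H⟩ := h.coefficient_equations q he
  have ha := (K.isParaCRMatrix q).apply_zero_zero_ne_zero
  have hF : MDifferentiableAt (𝓡 11) (𝓡 6) K.proj q := K.smooth_proj.mdifferentiable (by simp) q
  have hFk : ∀ k, MDifferentiableAt (𝓡 11) 𝓘(ℝ) (fun q => K.proj q k) q := fun k =>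
    (contMDiff_coord_comp K.smooth_proj k).mdifferentiable (by simp) q
  have hG : ∀ i j, MDifferentiableAt (𝓡 11) 𝓘(ℝ) (fun q => K.coeff q i j) q := fun i j =>
    (K.smooth_coeff i j).mdifferentiable (by simp) q
  have dx : ∀ j, diff (fun q => K.proj q 0) q (e j) = if 4 = j then 1 else 0 := fun j =>
    (congrFun (pullback_flatForm_apply hF (e j)) 4).symm.trans (he 4 j)
  have dy : ∀ j, diff (fun q => K.proj q 1) q (e j) = if 5 = j then 1 else 0 := fun j =>
    (congrFun (pullback_flatForm_apply hF (e j)) 5).symm.trans (he 5 j)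
  -- The relation for the third coefficients holds at all points, so it may be differentiated. The
  -- derivatives of x and y bring in undifferentiated coefficients.
  have d3 : ∀ i, (∀ q, K.coeff q i 3 = K.proj q 1 * K.coeff q i 1 + K.proj q 0 * K.coeff q i 2) →
      ∀ j, diff (fun q => K.coeff q i 3) q (e j)
        = K.proj q 1 * diff (fun q => K.coeff q i 1) q (e j)
          + K.coeff q i 1 * (if 5 = j then 1 else 0)
          + (K.proj q 0 * diff (fun q => K.coeff q i 2) q (e j)
          + K.coeff q i 2 * (if 4 = j then 1 else 0)) := by
    intro i hi j
    have h1 : MDifferentiableAt (𝓡 11) 𝓘(ℝ) (fun q => K.proj q 1 * K.coeff q i 1) q :=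
      (hFk 1).mul (hG i 1)
    have h2 : MDifferentiableAt (𝓡 11) 𝓘(ℝ) (fun q => K.proj q 0 * K.coeff q i 2) q :=
      (hFk 0).mul (hG i 2)
    rw [show (fun q => K.coeff q i 3) = _ from funext hi, diff_add_apply h1 h2,
      diff_mul_apply (hFk 1) (hG i 1), diff_mul_apply (hFk 0) (hG i 2), dx, dy]
  have e1 := d3 1 fun q => (h.coeff_three_eq q).1
  have e2 := d3 2 fun q => (h.coeff_three_eq q).2
  obtain ⟨c1, c2⟩ := h.coeff_three_eq q
  obtain ⟨_, rfl, a1, a2, a3⟩ := H 4 (by decide) 1 (by decide)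
  obtain ⟨_, rfl, a4, a5, a6⟩ := H 4 (by decide) 2 (by decide)
  obtain ⟨_, rfl, a7, a8, a9⟩ := H 4 (by decide) 3 (by decide)
  obtain ⟨_, rfl, b1, b2, b3⟩ := H 5 (by decide) 1 (by decide)
  obtain ⟨_, rfl, b4, b5, b6⟩ := H 5 (by decide) 2 (by decide)
  obtain ⟨_, rfl, b7, b8, b9⟩ := H 5 (by decide) 3 (by decide)
  rw [e1, c1] at a8 b8
  rw [e2, c2] at a9 b9
  simp at a1 a2 a3 a4 a5 a6 a7 a8 a9 b1 b2 b3 b4 b5 b6 b7 b8 b9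
  set r := K.coeff q 3 3 - K.proj q 1 * K.coeff q 3 1 - K.proj q 0 * K.coeff q 3 2 with hr
  -- In the equation for b = 3, less y times that for b = 1 and x times that for b = 2, every
  -- derivative and the unknown ξ cancel.
  have g12 : K.coeff q 1 2 = -K.coeff q 4 4 * r := by
    linear_combination a8 - K.proj q 1 * a2 - K.proj q 0 * a5
  have g11 : K.coeff q 1 1 = -K.coeff q 4 5 * r := by
    linear_combination b8 - K.proj q 1 * b2 - K.proj q 0 * b5
  have g22 : K.coeff q 2 2 = -K.coeff q 5 4 * r := by
    linear_combination a9 - K.proj q 1 * a3 - K.proj q 0 * a6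
  have g21 : K.coeff q 2 1 = -K.coeff q 5 5 * r := by
    linear_combination b9 - K.proj q 1 * b3 - K.proj q 0 * b6
  have hr0 : r ≠ 0 := by
    intro h0
    rw [g11, g21, h0] at a1
    simp at a1
    exact ha a1
  refine ⟨r, rfl, hr0, g11, g12, g21, g22, ?_, ?_, ?_, ?_, ?_, ?_, ?_⟩
  -- The coefficient of dx ∧ da₂ in dλ is zero. With the formulas just found, this says that the
  -- product of the two dx-coefficients of Ω₃ and Ω₂ vanishes.
  · refine mul_left_cancel₀ hr0 ?_
    rw [g12, g22] at a4
    linear_combination 1 / 2 * a4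
  · refine mul_left_cancel₀ hr0 ?_
    rw [g11, g21] at b1
    linear_combination 1 / 2 * b1
  · rw [g11, g21] at a1
    linear_combination a1
  -- Where an entry and its differential both vanish, the derivative and the term with ξ disappear,
  -- which leaves a formula for a coefficient of λ.
  · intro hd h0
    rw [hd, h0] at b5
    linear_combination b5
  · intro hd h0
    rw [hd, h0] at a3
    linear_combination a3
  · intro hd h0
    rw [hd, h0] at a2
    linear_combination a2
  · intro hd h0
    rw [hd, h0] at b6
    linear_combination b6

end FlatLift

theorem sum_smul_eq_add_of_ne_zero {V : Type*} [AddCommGroup V] [Module ℝ V] {f g : Fin 6 → ℝ}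
    {x : Fin 6 → V} (h : ∀ j, j ≠ 0 → f j = g j) :
    ∑ j, g j • x j = ∑ j, f j • x j + (g 0 - f 0) • x 0 := by
  rw [Fin.sum_univ_succ, Fin.sum_univ_succ (n := 5)]
  simp only [h _ (Fin.succ_ne_zero _)]
  module

/-! ### Identification of a completed lift with its model. -/

section FlatLift

variable {Q : Type*} [TopologicalSpace Q] [ChartedSpace (EuclideanSpace ℝ (Fin 11)) Q]

/-- Whether the forms `Ω₂`, `Ω₃` of a lift are multiples of `dx`, `dy` or of `dy`, `dx`. -/
def Lift.sheet (K : Lift flatModel Q) (q : Q) : Bool :=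
  open scoped Classical in decide (K.coeff q 4 5 ≠ 0)

/-- The model coordinates defined by the coefficients of a lift. -/
def Lift.model (K : Lift flatModel Q) : ModelCoords Q :=
  ModelCoords.ofBase K.sheet K.proj (fun q => K.coeff q 0 0)
    (fun q => K.coeff q 1 1 + K.coeff q 1 2) (fun q => K.coeff q 2 1 + K.coeff q 2 2)
    (fun q => K.coeff q 1 0 * (K.coeff q 1 1 + K.coeff q 1 2)⁻¹)
    (fun q => K.coeff q 2 0 * (K.coeff q 2 1 + K.coeff q 2 2)⁻¹)

variable [IsManifold (𝓡 11) ∞ Q] {K : Lift flatModel Q} {C : Fin 5 → OneForm 11 Q}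

/-- The block of Ω₃, Ω₂ is invertible and each column has a zero entry, so it is either diagonal or
antidiagonal. These are the two sheets, and both alternatives are open conditions. -/
theorem Lift.IsFlatCompletion.coeff_ne_zero_iff (h : K.IsFlatCompletion C) (q : Q) :
    K.coeff q 4 5 ≠ 0 ↔ K.coeff q 5 5 = 0 := by
  obtain ⟨r, -, -, -, -, -, -, -, h1, -⟩ := h.coefficient_relations q
  have hd := (K.isParaCRMatrix q).det_block_ne_zero
  constructor
  · exact fun h45 => (mul_eq_zero.1 h1).resolve_left h45
  · intro h0 h45
    simp [h0, h45] at hd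

theorem Lift.IsFlatCompletion.sheet_eventually_eq (h : K.IsFlatCompletion C) (q : Q) :
    ∀ᶠ q' in nhds q, K.sheet q' = K.sheet q := by
  have hc : ∀ i j, Continuous fun q => K.coeff q i j := fun i j => (K.smooth_coeff i j).continuous
  by_cases hq : K.coeff q 4 5 = 0
  · have h1 : K.coeff q 5 5 ≠ 0 := fun h0 => (h.coeff_ne_zero_iff q).2 h0 hq
    filter_upwards [(hc 5 5).continuousAt.eventually_ne h1] with q' hq'
    have : K.coeff q' 4 5 = 0 := by
      by_contra h0
      exact hq' ((h.coeff_ne_zero_iff q').1 h0)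
    simp [Lift.sheet, this, hq]
  · filter_upwards [(hc 4 5).continuousAt.eventually_ne hq] with q' hq'
    simp [Lift.sheet, hq, hq']

theorem diff_eq_zero_of_eventually {n : ℕ} {M : Type*} [TopologicalSpace M]
    [ChartedSpace (EuclideanSpace ℝ (Fin n)) M] {f : M → ℝ} {p : M} {c : ℝ}
    (h : ∀ᶠ q in nhds p, f q = c) (v : TangentSpace (𝓡 n) p) : diff f p v = 0 := by
  rw [diff_congr (g := fun _ => c) h, diff_const]

/-- The coefficients of a lift with a flat completion are those of the model coordinates, except
for the coefficients of `λ` in `θ³`, `Ω₂`, `Ω₃`. -/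
theorem Lift.IsFlatCompletion.coeff_eq_liftMatrix (h : K.IsFlatCompletion C) (q : Q) :
    (K.model.a q ≠ 0 ∧ K.model.p q ≠ 0 ∧ K.model.q q ≠ 0) ∧ ∀ i j : Fin 6, (j ≠ 0 ∨ i < 3) →
      K.coeff q i j = liftMatrix (K.sheet q) (K.model.X q) (K.model.Y q) (K.model.a q)
        (K.model.p q) (K.model.q q) (K.model.m q) (K.model.n q) i j := by
  obtain ⟨r, hr, hr0, g11, g12, g21, g22, z1, z2, ga, k1, k2, k3, k4⟩ := h.coefficient_relations q
  obtain ⟨c1, c2⟩ := h.coeff_three_eq q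
  have hd := (K.isParaCRMatrix q).det_block_ne_zero
  have ha := (K.isParaCRMatrix q).apply_zero_zero_ne_zero
  have hs := h.sheet_eventually_eq q
  have z : ∀ {i j}, paraCRSupport i j = false → K.coeff q i j = 0 := fun hij =>
    (K.isParaCRMatrix _).apply_eq_zero hij
  have ea : K.model.a q = K.coeff q 0 0 := rfl
  have ep : K.model.p q = K.coeff q 1 1 + K.coeff q 1 2 := rfl
  have eq : K.model.q q = K.coeff q 2 1 + K.coeff q 2 2 := rfl
  have em : K.model.m q = K.coeff q 1 0 * (K.model.p q)⁻¹ := rfl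
  have en : K.model.n q = K.coeff q 2 0 * (K.model.q q)⁻¹ := rfl
  have eX : K.model.X q = bif K.sheet q then K.proj q 0 else K.proj q 1 := rfl
  have eY : K.model.Y q = bif K.sheet q then K.proj q 1 else K.proj q 0 := rfl
  set a := K.model.a q
  set p := K.model.p q
  set q' := K.model.q q
  set m := K.model.m q
  set n := K.model.n q
  set X := K.model.X q
  set Y := K.model.Y q
  have hsheet : ∀ q, K.sheet q = true ↔ K.coeff q 4 5 ≠ 0 := fun q => by simp [Lift.sheet]
  by_cases h45 : K.coeff q 4 5 = 0
  · have st : K.sheet q = false := by simp [Lift.sheet, h45]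
    rw [h45, zero_mul, sub_zero] at hd
    have h44 : K.coeff q 4 4 ≠ 0 := left_ne_zero_of_mul hd
    have h55 : K.coeff q 5 5 ≠ 0 := right_ne_zero_of_mul hd
    have h54 : K.coeff q 5 4 = 0 := (mul_eq_zero.1 z1).resolve_left h44
    -- On this sheet the two entries vanish on a neighbourhood, so their differentials vanish as
    -- well and the conditional relations apply.
    have near : ∀ᶠ q' in nhds q, K.coeff q' 1 1 = 0 ∧ K.coeff q' 2 2 = 0 := by
      filter_upwards [hs] with q' hq'
      obtain ⟨r, -, -, g11', -, -, g22', z1', -⟩ := h.coefficient_relations q'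
      have hd' := (K.isParaCRMatrix q').det_block_ne_zero
      have h45' : K.coeff q' 4 5 = 0 := by
        by_contra h0
        rw [st, ← Bool.not_eq_true, hsheet] at hq'
        exact hq' h0
      rw [h45', zero_mul, sub_zero] at hd'
      have h54' := (mul_eq_zero.1 z1').resolve_left (left_ne_zero_of_mul hd')
      rw [g11', g22', h45', h54']
      simp
    have m0 := k3 (fun v => diff_eq_zero_of_eventually (near.mono fun _ h => h.1) v)
      near.self_of_nhds.1
    have n0 := k4 (fun v => diff_eq_zero_of_eventually (near.mono fun _ h => h.2) v)
      near.self_of_nhds.2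
    rw [h54, zero_mul, zero_add] at ga
    rw [near.self_of_nhds.1] at ep c1
    rw [near.self_of_nhds.2] at eq c2
    rw [zero_add, g12] at ep
    rw [add_zero, g21] at eq
    rw [st, cond_false] at eX eY
    clear_value a p q' m n X Y
    have hp0 : p ≠ 0 := by rw [ep]; simp [h44, hr0]
    have hq0 : q' ≠ 0 := by rw [eq]; simp [h55, hr0]
    have ha0 : a ≠ 0 := by rwa [ea]
    -- Here p, q and a are -r, -r and -r times the entries of Ω₃, Ω₂ and their product, so that pq/a
    -- = -r.
    have hr' : -(p * q' * a⁻¹) = r := by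
      rw [ep, eq, ea, ga]
      field_simp
    have f10 : K.coeff q 1 0 = p * m := by rw [em]; field_simp
    have f20 : K.coeff q 2 0 = q' * n := by rw [en]; field_simp
    have f3m : K.coeff q 3 1 = -(p * q' * a⁻¹) * m := by
      rw [hr']
      refine mul_left_cancel₀ h44 ?_
      rw [f10, ep] at m0
      linear_combination m0
    have f3n : K.coeff q 3 2 = -(p * q' * a⁻¹) * n := by
      rw [hr']
      refine mul_left_cancel₀ h55 ?_
      rw [f20, eq] at n0
      linear_combination n0
    have f33 : K.coeff q 3 3 = -(p * q' * a⁻¹) * (1 + n * Y + m * X) := by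
      rw [hr'] at f3m f3n ⊢
      rw [eX, eY]
      linear_combination -hr + K.proj q 1 * f3m + K.proj q 0 * f3n
    have fp : K.coeff q 1 2 = p := by rw [ep, g12]
    have fq : K.coeff q 2 1 = q' := by rw [eq, g21]
    have f13 : K.coeff q 1 3 = p * Y := by rw [c1, eY, ← fp]; ring
    have f23 : K.coeff q 2 3 = q' * X := by rw [c2, eX, ← fq]; ring
    have f4 : K.coeff q 4 4 = a * q'⁻¹ := by rw [ea, ga, eq]; field_simp
    have f5 : K.coeff q 5 5 = a * p⁻¹ := by rw [ea, ga, ep]; field_simp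
    refine ⟨⟨ha0, hp0, hq0⟩, ?_⟩
    rw [st]
    intro i j hij
    fin_cases i <;> fin_cases j <;> first
      | exact absurd hij (by decide) | exact z (by decide) | exact ea.symm | exact f10
      | exact f20 | exact f3m | exact f3n | exact f33 | exact fp | exact fq | exact f13
      | exact f23 | exact f4 | exact f5 | exact near.self_of_nhds.1 | exact near.self_of_nhds.2
      | exact h45 | exact h54
  -- The other sheet: the same argument with ν₁, ν₂ interchanged, and with μ₁, μ₂ interchanged.
  · have st : K.sheet q = true := by simp [Lift.sheet, h45]
    have h55 : K.coeff q 5 5 = 0 := (mul_eq_zero.1 z2).resolve_left h45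
    rw [h55, mul_zero, zero_sub, neg_ne_zero] at hd
    have h54 : K.coeff q 5 4 ≠ 0 := right_ne_zero_of_mul hd
    have h44 : K.coeff q 4 4 = 0 := (mul_eq_zero.1 z1).resolve_right h54
    have near : ∀ᶠ q' in nhds q, K.coeff q' 1 2 = 0 ∧ K.coeff q' 2 1 = 0 := by
      filter_upwards [hs] with q' hq'
      obtain ⟨r, -, -, -, g12', g21', -, z1', z2', -⟩ := h.coefficient_relations q'
      have hd' := (K.isParaCRMatrix q').det_block_ne_zero
      have h45' : K.coeff q' 4 5 ≠ 0 := by rwa [st, hsheet] at hq'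
      have h55' : K.coeff q' 5 5 = 0 := (mul_eq_zero.1 z2').resolve_left h45'
      rw [h55', mul_zero, zero_sub, neg_ne_zero] at hd'
      have h44' := (mul_eq_zero.1 z1').resolve_right (right_ne_zero_of_mul hd')
      rw [g12', g21', h44', h55']
      simp
    have m0 := k1 (fun v => diff_eq_zero_of_eventually (near.mono fun _ h => h.1) v)
      near.self_of_nhds.1
    have n0 := k2 (fun v => diff_eq_zero_of_eventually (near.mono fun _ h => h.2) v)
      near.self_of_nhds.2
    rw [h44, zero_mul, add_zero] at ga
    rw [near.self_of_nhds.1] at ep c1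
    rw [near.self_of_nhds.2] at eq c2
    rw [add_zero, g11] at ep
    rw [zero_add, g22] at eq
    rw [st, cond_true] at eX eY
    clear_value a p q' m n X Y
    have hp0 : p ≠ 0 := by rw [ep]; simp [h45, hr0]
    have hq0 : q' ≠ 0 := by rw [eq]; simp [h54, hr0]
    have ha0 : a ≠ 0 := by rwa [ea]
    have hr' : -(p * q' * a⁻¹) = r := by
      rw [ep, eq, ea, ga]
      field_simp
    have f10 : K.coeff q 1 0 = p * m := by rw [em]; field_simp
    have f20 : K.coeff q 2 0 = q' * n := by rw [en]; field_simp
    have f3m : K.coeff q 3 2 = -(p * q' * a⁻¹) * m := by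
      rw [hr']
      refine mul_left_cancel₀ h45 ?_
      rw [f10, ep] at m0
      linear_combination m0
    have f3n : K.coeff q 3 1 = -(p * q' * a⁻¹) * n := by
      rw [hr']
      refine mul_left_cancel₀ h54 ?_
      rw [f20, eq] at n0
      linear_combination n0
    have f33 : K.coeff q 3 3 = -(p * q' * a⁻¹) * (1 + n * Y + m * X) := by
      rw [hr'] at f3m f3n ⊢
      rw [eX, eY]
      linear_combination -hr + K.proj q 0 * f3m + K.proj q 1 * f3n
    have fp : K.coeff q 1 1 = p := by rw [ep, g11]
    have fq : K.coeff q 2 2 = q' := by rw [eq, g22]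
    have f13 : K.coeff q 1 3 = p * Y := by rw [c1, eY, ← fp]; ring
    have f23 : K.coeff q 2 3 = q' * X := by rw [c2, eX, ← fq]; ring
    have f4 : K.coeff q 4 5 = a * q'⁻¹ := by rw [ea, ga, eq]; field_simp
    have f5 : K.coeff q 5 4 = a * p⁻¹ := by rw [ea, ga, ep]; field_simp
    refine ⟨⟨ha0, hp0, hq0⟩, ?_⟩
    rw [st]
    intro i j hij
    fin_cases i <;> fin_cases j <;> first
      | exact absurd hij (by decide) | exact z (by decide) | exact ea.symm | exact f10
      | exact f20 | exact f3m | exact f3n | exact f33 | exact fp | exact fq | exact f13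
      | exact f23 | exact f4 | exact f5 | exact near.self_of_nhds.1 | exact near.self_of_nhds.2
      | exact h44 | exact h55

/-- On each sheet exactly one summand of p and one of q is nonzero, so the sums are smooth and
nowhere zero without reference to the sheet. -/
theorem Lift.IsFlatCompletion.model_isAdmissible (h : K.IsFlatCompletion C) :
    K.model.IsAdmissible := by
  have hp : ∀ q, K.coeff q 1 1 + K.coeff q 1 2 ≠ 0 := fun q => (h.coeff_eq_liftMatrix q).1.2.1
  have hq : ∀ q, K.coeff q 2 1 + K.coeff q 2 2 ≠ 0 := fun q => (h.coeff_eq_liftMatrix q).1.2.2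
  have sp := (K.smooth_coeff 1 1).add (K.smooth_coeff 1 2)
  have sq := (K.smooth_coeff 2 1).add (K.smooth_coeff 2 2)
  exact ModelCoords.ofBase_isAdmissible h.sheet_eventually_eq K.smooth_proj (K.smooth_coeff 0 0)
    sp sq ((K.smooth_coeff 1 0).mul (ModelCoords.contMDiff_inv sp hp))
    ((K.smooth_coeff 2 0).mul (ModelCoords.contMDiff_inv sq hq))
    (fun q => (h.coeff_eq_liftMatrix q).1.1) hp hq

theorem ModelCoords.IsAdmissible.smoothFlat {c : ModelCoords Q} (hc : c.IsAdmissible) :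
    SmoothFlat c.theta c.Omega c.A :=
  ⟨hc.isSmooth_theta, hc.isSmooth_Omega, hc.isSmooth_A, hc.explicitFlat⟩

/-- A lift of the flat structure with a flat completion is given by the model forms. -/
theorem Lift.IsFlatCompletion.eq_model (h : K.IsFlatCompletion C) :
    K.model.theta = K.theta ∧ K.model.Omega = K.Omega C ∧ K.model.A = C 4 := by
  have hm := ModelCoords.sum_liftMatrix_smul (a := K.model.a) (p := K.model.p) (q := K.model.q)
    (m := K.model.m) (n := K.model.n) h.sheet_eventually_eq K.smooth_proj
  change ∀ (z : Q) (i : Fin 6), ∑ j, liftMatrix (K.sheet z) (K.model.X z) (K.model.Y z) (K.model.a z)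
    (K.model.p z) (K.model.q z) (K.model.m z) (K.model.n z) i j • pullback K.proj (flatForm j) z
    = ![K.model.theta 3 z, K.model.theta 0 z, K.model.theta 1 z, K.model.theta 2 z,
        K.model.Omega 2 z, K.model.Omega 1 z] i at hm
  set l : Q → Matrix (Fin 6) (Fin 6) ℝ := fun z => liftMatrix (K.sheet z) (K.model.X z)
    (K.model.Y z) (K.model.a z) (K.model.p z) (K.model.q z) (K.model.m z) (K.model.n z) with hl
  have hcoeff : ∀ z i j, (j ≠ 0 ∨ i < 3) → K.coeff z i j = l z i j :=
    fun z => (h.coeff_eq_liftMatrix z).2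
  have hform : ∀ z i, K.form i z = ∑ j, K.coeff z i j • pullback K.proj (flatForm j) z :=
    fun _ _ => rfl
  have h0 : ∀ z, K.form 0 z = K.coeff z 0 0 • pullback K.proj (flatForm 0) z := by
    intro z
    have hz : ∀ j : Fin 6, j ≠ 0 → K.coeff z 0 j = 0 := fun j hj =>
      (K.isParaCRMatrix z).apply_eq_zero (by revert j; decide)
    rw [hform, Finset.sum_eq_single 0 (fun j _ hj => by rw [hz j hj, zero_smul]) (by simp)]
  -- The lift and its model can differ only in coefficients of λ, and λ is a multiple of θ⁴.
  have key : ∀ (z : Q) (i : Fin 6), ![K.model.theta 3 z, K.model.theta 0 z, K.model.theta 1 z,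
      K.model.theta 2 z, K.model.Omega 2 z, K.model.Omega 1 z] i
      = K.form i z + ((l z i 0 - K.coeff z i 0) * (K.coeff z 0 0)⁻¹) • K.form 0 z := by
    intro z i
    rw [← hm, h0, smul_smul, mul_assoc,
      inv_mul_cancel₀ (K.isParaCRMatrix z).apply_zero_zero_ne_zero, mul_one, hform]
    exact sum_smul_eq_add_of_ne_zero fun j hj => hcoeff z i j (Or.inl hj)
  have small : ∀ (z : Q) (i : Fin 6), i < 3 → ![K.model.theta 3 z, K.model.theta 0 z, K.model.theta 1 z,
      K.model.theta 2 z, K.model.Omega 2 z, K.model.Omega 1 z] i = K.form i z := by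
    intro z i hi
    rw [key, hcoeff z i 0 (Or.inr hi), sub_self, zero_mul, zero_smul, add_zero]
  -- The completed lift is the reference coframe in the comparison, since its independence is known.
  -- That of the model forms over `Q` is a consequence.
  exact h.smoothFlat.rigid h.model_isAdmissible.smoothFlat h.2.1
    (funext fun z => small z 1 (by decide)) (funext fun z => small z 2 (by decide))
    (funext fun z => small z 0 (by decide)) (fun z => key z 3) (fun z => key z 5)
    (fun z => key z 4)

/-- Once the lifted forms agree with the model forms, the three coefficients left open agree too, as
the values of these forms on dual vectors. -/
theorem Lift.IsFlatCompletion.coeff_eq (h : K.IsFlatCompletion C) (q : Q) :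
    K.coeff q = liftMatrix (K.sheet q) (K.model.X q) (K.model.Y q) (K.model.a q)
      (K.model.p q) (K.model.q q) (K.model.m q) (K.model.n q) := by
  have hm := ModelCoords.sum_liftMatrix_smul (a := K.model.a) (p := K.model.p) (q := K.model.q)
    (m := K.model.m) (n := K.model.n) h.sheet_eventually_eq K.smooth_proj q
  change ∀ i : Fin 6, ∑ j, liftMatrix (K.sheet q) (K.model.X q) (K.model.Y q) (K.model.a q)
    (K.model.p q) (K.model.q q) (K.model.m q) (K.model.n q) i j • pullback K.proj (flatForm j) q
    = ![K.model.theta 3 q, K.model.theta 0 q, K.model.theta 1 q, K.model.theta 2 q,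
        K.model.Omega 2 q, K.model.Omega 1 q] i at hm
  obtain ⟨e1, e2, -⟩ := h.eq_model
  rw [e1, e2] at hm
  obtain ⟨e, he⟩ := h.exists_dual q
  ext i j
  have h1 : K.form i q (e j) = K.coeff q i j := by
    rw [K.form_apply]
    simp [he]
  have h2 : ![K.theta 3 q, K.theta 0 q, K.theta 1 q, K.theta 2 q, K.Omega C 2 q, K.Omega C 1 q] i
      = K.form i q := by
    fin_cases i <;> rfl
  rw [← h1, ← h2, ← hm]
  have hsum : ∀ g : Fin 6 → ℝ,
      (∑ j, g j • pullback (n := 11) K.proj (flatForm j) q : EuclideanSpace ℝ (Fin 11) →L[ℝ] ℝ)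
        (e j) = ∑ k, g k * pullback (n := 11) K.proj (flatForm k) q (e j) := fun g =>
    sum_apply _ _ _
  refine (hsum _).trans ?_
  have he' : ∀ i j, pullback K.proj (flatForm i) q (e j) = if i = j then 1 else 0 := he
  simp [he']

end FlatLift

/-! ### Lifts defined by model coordinates -/

theorem linearIndependent_of_eq_sum {V : Type*} [AddCommGroup V] [Module ℝ V] {ι : Type*}
    [Fintype ι] [DecidableEq ι] {G : Matrix ι ι ℝ} (hG : G.det ≠ 0) {x y : ι → V}
    (h : ∀ i, y i = ∑ j, G i j • x j) (hy : LinearIndependent ℝ y) : LinearIndependent ℝ x := by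
  rw [Fintype.linearIndependent_iff] at hy ⊢
  intro c hc
  have hu : IsUnit G.det := hG.isUnit
  have h1 : ∑ i, Matrix.vecMul c G⁻¹ i • y i = 0 := by
    simp only [h, Finset.smul_sum, smul_smul]
    rw [Finset.sum_comm]
    simp only [← Finset.sum_smul]
    have h2 : ∀ j, ∑ i, Matrix.vecMul c G⁻¹ i * G i j = c j := by
      intro j
      have := congrFun (Matrix.vecMul_vecMul c G⁻¹ G) j
      rwa [Matrix.nonsing_inv_mul _ hu, Matrix.vecMul_one] at this
    simp only [h2, hc]
  have h2 := hy _ h1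
  have h3 : Matrix.vecMul (Matrix.vecMul c G⁻¹) G = c := by
    rw [Matrix.vecMul_vecMul, Matrix.nonsing_inv_mul _ hu, Matrix.vecMul_one]
  rw [show Matrix.vecMul c G⁻¹ = 0 from funext h2, Matrix.zero_vecMul] at h3
  exact fun i => (congrFun h3 i).symm

section Construction

variable {Q : Type*} [TopologicalSpace Q] [ChartedSpace (EuclideanSpace ℝ (Fin 11)) Q]

/-- The completion by the model forms. -/
def ModelCoords.completion (c : ModelCoords Q) : Fin 5 → OneForm 11 Q :=
  ![c.Omega 0, c.Omega 3, c.Omega 4, c.Omega 5, c.A]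

variable [IsManifold (𝓡 11) ∞ Q] {M : Type*} [TopologicalSpace M]
  [ChartedSpace (EuclideanSpace ℝ (Fin 6)) M] [IsManifold (𝓡 6) ∞ M]

/-- Model coordinates over a map which pulls the flat structure back to a given one define a lift
with a flat completion. -/
theorem exists_lift_of_model (S : Structure123 M) {proj : Q → M}
    (hproj : ContMDiff (𝓡 11) (𝓡 6) ∞ proj) {ε : Q → Bool} {F : Q → EuclideanSpace ℝ (Fin 6)}
    {a p q m n : Q → ℝ} (hε : ∀ z, ∀ᶠ z' in nhds z, ε z' = ε z)
    (hF : ContMDiff (𝓡 11) (𝓡 6) ∞ F)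
    (hc : (ModelCoords.ofBase ε F a p q m n).IsAdmissible)
    (hi : (ModelCoords.ofBase ε F a p q m n).IsIndependent) {G : Q → Matrix (Fin 6) (Fin 6) ℝ}
    (hG : ∀ z, IsParaCRMatrix (G z))
    (h : ∀ z i, pullback (n := 11) F (flatForm i) z
      = ∑ j, G z i j • pullback (n := 11) proj (S.form j) z) :
    ∃ L : Lift S Q, L.proj = proj ∧
      (∀ z, L.coeff z = liftMatrix (ε z) (bif ε z then F z 0 else F z 1)
        (bif ε z then F z 1 else F z 0) (a z) (p z) (q z) (m z) (n z) * G z) ∧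
      L.IsFlatCompletion (ModelCoords.ofBase ε F a p q m n).completion := by
  set c := ModelCoords.ofBase ε F a p q m n with hcdef
  set l : Q → Matrix (Fin 6) (Fin 6) ℝ := fun z => liftMatrix (ε z) (bif ε z then F z 0 else F z 1)
    (bif ε z then F z 1 else F z 0) (a z) (p z) (q z) (m z) (n z) with hl
  have hl' : ∀ z, IsParaCRMatrix (l z) := fun z =>
    isParaCRMatrix_liftMatrix _ _ _ _ _ (hc.a_ne z) (hc.p_ne z) (hc.q_ne z)
  set ρ : Fin 6 → OneForm 11 Q :=
    ![c.theta 3, c.theta 0, c.theta 1, c.theta 2, c.Omega 2, c.Omega 1] with hρdef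
  have hρ : ∀ z i, ρ i z = ∑ j, (l z * G z) i j • pullback (n := 11) proj (S.form j) z := by
    intro z i
    have h1 := ModelCoords.sum_liftMatrix_smul (a := a) (p := p) (q := q) (m := m) (n := n) hε hF z i
    have h2 : ρ i z = ![c.theta 3 z, c.theta 0 z, c.theta 1 z, c.theta 2 z, c.Omega 2 z,
        c.Omega 1 z] i := by
      fin_cases i <;> rfl
    refine h2.trans (h1.symm.trans ?_)
    simp only [h, Finset.smul_sum, smul_smul, Matrix.mul_apply, Finset.sum_smul]
    exact Finset.sum_comm
  have hρs : ∀ i, IsSmooth (ρ i) := by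
    intro i
    fin_cases i
    exacts [hc.isSmooth_theta 3, hc.isSmooth_theta 0, hc.isSmooth_theta 1, hc.isSmooth_theta 2,
      hc.isSmooth_Omega 2, hc.isSmooth_Omega 1]
  have hρi : ∀ z, LinearIndependent ℝ fun i => ρ i z := by
    intro z
    let σ : Fin 6 → Fin 4 ⊕ Fin 6 ⊕ Unit :=
      ![Sum.inl 3, Sum.inl 0, Sum.inl 1, Sum.inl 2, Sum.inr (Sum.inl 2), Sum.inr (Sum.inl 1)]
    have hσ : Function.Injective σ := by decide
    convert (hi.linearIndependent hc z).comp σ hσ using 1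
    funext i
    fin_cases i <;> rfl
  -- The matrices `G` are only given pointwise. Independence of the pulled back forms makes the
  -- coefficients of the smooth model forms smooth all the same.
  have hpi : ∀ z, LinearIndependent ℝ fun j => pullback (n := 11) proj (S.form j) z := fun z =>
    linearIndependent_of_eq_sum ((hl' z).mul (hG z)).2 (hρ z) (hρi z)
  let L : Lift S Q :=
    { proj := proj
      coeff := fun z => l z * G z
      smooth_proj := hproj
      smooth_coeff := fun i j => contMDiff_coefficient
        (fun j => (S.smooth j).pullback hproj) hpi (hρs i) (fun z => hρ z i) j
      isParaCRMatrix := fun z => (hl' z).mul (hG z) }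
  have hform : ∀ i, L.form i = ρ i := fun i => funext fun z => (hρ z i).symm
  have hθ : L.theta = c.theta := by
    funext i
    fin_cases i
    exacts [hform 1, hform 2, hform 3, hform 0]
  have hΩ : L.Omega c.completion = c.Omega := by
    funext μ
    fin_cases μ
    exacts [rfl, hform 5, hform 4, rfl, rfl, rfl]
  have hA : c.completion 4 = c.A := rfl
  refine ⟨L, rfl, fun _ => rfl, ?_, ?_, ?_⟩
  · intro i
    fin_cases i
    exacts [hc.isSmooth_Omega 0, hc.isSmooth_Omega 3, hc.isSmooth_Omega 4, hc.isSmooth_Omega 5,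
      hc.isSmooth_A]
  · rw [hθ, hΩ, hA]
    exact hi.linearIndependent hc
  · rw [hθ, hΩ, hA]
    exact (flatEquations_iff hc.isSmooth_Omega hc.isSmooth_A).2 hc.explicitFlat

end Construction

/-! ### Model coordinates on sheets -/

/-- The projection of `ℝ¹¹` to the first six coordinates. -/
def baseMap : EuclideanSpace ℝ (Fin 11) →L[ℝ] EuclideanSpace ℝ (Fin 6) :=
  LinearMap.toContinuousLinearMap
    { toFun := fun u => WithLp.toLp 2 fun k => u (Fin.castLE (by simp) k)
      map_add' := fun _ _ => rfl
      map_smul' := fun _ _ => rfl }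

namespace Sheets

variable {I : Type*} {U : I → TopologicalSpace.Opens (EuclideanSpace ℝ (Fin 11))}

/-- The model coordinates on sheets over `ℝ¹¹`. -/
def model (ε : I → Bool) : ModelCoords (Sheets 11 U) :=
  ModelCoords.ofBase (fun z => ε z.idx) (fun z => baseMap z.pt) (fun z => z.pt 6)
    (fun z => z.pt 7) (fun z => z.pt 8) (fun z => z.pt 9) (fun z => z.pt 10)

theorem idx_eventually_eq (z : Sheets 11 U) : ∀ᶠ z' in nhds z, z'.idx = z.idx :=
  (isOpen_idx_eq {z.idx}).mem_nhds rfl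

theorem contMDiff_baseMap_pt :
    ContMDiff (𝓡 11) (𝓡 6) ∞ (fun z : Sheets 11 U => baseMap z.pt) :=
  baseMap.contDiff.contMDiff.comp contMDiff_pt

theorem model_isAdmissible (ε : I → Bool) (hU : ∀ i, ∀ u ∈ U i, u 6 ≠ 0 ∧ u 7 ≠ 0 ∧ u 8 ≠ 0) :
    (model ε : ModelCoords (Sheets 11 U)).IsAdmissible :=
  ModelCoords.ofBase_isAdmissible
    (fun z => (idx_eventually_eq z).mono fun _ hz' => by rw [hz']) contMDiff_baseMap_pt
    (contMDiff_coord 6) (contMDiff_coord 7) (contMDiff_coord 8) (contMDiff_coord 9)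
    (contMDiff_coord 10) (fun z => (hU _ _ z.pt_mem).1) (fun z => (hU _ _ z.pt_mem).2.1)
    (fun z => (hU _ _ z.pt_mem).2.2)

theorem model_isIndependent (ε : I → Bool) :
    (model ε : ModelCoords (Sheets 11 U)).IsIndependent := by
  intro z v hX hY h0 h1 h2 h3 ha hp hq hm hn
  have hε : ∀ z : Sheets 11 U, ∀ᶠ z' in nhds z, ε z'.idx = ε z.idx := fun z =>
    (idx_eventually_eq z).mono fun _ hz' => by rw [hz']
  have hX' := (diff_cond hε (fun z => z.pt 0) (fun z => z.pt 1) z v).symm.trans hX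
  have hY' := (diff_cond hε (fun z => z.pt 1) (fun z => z.pt 0) z v).symm.trans hY
  have h1' := (diff_cond hε (fun z => z.pt 3) (fun z => z.pt 4) z v).symm.trans h1
  have h2' := (diff_cond hε (fun z => z.pt 4) (fun z => z.pt 3) z v).symm.trans h2
  refine eq_zero_of_diff_coord z fun k => ?_
  cases hb : ε z.idx
  · rw [hb, cond_false] at hX' hY' h1' h2'
    fin_cases k
    exacts [hY', hX', h0, h2', h1', h3, ha, hp, hq, hm, hn]
  · rw [hb, cond_true] at hX' hY' h1' h2'
    fin_cases k
    exacts [hX', hY', h0, h1', h2', h3, ha, hp, hq, hm, hn]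

end Sheets

/-! ### The maximal lift of the flat structure -/

/-- Rigidity for two coframes with the same lifted forms, with all three ambiguity functions equal
to 0. -/
theorem Lift.IsFlatCompletion.unique {M : Type*} [TopologicalSpace M]
    [ChartedSpace (EuclideanSpace ℝ (Fin 6)) M] [IsManifold (𝓡 6) ∞ M] {S : Structure123 M}
    {Q : Type*} [TopologicalSpace Q] [ChartedSpace (EuclideanSpace ℝ (Fin 11)) Q]
    [IsManifold (𝓡 11) ∞ Q] {K : Lift S Q} {B B' : Fin 5 → OneForm 11 Q}
    (h : K.IsFlatCompletion B) (h' : K.IsFlatCompletion B') : B' = B := by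
  have hz : ∀ {η : OneForm 11 Q} q, η q = η q + (fun _ : Q => (0 : ℝ)) q • K.theta 3 q := by
    intro η q
    simp
  obtain ⟨-, hΩ, hA⟩ := h.smoothFlat.rigid h'.smoothFlat h.2.1 rfl rfl rfl hz hz hz
  funext i
  fin_cases i
  exacts [congrFun hΩ 0, congrFun hΩ 3, congrFun hΩ 4, congrFun hΩ 5, hA]

theorem isParaCRMatrix_one : IsParaCRMatrix 1 := by
  refine isParaCRMatrix_iff.2 ⟨fun i j hij => Matrix.one_apply_ne ?_, by simp⟩
  rintro rfl
  exact absurd hij (by revert i; decide)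

/-- The domain of the coordinates on each of the two sheets of the maximal lift. -/
def modelDomain : TopologicalSpace.Opens (EuclideanSpace ℝ (Fin 11)) where
  carrier := {u | u 6 ≠ 0 ∧ u 7 ≠ 0 ∧ u 8 ≠ 0}
  is_open' := by
    have h : ∀ k : Fin 11, IsOpen {u : EuclideanSpace ℝ (Fin 11) | u k ≠ 0} := fun k =>
      isOpen_ne_fun (by fun_prop) continuous_const
    exact (h 6).inter ((h 7).inter (h 8))

/-- The 11-manifold of the maximal lift of the flat structure. -/
abbrev FlatBundle : Type := Sheets 11 fun _ : Bool => modelDomain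

/-- The coordinates of a point of the maximal lift in terms of its base point and its para-CR
matrix. -/
def lambdaCoords (x : EuclideanSpace ℝ (Fin 6)) (G : Matrix (Fin 6) (Fin 6) ℝ) :
    EuclideanSpace ℝ (Fin 11) :=
  WithLp.toLp 2 ![x 0, x 1, x 2, x 3, x 4, x 5, G 0 0, G 1 1 + G 1 2, G 2 1 + G 2 2,
    G 1 0 * (G 1 1 + G 1 2)⁻¹, G 2 0 * (G 2 1 + G 2 2)⁻¹]

theorem continuousAt_lambdaCoords {z : EuclideanSpace ℝ (Fin 6) × Matrix (Fin 6) (Fin 6) ℝ}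
    (hp : z.2 1 1 + z.2 1 2 ≠ 0) (hq : z.2 2 1 + z.2 2 2 ≠ 0) :
    ContinuousAt (fun z : EuclideanSpace ℝ (Fin 6) × Matrix (Fin 6) (Fin 6) ℝ =>
      lambdaCoords z.1 z.2) z := by
  have hx : ∀ k : Fin 6, Continuous fun z : EuclideanSpace ℝ (Fin 6) × Matrix (Fin 6) (Fin 6) ℝ =>
      z.1 k := fun k => by fun_prop
  have hG : ∀ i j : Fin 6, Continuous
      fun z : EuclideanSpace ℝ (Fin 6) × Matrix (Fin 6) (Fin 6) ℝ => z.2 i j := fun i j =>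
    continuous_snd.matrix_elem i j
  have hpc := (hG 1 1).add (hG 1 2)
  have hqc := (hG 2 1).add (hG 2 2)
  refine (PiLp.continuous_toLp 2 _).continuousAt.comp (continuousAt_pi.2 fun k => ?_)
  fin_cases k
  exacts [(hx 0).continuousAt, (hx 1).continuousAt, (hx 2).continuousAt, (hx 3).continuousAt,
    (hx 4).continuousAt, (hx 5).continuousAt, (hG 0 0).continuousAt, hpc.continuousAt,
    hqc.continuousAt, (hG 1 0).continuousAt.mul (hpc.continuousAt.inv₀ hp),
    (hG 2 0).continuousAt.mul (hqc.continuousAt.inv₀ hq)]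

theorem liftMatrix_sums (ε : Bool) (X Y a p q m n : ℝ) :
    liftMatrix ε X Y a p q m n 0 0 = a ∧
    liftMatrix ε X Y a p q m n 1 1 + liftMatrix ε X Y a p q m n 1 2 = p ∧
    liftMatrix ε X Y a p q m n 2 1 + liftMatrix ε X Y a p q m n 2 2 = q ∧
    liftMatrix ε X Y a p q m n 1 0 = p * m ∧ liftMatrix ε X Y a p q m n 2 0 = q * n := by
  cases ε <;> simp [liftMatrix]

/-- Base point and matrix together recover the coordinates on either sheet: `lambdaCoords` is a left
inverse, used for the embedding and for the definition of maps into the maximal lift. -/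
theorem lambdaCoords_liftMatrix (u : EuclideanSpace ℝ (Fin 11)) (hp : u 7 ≠ 0) (hq : u 8 ≠ 0)
    (ε : Bool) (X Y : ℝ) : lambdaCoords (baseMap u)
      (liftMatrix ε X Y (u 6) (u 7) (u 8) (u 9) (u 10)) = u := by
  obtain ⟨h0, h1, h2, h3, h4⟩ := liftMatrix_sums ε X Y (u 6) (u 7) (u 8) (u 9) (u 10)
  ext k
  fin_cases k
  · rfl
  · rfl
  · rfl
  · rfl
  · rfl
  · rfl
  · exact h0
  · exact h1
  · exact h2
  · change liftMatrix ε X Y (u 6) (u 7) (u 8) (u 9) (u 10) 1 0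
      * (liftMatrix ε X Y (u 6) (u 7) (u 8) (u 9) (u 10) 1 1 + _)⁻¹ = u 9
    rw [h1, h3]
    field_simp
  · change liftMatrix ε X Y (u 6) (u 7) (u 8) (u 9) (u 10) 2 0
      * (liftMatrix ε X Y (u 6) (u 7) (u 8) (u 9) (u 10) 2 1 + _)⁻¹ = u 10
    rw [h2, h4]
    field_simp

/-- The flat structure has a lift to the two sheets given by the model coordinates. -/
theorem exists_flatLift : ∃ L : Lift flatModel FlatBundle, (∀ z, L.proj z = baseMap z.pt) ∧
    (∀ z, L.coeff z = liftMatrix z.idx (bif z.idx then baseMap z.pt 0 else baseMap z.pt 1)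
        (bif z.idx then baseMap z.pt 1 else baseMap z.pt 0) (z.pt 6) (z.pt 7) (z.pt 8) (z.pt 9)
        (z.pt 10)) ∧
    L.IsFlatCompletion (Sheets.model id : ModelCoords FlatBundle).completion := by
  obtain ⟨L, h1, h2, h3⟩ := exists_lift_of_model (G := fun _ => 1) flatModel
    (Sheets.contMDiff_baseMap_pt (U := fun _ : Bool => modelDomain))
    (fun z => (Sheets.idx_eventually_eq z).mono fun _ hz' => by rw [hz'])
    Sheets.contMDiff_baseMap_pt (Sheets.model_isAdmissible id fun _ _ hu => hu)
    (Sheets.model_isIndependent id) (fun _ => isParaCRMatrix_one) (fun z i => by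
      simp only [Matrix.one_apply, ite_smul, one_smul, zero_smul, Finset.sum_ite_eq,
        Finset.mem_univ, if_true]
      rfl)
  exact ⟨L, congrFun h1, fun z => (h2 z).trans (Matrix.mul_one _), h3⟩

/-! ### The maximal lift as a submanifold of ℝ⁶ × G₀. -/

section FlatLift

/-- The lift of the flat structure to the flat bundle is the one given by the coordinates. -/
structure Lift.IsStandard (L : Lift flatModel FlatBundle) : Prop where
  proj_eq : ∀ z, L.proj z = baseMap z.pt
  coeff_eq : ∀ z, L.coeff z = liftMatrix z.idx
    (bif z.idx then baseMap z.pt 0 else baseMap z.pt 1)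
    (bif z.idx then baseMap z.pt 1 else baseMap z.pt 0) (z.pt 6) (z.pt 7) (z.pt 8) (z.pt 9)
    (z.pt 10)

variable {L : Lift flatModel FlatBundle}

theorem Lift.IsStandard.surjective (h : L.IsStandard) : Function.Surjective L.proj := by
  intro x
  refine ⟨Sheets.mk true (WithLp.toLp 2 ![x 0, x 1, x 2, x 3, x 4, x 5, 1, 1, 1, 0, 0])
    ⟨one_ne_zero, one_ne_zero, one_ne_zero⟩, ?_⟩
  rw [h.proj_eq]
  ext k
  fin_cases k <;> rfl

theorem Lift.IsStandard.lambdaCoords_eq_pt (h : L.IsStandard) (z : FlatBundle) :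
    lambdaCoords (L.proj z) (L.coeff z) = z.pt := by
  rw [h.proj_eq, h.coeff_eq]
  exact lambdaCoords_liftMatrix _ z.pt_mem.2.1 z.pt_mem.2.2 _ _ _

theorem Lift.IsStandard.idx_iff (h : L.IsStandard) (z : FlatBundle) : (z.idx = true ↔ L.coeff z 4 5 ≠ 0) ∧
    (z.idx = false ↔ L.coeff z 4 4 ≠ 0) := by
  have ha := z.pt_mem.1
  have hq := z.pt_mem.2.2
  rw [h.coeff_eq]
  cases z.idx <;> simp [liftMatrix, ha, hq]

/-- The coordinates are a continuous function of base point and matrix near the image. The sheet is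
detected by the nonvanishing of the entry (4,4) or (4,5), which are open conditions. -/
theorem Lift.IsStandard.isEmbedding (h : L.IsStandard) :
    Topology.IsEmbedding fun z => (L.proj z, L.coeff z) := by
  have hpt := h.lambdaCoords_eq_pt
  have hidx := h.idx_iff
  refine ⟨Topology.isInducing_iff_nhds.2 fun z => le_antisymm ?_ ?_, fun z z' hz => ?_⟩
  · refine Filter.tendsto_iff_comap.1 ?_
    exact L.smooth_proj.continuous.continuousAt.prodMk
      (continuous_matrix fun i j => (L.smooth_coeff i j).continuous).continuousAt
  · rw [Sheets.nhds_eq]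
    refine le_inf ?_ ?_
    · have hs := liftMatrix_sums z.idx (bif z.idx then baseMap z.pt 0 else baseMap z.pt 1)
        (bif z.idx then baseMap z.pt 1 else baseMap z.pt 0) (z.pt 6) (z.pt 7) (z.pt 8) (z.pt 9)
        (z.pt 10)
      rw [← h.coeff_eq] at hs
      have hc := continuousAt_lambdaCoords (z := (L.proj z, L.coeff z))
        (by rw [hs.2.1]; exact z.pt_mem.2.1) (by rw [hs.2.2.1]; exact z.pt_mem.2.2)
      have hc' : Filter.Tendsto (fun w : EuclideanSpace ℝ (Fin 6) × Matrix (Fin 6) (Fin 6) ℝ =>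
          lambdaCoords w.1 w.2) (nhds (L.proj z, L.coeff z)) (nhds z.pt) := by
        rw [← hpt z]
        exact hc
      refine (Filter.comap_mono (Filter.tendsto_iff_comap.1 hc')).trans ?_
      rw [Filter.comap_comap]
      exact (congrArg (Filter.comap · (nhds z.pt)) (funext hpt)).le
    · rw [Filter.le_principal_iff]
      have hopen : ∀ j : Fin 6, IsOpen
          {w : EuclideanSpace ℝ (Fin 6) × Matrix (Fin 6) (Fin 6) ℝ | w.2 4 j ≠ 0} := fun j =>
        isOpen_ne_fun (continuous_snd.matrix_elem 4 j) continuous_const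
      cases hb : z.idx
      · exact ⟨_, (hopen 4).mem_nhds ((hidx z).2.1 hb), fun w hw => (hidx w).2.2 hw⟩
      · exact ⟨_, (hopen 5).mem_nhds ((hidx z).1.1 hb), fun w hw => (hidx w).1.2 hw⟩
  · have e1 : L.proj z = L.proj z' := congrArg Prod.fst hz
    have e2 : L.coeff z = L.coeff z' := congrArg Prod.snd hz
    refine Sheets.ext_of_eq ?_ ?_
    · have := (hidx z).1.trans ((e2 ▸ Iff.rfl : _ ↔ _).trans (hidx z').1.symm)
      exact Bool.eq_iff_iff.2 this
    · rw [← hpt z, ← hpt z', e1, e2]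

end FlatLift

/-! ### The map from a completed lift to the maximal one. -/

section Maximality

variable {L : Lift flatModel FlatBundle} {Q : Type*} [TopologicalSpace Q]
  [ChartedSpace (EuclideanSpace ℝ (Fin 11)) Q] [IsManifold (𝓡 11) ∞ Q] {K : Lift flatModel Q}
  {C : Fin 5 → OneForm 11 Q}

theorem Lift.IsFlatCompletion.exists_map_to_flatBundle (h : K.IsFlatCompletion C) :
    ∃ F : Q → FlatBundle, ∀ q, (F q).idx = K.sheet q ∧
      (F q).pt = lambdaCoords (K.proj q) (K.coeff q) :=
  ⟨fun q => Sheets.mk (K.sheet q) (lambdaCoords (K.proj q) (K.coeff q))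
    (h.coeff_eq_liftMatrix q).1, fun _ => ⟨rfl, rfl⟩⟩

theorem Lift.IsFlatCompletion.contMDiff_map (h : K.IsFlatCompletion C) {F : Q → FlatBundle}
    (hF : ∀ q, (F q).idx = K.sheet q ∧ (F q).pt = lambdaCoords (K.proj q) (K.coeff q)) :
    ContMDiff (𝓡 11) (𝓡 11) ∞ F := by
  have hm := h.model_isAdmissible
  refine Sheets.contMDiff_of_pt ?_ fun q => (h.sheet_eventually_eq q).mono fun q' hq' => by
    rw [(hF q).1, (hF q').1, hq']
  rw [show (fun q => (F q).pt) = fun q => lambdaCoords (K.proj q) (K.coeff q) from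
    funext fun q => (hF q).2]
  have hx : ∀ k : Fin 6, ContMDiff (𝓡 11) 𝓘(ℝ) ∞ fun q => K.proj q k := fun k =>
    contMDiff_coord_comp K.smooth_proj k
  refine (PiLp.contDiff_toLp (𝕜 := ℝ) (p := 2)).contMDiff.comp (contMDiff_pi_space.2 fun k => ?_)
  fin_cases k
  exacts [hx 0, hx 1, hx 2, hx 3, hx 4, hx 5, hm.a, hm.p, hm.q, hm.m,
    hm.n]

/-- The map is given by the coordinates of `K.model`, so it pulls the model forms back to those of
`K`, which are the completed coframe of `K`. A pullback of forms that is a coframe forces the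
derivative to be injective. -/
theorem Lift.IsFlatCompletion.exists_localDiffeomorph (h : K.IsFlatCompletion C)
    (hL : L.IsStandard) :
    ∃ F : Q → FlatBundle, IsLocalDiffeomorph (𝓡 11) (𝓡 11) ∞ F ∧
      (∀ q, L.proj (F q) = K.proj q) ∧ (∀ q, L.coeff (F q) = K.coeff q) ∧
      ∀ i, pullback F ((Sheets.model id : ModelCoords FlatBundle).completion i) = C i := by
  obtain ⟨F, hF⟩ := h.exists_map_to_flatBundle
  have hFs := h.contMDiff_map hF
  have hb : ∀ q, baseMap (F q).pt = K.proj q := by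
    intro q
    rw [(hF q).2]
    ext k
    fin_cases k <;> rfl
  have hcomp : (Sheets.model id : ModelCoords FlatBundle).comp F = K.model := by
    have hpt : ∀ k q, (F q).pt k = lambdaCoords (K.proj q) (K.coeff q) k := fun k q => by
      rw [(hF q).2]
    have hc : ∀ (i j : Fin 6) q,
        (bif (F q).idx then baseMap (F q).pt i else baseMap (F q).pt j) =
          bif K.sheet q then K.proj q i else K.proj q j := fun i j q => by rw [(hF q).1, hb]
    have hb' : ∀ k q, baseMap (F q).pt k = K.proj q k := fun k q => by rw [hb]
    simp only [ModelCoords.comp, Lift.model, ModelCoords.ofBase, ModelCoords.mk.injEq]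
    exact ⟨funext (hc 0 1), funext (hc 1 0), funext (hb' 2), funext (hc 3 4), funext (hc 4 3),
      funext (hb' 5), funext (hpt 6), funext (hpt 7), funext (hpt 8), funext (hpt 9),
      funext (hpt 10)⟩
  have hadm : (Sheets.model id : ModelCoords FlatBundle).IsAdmissible :=
    Sheets.model_isAdmissible id fun _ _ hu => hu
  obtain ⟨eθ, eΩ, eA⟩ := h.eq_model
  have pθ := fun i => ModelCoords.pullback_theta hadm hFs i
  have pΩ := fun i => ModelCoords.pullback_Omega hadm hFs i
  have pA := ModelCoords.pullback_A hadm hFs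
  rw [hcomp, eθ] at pθ
  rw [hcomp, eΩ] at pΩ
  rw [hcomp, eA] at pA
  refine ⟨F, ?_, fun q => (hL.proj_eq _).trans (hb q), fun q => ?_, fun i => ?_⟩
  · refine isLocalDiffeomorph_of_mfderiv_injective hFs fun q => ?_
    refine (injective_iff_map_eq_zero _).2 fun v hv => ?_
    have hk : ∀ η : OneForm 11 FlatBundle, pullback F η q v = 0 := by
      intro η
      change η (F q) (mfderiv (𝓡 11) (𝓡 11) F q v) = 0
      rw [hv, map_zero]
    refine (linearIndependent_iff_forall_eq_zero (by simp)).1 (h.2.1 q) v ?_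
    rintro (i | μ | -)
    · exact (congrArg (fun η : OneForm 11 Q => η q v) (pθ i)).symm.trans (hk _)
    · exact (congrArg (fun η : OneForm 11 Q => η q v) (pΩ μ)).symm.trans (hk _)
    · exact (congrArg (fun η : OneForm 11 Q => η q v) pA).symm.trans (hk _)
  · rw [hL.coeff_eq, h.coeff_eq q, ← hcomp, (hF q).1.symm]
    rfl
  · fin_cases i
    exacts [pΩ 0, pΩ 3, pΩ 4, pΩ 5, pA]

end Maximality

theorem exists_flat_maximal_lift :
    ∃ (P : Type) (_ : TopologicalSpace P) (_ : T2Space P) (_ : SecondCountableTopology P)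
        (_ : ChartedSpace (EuclideanSpace ℝ (Fin 11)) P) (_ : IsManifold (𝓡 11) ∞ P)
        (L : Lift flatModel P) (B : Fin 5 → OneForm 11 P),
      Function.Surjective L.proj ∧
      Topology.IsEmbedding (fun q => (L.proj q, L.coeff q)) ∧
      L.IsFlatCompletion B ∧
      (∀ B' : Fin 5 → OneForm 11 P, L.IsFlatCompletion B' → B' = B) ∧
      (∀ (Q : Type u) [TopologicalSpace Q] [ChartedSpace (EuclideanSpace ℝ (Fin 11)) Q]
          [IsManifold (𝓡 11) ∞ Q] (K : Lift flatModel Q) (C : Fin 5 → OneForm 11 Q),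
        K.IsFlatCompletion C →
          ∃! F : Q → P, IsLocalDiffeomorph (𝓡 11) (𝓡 11) ∞ F ∧
            (∀ q, L.proj (F q) = K.proj q) ∧ (∀ q, L.coeff (F q) = K.coeff q) ∧
            ∀ i, pullback F (B i) = C i) := by
  obtain ⟨L, h1, h2, hL⟩ := exists_flatLift
  have hs : L.IsStandard := ⟨h1, h2⟩
  refine ⟨FlatBundle, inferInstance, inferInstance, inferInstance, inferInstance, inferInstance, L,
    _, hs.surjective, hs.isEmbedding, hL, fun _ => hL.unique, ?_⟩
  intro Q _ _ _ K C h
  obtain ⟨F, hF⟩ := h.exists_localDiffeomorph hs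
  -- Uniqueness needs only compatibility with the maps to ℝ⁶ × G₀, because the embedding is
  -- injective.
  refine ⟨F, hF, fun F' hF' => funext fun q => hs.isEmbedding.injective ?_⟩
  exact Prod.ext ((hF'.2.1 q).trans (hF.2.1 q).symm) ((hF'.2.2.1 q).trans (hF.2.2.1 q).symm)

/-! ### Lifts of locally flat structures -/

section LocallyFlat

variable {M : Type v} [TopologicalSpace M] [ChartedSpace (EuclideanSpace ℝ (Fin 6)) M]

/-- The forms of a structure that is equivalent to the flat one by `Φ`, pulled back under a map
through `Φ`. -/
theorem pullback_flatForm_of_eventuallyEq {S : Structure123 M}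
    {Φ : OpenPartialHomeomorph M (EuclideanSpace ℝ (Fin 6))}
    (hΦ : ContMDiffOn (𝓡 6) (𝓡 6) ∞ Φ Φ.source) {Q : Type*} [TopologicalSpace Q]
    [ChartedSpace (EuclideanSpace ℝ (Fin 11)) Q] {proj : Q → M} {F : Q → EuclideanSpace ℝ (Fin 6)}
    {z : Q} (hp : MDifferentiableAt (𝓡 11) (𝓡 6) proj z) (hz : proj z ∈ Φ.source)
    (hF : F =ᶠ[nhds z] Φ ∘ proj) {G : Matrix (Fin 6) (Fin 6) ℝ}
    (hG : ∀ i, pullback Φ (flatForm i) (proj z) = ∑ j, G i j • S.form j (proj z)) (i : Fin 6) :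
    pullback (n := 11) F (flatForm i) z
      = ∑ j, G i j • pullback (n := 11) proj (S.form j) z := by
  have h1 : MDifferentiableAt (𝓡 6) (𝓡 6) Φ (proj z) :=
    ((hΦ.contMDiffAt (Φ.open_source.mem_nhds hz)).mdifferentiableAt (by simp))
  have h2 : ∀ v : TangentSpace (𝓡 11) z, (mfderiv (𝓡 11) (𝓡 6) F z v : EuclideanSpace ℝ (Fin 6)) =
      mfderiv (𝓡 6) (𝓡 6) Φ (proj z) (mfderiv (𝓡 11) (𝓡 6) proj z v) := by
    intro v
    have e1 := ((h1.hasMFDerivAt.comp z hp.hasMFDerivAt).congr_of_eventuallyEq hF).mfderiv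
    exact congrArg (fun L : EuclideanSpace ℝ (Fin 11) →L[ℝ] EuclideanSpace ℝ (Fin 6) => L v) e1
  refine ContinuousLinearMap.ext fun v => ?_
  have h3 := congrArg (fun L : EuclideanSpace ℝ (Fin 6) →L[ℝ] ℝ =>
    L (mfderiv (𝓡 11) (𝓡 6) proj z v)) (hG i)
  have e0 : F z = Φ (proj z) := hF.eq_of_nhds
  have h4 : pullback (n := 11) F (flatForm i) z v
      = (pullback Φ (flatForm i) (proj z) : EuclideanSpace ℝ (Fin 6) →L[ℝ] ℝ)
        (mfderiv (𝓡 11) (𝓡 6) proj z v) := by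
    change (flatForm i (F z) : EuclideanSpace ℝ (Fin 6) →L[ℝ] ℝ) (mfderiv (𝓡 11) (𝓡 6) F z v) =
      (flatForm i (Φ (proj z)) : EuclideanSpace ℝ (Fin 6) →L[ℝ] ℝ) _
    rw [← e0]
    exact congrArg _ (h2 v)
  refine (h4.trans h3).trans ?_
  have hs : ∀ (g : Fin 6 → ℝ) (x : Fin 6 → EuclideanSpace ℝ (Fin 6) →L[ℝ] ℝ)
      (L : EuclideanSpace ℝ (Fin 11) →L[ℝ] EuclideanSpace ℝ (Fin 6)) v,
      (∑ j, g j • x j) (L v) = (∑ j, g j • (x j).comp L) v := by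
    intro g x L v
    simp
  exact hs (G i) (fun j => S.form j (proj z)) (mfderiv (𝓡 11) (𝓡 6) proj z) v

variable [SecondCountableTopology M] [IsManifold (𝓡 6) ∞ M]

/-- Over the image of each local equivalence a part of one sheet of the model is pulled back, and
the parts are taken disjointly. No gluing is needed, since the lift only has to cover `M`. -/
theorem Structure123.LocallyEquivalent.exists_lift {S : Structure123 M}
    (h : S.LocallyEquivalent flatModel) :
    ∃ (P : Type v) (_ : TopologicalSpace P) (_ : T2Space P) (_ : SecondCountableTopology P)
      (_ : ChartedSpace (EuclideanSpace ℝ (Fin 11)) P) (_ : IsManifold (𝓡 11) ∞ P)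
      (L : Lift S P) (B : Fin 5 → OneForm 11 P),
      Function.Surjective L.proj ∧ L.IsFlatCompletion B := by
  choose Φ hmem hs hs' G hG using h
  -- Countably many equivalences suffice, which keeps the disjoint union second countable.
  obtain ⟨s, hsc, hcov⟩ := TopologicalSpace.countable_cover_nhds fun p =>
    (Φ p).open_source.mem_nhds (hmem p)
  have : Countable s := hsc.to_subtype
  let U : s → TopologicalSpace.Opens (EuclideanSpace ℝ (Fin 11)) := fun i =>
    modelDomain ⊓ ⟨baseMap ⁻¹' (Φ i).target, (Φ i).open_target.preimage baseMap.continuous⟩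
  have hU : ∀ z : Sheets 11 U, baseMap z.pt ∈ (Φ z.idx).target := fun z => z.pt_mem.2
  let proj : Sheets 11 U → M := fun z => (Φ z.idx).symm (baseMap z.pt)
  have hps : ∀ z, proj z ∈ (Φ z.idx).source := fun z => (Φ z.idx).map_target (hU z)
  have hproj : ContMDiff (𝓡 11) (𝓡 6) ∞ proj := by
    intro z
    have h1 : ContMDiffAt (𝓡 6) (𝓡 6) ∞ (Φ z.idx).symm (baseMap z.pt) :=
      (hs' z.idx).contMDiffAt ((Φ z.idx).open_target.mem_nhds (hU z))
    refine (h1.comp z (Sheets.contMDiff_baseMap_pt z)).congr_of_eventuallyEq ?_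
    filter_upwards [Sheets.idx_eventually_eq z] with z' hz'
    change (Φ z'.idx).symm _ = (Φ z.idx).symm _
    rw [hz']
  obtain ⟨L, h1, -, h3⟩ := exists_lift_of_model (G := fun z => G z.idx (proj z) (hps z)) S hproj
    (ε := fun _ => true) (fun _ => .of_forall fun _ => rfl) Sheets.contMDiff_baseMap_pt
    (Sheets.model_isAdmissible (U := U) (fun _ => true) fun _ _ hu => hu.1)
    (Sheets.model_isIndependent (fun _ => true)) (fun z => (hG _ _ _).1) (fun z i => by
      refine pullback_flatForm_of_eventuallyEq (hs z.idx)
        (hproj.mdifferentiable (by simp) z) (hps z) ?_ (hG _ _ _).2 i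
      filter_upwards [Sheets.idx_eventually_eq z] with z' hz'
      change _ = Φ z.idx ((Φ z'.idx).symm (baseMap z'.pt))
      rw [← hz']
      exact ((Φ z'.idx).right_inv (hU z')).symm)
  refine ⟨Sheets 11 U, inferInstance, inferInstance, inferInstance, inferInstance, inferInstance,
    L, _, fun x => ?_, h3⟩
  obtain ⟨p, hp, hx⟩ := Set.mem_iUnion₂.1 (hcov.symm ▸ Set.mem_univ x : x ∈ ⋃ x ∈ s, (Φ x).source)
  let y := Φ p x
  let u : EuclideanSpace ℝ (Fin 11) :=
    WithLp.toLp 2 ![y 0, y 1, y 2, y 3, y 4, y 5, 1, 1, 1, 0, 0]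
  have hu : baseMap u = y := by
    ext k
    fin_cases k <;> rfl
  refine ⟨Sheets.mk ⟨p, hp⟩ u ⟨⟨one_ne_zero, one_ne_zero, one_ne_zero⟩, ?_⟩, ?_⟩
  · change baseMap u ∈ (Φ p).target
    rw [hu]
    exact (Φ p).map_source hx
  · rw [h1]
    change (Φ p).symm (baseMap u) = x
    rw [hu]
    exact (Φ p).left_inv hx

end LocallyFlat

/-! ### Parallel sections of flat systems on manifolds -/

section Parallel

open Metric

variable {n : ℕ} {Q : Type*} [TopologicalSpace Q] [ChartedSpace (EuclideanSpace ℝ (Fin n)) Q]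

/-! ### Linear systems whose coefficients are 1-forms. -/

section System

variable {E F : Type*} [NormedAddCommGroup E] [NormedSpace ℝ E] [NormedAddCommGroup F]
  [NormedSpace ℝ F] {k : ℕ}

theorem contDiffAt_smulRight {η : E → E →L[ℝ] ℝ} {x : E} (h : ContDiffAt ℝ ∞ η x) (y : F) :
    ContDiffAt ℝ ∞ (fun x => (η x).smulRight y) x :=
  (((ContinuousLinearMap.smulRightL ℝ E F).flip y).contDiff.contDiffAt (x := η x)).comp x h

theorem hasFDerivAt_smulRight {η : E → E →L[ℝ] ℝ} {x : E} (h : DifferentiableAt ℝ η x) (y : F) :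
    HasFDerivAt (fun x => (η x).smulRight y)
      (((ContinuousLinearMap.smulRightL ℝ E F).flip y).comp (fderiv ℝ η x)) x :=
  (((ContinuousLinearMap.smulRightL ℝ E F).flip y).hasFDerivAt (x := η x)).comp x h.hasFDerivAt

/-- The endomorphisms `∑ i j, c i j v • R i j` depending linearly on `v`, for a matrix `c` of
linear forms. -/
def systemOfForms (R : Fin k → Fin k → F →L[ℝ] F) (c : Fin k → Fin k → E →L[ℝ] ℝ) :
    E →L[ℝ] F →L[ℝ] F :=
  ∑ j, ∑ i, (c j i).smulRight (R j i)

theorem systemOfForms_apply (R : Fin k → Fin k → F →L[ℝ] F)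
    (c : Fin k → Fin k → E →L[ℝ] ℝ) (v : E) (f : F) :
    systemOfForms R c v f = ∑ j, ∑ i, c j i v • R j i f := by
  simp [systemOfForms, sum_apply]

theorem contDiffAt_systemOfForms (R : Fin k → Fin k → F →L[ℝ] F)
    {c : E → Fin k → Fin k → E →L[ℝ] ℝ} {x : E} (hc : ∀ j i, ContDiffAt ℝ ∞ (fun x => c x j i) x) :
    ContDiffAt ℝ ∞ (fun x => systemOfForms R (c x)) x :=
  ContDiffAt.sum fun j _ => ContDiffAt.sum fun i _ => contDiffAt_smulRight (hc j i) (R j i)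

theorem fderiv_systemOfForms (R : Fin k → Fin k → F →L[ℝ] F)
    {c : E → Fin k → Fin k → E →L[ℝ] ℝ} {x : E}
    (hc : ∀ j i, DifferentiableAt ℝ (fun x => c x j i) x) (u : E) :
    fderiv ℝ (fun x => systemOfForms R (c x)) x u
      = systemOfForms R (fun j i => fderiv ℝ (fun x => c x j i) x u) := by
  have h : HasFDerivAt (fun x => systemOfForms R (c x)) _ x :=
    HasFDerivAt.fun_sum fun j _ => HasFDerivAt.fun_sum fun i _ =>
      hasFDerivAt_smulRight (hc j i) (R j i)
  rw [h.fderiv]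
  simp only [systemOfForms, sum_apply, ContinuousLinearMap.comp_apply]
  rfl

end System

/-- The elementary endomorphisms of `ℝᵏ`. -/
def elementaryEnd (k : ℕ) (j i : Fin k) : EuclideanSpace ℝ (Fin k) →L[ℝ] EuclideanSpace ℝ (Fin k) :=
  (EuclideanSpace.proj j : EuclideanSpace ℝ (Fin k) →L[ℝ] ℝ).smulRight (EuclideanSpace.single i 1)

theorem systemOfForms_elementaryEnd_apply {E : Type*} [NormedAddCommGroup E] [NormedSpace ℝ E]
    {k : ℕ} (c : Fin k → Fin k → E →L[ℝ] ℝ) (v : E) (f : EuclideanSpace ℝ (Fin k)) (i : Fin k) :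
    systemOfForms (elementaryEnd k) c v f i = ∑ j, f j * c j i v := by
  rw [systemOfForms_apply]
  simp [elementaryEnd, Finset.sum_apply, Pi.single_apply, mul_comm]

variable [IsManifold (𝓡 n) ∞ Q]

/-- The inverse chart has surjective derivative, so no tangent vector is missed. -/
theorem eq_of_inChart_eq {η η' : OneForm n Q}
    {e : OpenPartialHomeomorph Q (EuclideanSpace ℝ (Fin n))}
    (he : e ∈ atlas (EuclideanSpace ℝ (Fin n)) Q) {q : Q} (hq : q ∈ e.source)
    (h : inChart η e (e q) = inChart η' e (e q)) : η q = η' q := by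
  have : IsManifold (𝓡 n) 1 Q := IsManifold.of_le (n := ∞) (by simp)
  have hs := (mdifferentiable_of_mem_atlas (I := 𝓡 n) he).symm.mfderiv_surjective
    (e.map_source hq)
  have key : ∀ q' : Q, q' = e.symm (e q) → η q' = η' q' := by
    rintro _ rfl
    refine ContinuousLinearMap.ext fun v => ?_
    obtain ⟨w, rfl⟩ := hs v
    exact congrArg (fun L : EuclideanSpace ℝ (Fin n) →L[ℝ] ℝ => L w) h
  exact key q (e.left_inv hq).symm

/-- The system is df = fW for a row f. Its integrability condition f (dW + W ∧ W) = 0 is the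
flatness of W, and a chart reduces it to `exists_flat_solution`. -/
theorem exists_parallel {k : ℕ} {W : Fin k → Fin k → OneForm n Q} (hW : ∀ i j, IsSmooth (W i j))
    (flat : ∀ i j q, ∀ v w : TangentSpace (𝓡 n) q,
      extD (W i j) q v w + ∑ l, wedge (W i l) (W l j) q v w = 0) (q₀ : Q) (f₀ : Fin k → ℝ) :
    ∃ U : Set Q, IsOpen U ∧ q₀ ∈ U ∧ ∃ f : Fin k → Q → ℝ, (∀ i, f i q₀ = f₀ i) ∧
      (∀ i, ContMDiffOn (𝓡 n) 𝓘(ℝ) ∞ (f i) U) ∧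
      ∀ q ∈ U, ∀ i, ∀ v : TangentSpace (𝓡 n) q, diff (f i) q v = ∑ j, f j q * W j i q v := by
  set e := chart n q₀ with he
  have hm : e ∈ atlas (EuclideanSpace ℝ (Fin n)) Q := chart_mem_atlas _ _
  set u₀ := e q₀
  -- The chart is translated so that the base point becomes the origin, from which the rays start.
  set c : EuclideanSpace ℝ (Fin n) → Fin k → Fin k → EuclideanSpace ℝ (Fin n) →L[ℝ] ℝ :=
    fun x i j => inChart (W i j) e (x + u₀) with hc
  set s : Set (EuclideanSpace ℝ (Fin n)) := (fun x => x + u₀) ⁻¹' e.target with hs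
  have hcont : Continuous fun x : EuclideanSpace ℝ (Fin n) => x + u₀ := by fun_prop
  have hs0 : s ∈ nhds 0 := (e.open_target.preimage hcont).mem_nhds (by
    change 0 + u₀ ∈ e.target
    rw [zero_add]
    exact mem_chart_target _ _)
  have hcd : ∀ x ∈ s, ∀ i j, ContDiffAt ℝ ∞ (fun x => c x i j) x := fun x hx i j =>
    ((hW i j).contDiffAt hm hx).comp x (contDiffAt_id.add contDiffAt_const)
  have hfd : ∀ x, ∀ i j, fderiv ℝ (fun x => c x i j) x
      = fderiv ℝ (inChart (W i j) e) (x + u₀) := fun x i j =>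
    fderiv_comp_add_right (f := inChart (W i j) e) u₀
  obtain ⟨r, hr, hrs, g, hg0, hgs, hg⟩ := exists_flat_solution
    (Λ := fun x => systemOfForms (elementaryEnd k) (c x)) hs0
    (fun x hx => (contDiffAt_systemOfForms _ (hcd x hx)).contDiffWithinAt)
    (fun x hx u v f => by
      rw [fderiv_systemOfForms _ (fun _ _ => (hcd x hx _ _).differentiableAt (by simp)),
        fderiv_systemOfForms _ (fun _ _ => (hcd x hx _ _).differentiableAt (by simp))]
      ext i
      simp only [PiLp.add_apply, PiLp.sub_apply, systemOfForms_elementaryEnd_apply, PiLp.zero_apply, hfd]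
      have h2 : ∀ l, fderiv ℝ (inChart (W l i) e) (x + u₀) u v
          - fderiv ℝ (inChart (W l i) e) (x + u₀) v u
          + ∑ j, (c x l j u * c x j i v - c x l j v * c x j i u) = 0 := by
        intro l
        rw [← extD_eq_inChart (hW l i) hm hx]
        exact flat l i _ _ _
      have h3 : ∀ u v, ∑ j, (∑ l, f l * c x l j u) * c x j i v
          = ∑ l, f l * ∑ j, c x l j u * c x j i v := by
        intro u v
        simp only [Finset.sum_mul, Finset.mul_sum]
        rw [Finset.sum_comm]
        exact Finset.sum_congr rfl fun _ _ => Finset.sum_congr rfl fun _ _ => by ring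
      rw [h3, h3, ← Finset.sum_sub_distrib, ← Finset.sum_add_distrib, ← Finset.sum_sub_distrib]
      refine Finset.sum_eq_zero fun l _ => ?_
      have h4 := h2 l
      rw [Finset.sum_sub_distrib] at h4
      linear_combination f l * h4) (WithLp.toLp 2 f₀)
  have hsub : ∀ q ∈ e.source ∩ e ⁻¹' ball u₀ r, e q - u₀ ∈ ball (0 : EuclideanSpace ℝ (Fin n)) r :=
    fun q hq => by simpa [dist_eq_norm] using hq.2
  refine ⟨e.source ∩ e ⁻¹' ball u₀ r, e.isOpen_inter_preimage isOpen_ball,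
    ⟨mem_chart_source _ _, mem_ball_self hr⟩, fun i q => g (e q - u₀) i, fun i => ?_,
    fun i q hq => ?_, fun q hq i v => ?_⟩
  · simp only [u₀, sub_self, hg0]
  · have h1 : ContMDiffAt (𝓡 n) (𝓡 n) ∞ (fun q => e q - u₀) q :=
      (contDiff_id.sub contDiff_const).contMDiff.contMDiffAt.comp q
        (contMDiffAt_of_mem_maximalAtlas (IsManifold.subset_maximalAtlas hm) hq.1)
    have h2 : ContDiffAt ℝ ∞ (fun x => g x i) (e q - u₀) :=
      (EuclideanSpace.proj i : EuclideanSpace ℝ (Fin k) →L[ℝ] ℝ).contDiff.contDiffAt.comp _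
        (hgs.contDiffAt (isOpen_ball.mem_nhds (hsub q hq)))
    exact (h2.contMDiffAt.comp q h1).contMDiffWithinAt
  · have hq1 := e.map_source hq.1
    have hd : HasFDerivAt (fun x => g x i) _ (e q - u₀) :=
      (EuclideanSpace.proj i : EuclideanSpace ℝ (Fin k) →L[ℝ] ℝ).hasFDerivAt.comp _
        (hg _ (hsub q hq))
    have hd' : HasFDerivAt (fun z => g (z - u₀) i) _ (e q) :=
      HasFDerivAt.comp (e q) (g := fun x => g x i) (f := fun z => z - u₀) hd ((hasFDerivAt_id _).sub_const u₀)
    have hd'' := hd'.congr_of_eventuallyEq (f₁ := (fun q => g (e q - u₀) i) ∘ e.symm) (by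
      filter_upwards [e.open_target.mem_nhds hq1] with z hz
      simp only [Function.comp_apply, e.right_inv hz])
    have hmd : MDifferentiableAt (𝓡 n) 𝓘(ℝ) (fun q => g (e q - u₀) i) q := by
      have h1 : ContMDiffAt (𝓡 n) (𝓡 n) ∞ (fun q => e q - u₀) q :=
        (contDiff_id.sub contDiff_const).contMDiff.contMDiffAt.comp q
          (contMDiffAt_of_mem_maximalAtlas (IsManifold.subset_maximalAtlas hm) hq.1)
      have h2 : ContDiffAt ℝ ∞ (fun x => g x i) (e q - u₀) :=
        (EuclideanSpace.proj i : EuclideanSpace ℝ (Fin k) →L[ℝ] ℝ).contDiff.contDiffAt.comp _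
          (hgs.contDiffAt (isOpen_ball.mem_nhds (hsub q hq)))
      exact (h2.contMDiffAt.comp q h1).mdifferentiableAt (by simp)
    have hic := inChart_diff hm hq1 (f := fun q => g (e q - u₀) i) (by rwa [e.left_inv hq.1])
    have heq : diff (fun q => g (e q - u₀) i) q
        = (fun p => ∑ j, g (e p - u₀) j • W j i p : OneForm n Q) q := by
      refine eq_of_inChart_eq (η := diff (fun q => g (e q - u₀) i))
        (η' := fun p => ∑ j, g (e p - u₀) j • W j i p) hm hq.1 ?_
      rw [hic, hd''.fderiv]
      refine ContinuousLinearMap.ext fun w => ?_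
      have hsum : ∀ (a : Fin k → ℝ) (b : Fin k → EuclideanSpace ℝ (Fin n) →L[ℝ] ℝ) w,
          (∑ j, a j • b j) w = ∑ j, a j * b j w := fun a b w => by simp [sum_apply]
      refine Eq.trans ?_ (hsum _ _ _).symm
      simp only [ContinuousLinearMap.comp_apply, ContinuousLinearMap.flip_apply,
        PiLp.proj_apply, systemOfForms_elementaryEnd_apply, hc, sub_add_cancel]
      rw [e.right_inv hq1]
      rfl
    have hsum : ∀ (a : Fin k → ℝ),
        (∑ j, a j • W j i q : EuclideanSpace ℝ (Fin n) →L[ℝ] ℝ) v = ∑ j, a j * W j i q v :=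
      fun a => sum_apply _ _ _
    exact (congrArg (fun L : EuclideanSpace ℝ (Fin n) →L[ℝ] ℝ => L v) heq).trans (hsum _)

/-- Along rays in a chart this is a homogeneous linear ODE with zero initial value. -/
theorem eventually_eq_zero_of_diff_eq_mul {A : OneForm n Q} (hA : IsSmooth A) {f : Q → ℝ}
    {U : Set Q} (hU : IsOpen U) {q₀ : Q} (hq₀ : q₀ ∈ U) (hf : ContMDiffOn (𝓡 n) 𝓘(ℝ) ∞ f U)
    (hd : ∀ q ∈ U, ∀ v : TangentSpace (𝓡 n) q, diff f q v = f q * A q v) (h0 : f q₀ = 0) :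
    ∀ᶠ q in nhds q₀, f q = 0 := by
  set e := chart n q₀ with he
  have hm : e ∈ atlas (EuclideanSpace ℝ (Fin n)) Q := chart_mem_atlas _ _
  have hs : q₀ ∈ e.source := mem_chart_source _ _
  set u₀ := e q₀
  have hopen : IsOpen (e.target ∩ e.symm ⁻¹' U) := e.symm.isOpen_inter_preimage hU
  have hmem : u₀ ∈ e.target ∩ e.symm ⁻¹' U :=
    ⟨e.map_source hs, by simpa [u₀, e.left_inv hs] using hq₀⟩
  obtain ⟨r, hr, hrs⟩ := Metric.isOpen_iff.1 hopen u₀ hmem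
  have hsub : ∀ x ∈ ball (0 : EuclideanSpace ℝ (Fin n)) r, x + u₀ ∈ e.target ∩ e.symm ⁻¹' U :=
    fun x hx => hrs (by simpa [dist_eq_norm] using hx)
  have key := eq_zero_of_fderiv_eq_smul (f := fun x => f (e.symm (x + u₀))) (r := r)
    (A := fun x => inChart A e (x + u₀))
    (fun x hx => (((hA.contDiffAt hm (hsub x hx).1).continuousAt).comp
      (f := fun x => x + u₀) (by fun_prop)).continuousWithinAt)
    (by simpa [u₀, e.left_inv hs] using h0)
    (fun x hx => by
      obtain ⟨hx1, hx2⟩ := hsub x hx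
      have h1 : ContMDiffAt (𝓡 n) 𝓘(ℝ) ∞ f (e.symm (x + u₀)) := hf.contMDiffAt (hU.mem_nhds hx2)
      have h2 := inChart_diff hm hx1 (h1.mdifferentiableAt (by simp))
      have h3 : HasFDerivAt (f ∘ e.symm) (f (e.symm (x + u₀)) • inChart A e (x + u₀)) (x + u₀) := by
        have h4 := ((contDiffAt_comp_atlas_symm hm hx1 h1).differentiableAt (by simp)).hasFDerivAt
        rw [← h2] at h4
        have h5 : inChart (diff f) e (x + u₀) = f (e.symm (x + u₀)) • inChart A e (x + u₀) :=
          ContinuousLinearMap.ext fun w =>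
            hd _ hx2 (mfderiv (𝓡 n) (𝓡 n) e.symm (x + u₀) w)
        rwa [h5] at h4
      exact HasFDerivAt.comp x (f := fun x => x + u₀) h3 ((hasFDerivAt_id x).add_const u₀))
  filter_upwards [(e.isOpen_inter_preimage (isOpen_ball (x := u₀) (ε := r))).mem_nhds
    ⟨hs, mem_ball_self hr⟩] with q hq
  have := key (e q - u₀) (by simpa [dist_eq_norm] using hq.2)
  simpa [e.left_inv hq.1] using this

end Parallel

/-! ### Developing a flat connection -/

section Developing

variable {Q : Type*} [TopologicalSpace Q] [ChartedSpace (EuclideanSpace ℝ (Fin 11)) Q]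
  {θ : Fin 4 → OneForm 11 Q} {Ω : Fin 6 → OneForm 11 Q} {A : OneForm 11 Q}

theorem isSmooth_gamma (hΩ : ∀ i, IsSmooth (Ω i)) (hA : IsSmooth A) (i j : Fin 4) :
    IsSmooth (gamma Ω A i j) := by
  rw [gamma_eq]
  have h2 : IsSmooth ((1 / 2 : ℝ) • A) := hA.const_smul _
  fin_cases i <;> fin_cases j
  exacts [(hΩ 0).neg.add h2, isSmooth_zero, hΩ 2, hΩ 4, isSmooth_zero, (hΩ 0).add h2, hΩ 1, hΩ 3,
    (hΩ 3).neg, (hΩ 4).neg, (hΩ 5).neg.add h2, isSmooth_zero, (hΩ 1).neg, (hΩ 2).neg,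
    isSmooth_zero, (hΩ 5).add h2]

variable [IsManifold (𝓡 11) ∞ Q]

/-- A coframe satisfying the flat structure equations has parallel rows. -/
theorem exists_parallel_row (hθ : ∀ i, IsSmooth (θ i)) (hΩ : ∀ i, IsSmooth (Ω i))
    (hA : IsSmooth A) (h : FlatEquations θ Ω A) (q₀ : Q) (t₀ : Fin 4 → ℝ) :
    ∃ U : Set Q, IsOpen U ∧ q₀ ∈ U ∧ ∃ (t : Fin 4 → Q → ℝ) (x : Q → ℝ), (∀ i, t i q₀ = t₀ i) ∧
      (∀ i, ContMDiffOn (𝓡 11) 𝓘(ℝ) ∞ (t i) U) ∧ ContMDiffOn (𝓡 11) 𝓘(ℝ) ∞ x U ∧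
      ∀ q ∈ U, ∀ v : TangentSpace (𝓡 11) q,
        (∀ i, diff (t i) q v = ∑ j, t j q * gamma Ω A j i q v) ∧
        diff x q v = ∑ j, t j q * θ j q v := by
  have hΓ := isSmooth_gamma hΩ hA
  -- The affine connection matrix with rows (Γ, θ) and (0, 0): a parallel row (t, x) satisfies dt =
  -- tΓ and dx = tθ, and flatness unites the equations for Γ and for θ.
  let W : Fin 5 → Fin 5 → OneForm 11 Q :=
    Fin.snoc (α := fun _ => Fin 5 → OneForm 11 Q)
      (fun i => Fin.snoc (α := fun _ => OneForm 11 Q) (gamma Ω A i) (θ i)) (fun _ => 0)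
  have w1 : ∀ i j : Fin 4, W i.castSucc j.castSucc = gamma Ω A i j := fun i j => by
    simp only [W, Fin.snoc_castSucc]
  have w2 : ∀ i : Fin 4, W i.castSucc (Fin.last 4) = θ i := fun i => by
    simp only [W, Fin.snoc_castSucc, Fin.snoc_last]
  have w3 : ∀ j, W (Fin.last 4) j = 0 := fun j => by simp only [W, Fin.snoc_last]
  obtain ⟨U, hU, hq, f, hf0, hfs, hf⟩ := exists_parallel (W := W) (by
    intro i j
    induction i using Fin.lastCases with
    | last => rw [w3]; exact isSmooth_zero
    | cast i =>
      induction j using Fin.lastCases with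
      | last => rw [w2]; exact hθ i
      | cast j => rw [w1]; exact hΓ i j) (by
    intro i j q v w
    rw [Fin.sum_univ_castSucc]
    induction i using Fin.lastCases with
    | last =>
      simp only [w3]
      rw [(hasExtDerivAt_zero (p := q)).2]
      simp [wedge]
    | cast i =>
      have hlast : ∀ (η : OneForm 11 Q), wedge η (0 : OneForm 11 Q) q v w = 0 := fun η => by
        simp [wedge]
      rw [w3, hlast, add_zero]
      induction j using Fin.lastCases with
      | last =>
        simp only [w1, w2]
        have := congrFun (congrFun (congrFun (h.1 i) q) v) w
        simpa [Finset.sum_apply] using this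
      | cast j =>
        simp only [w1]
        have := congrFun (congrFun (congrFun (h.2 i j) q) v) w
        simpa [Finset.sum_apply] using this) q₀ (Fin.snoc (α := fun _ => ℝ) t₀ 0)
  refine ⟨U, hU, hq, fun i => f i.castSucc, f (Fin.last 4), fun i => ?_, fun i => hfs _, hfs _,
    fun q hq v => ⟨fun i => ?_, ?_⟩⟩
  · exact (hf0 _).trans (Fin.snoc_castSucc (α := fun _ => ℝ) _ _ _)
  · rw [hf q hq, Fin.sum_univ_castSucc]
    simp only [w1, w3]
    exact add_eq_left.2 (mul_zero _)
  · rw [hf q hq, Fin.sum_univ_castSucc]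
    simp only [w2, w3]
    exact add_eq_left.2 (mul_zero _)

/-- The initial value of the parallel frame. -/
def initialFrame : Matrix (Fin 4) (Fin 4) ℝ :=
  !![0, 0, 0, 1; 1, 0, 0, 0; 0, -1, 0, 0; 0, 0, 1, 0]

/-- The quadratic form `2(X⁰X³ - X¹X²)`. -/
def quadricForm : Matrix (Fin 4) (Fin 4) ℝ :=
  !![0, 0, 0, 1; 0, 0, -1, 0; 0, -1, 0, 0; 1, 0, 0, 0]

/-- Both quadratic forms are involutions as matrices. The hypothesis says that κ⁻¹Tg and Tᵗh are
inverse to each other, and multiplying them in the opposite order gives the claim. -/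
theorem transpose_mul_quadricForm_mul {T : Matrix (Fin 4) (Fin 4) ℝ} {κ : ℝ} (hκ : κ ≠ 0)
    (h : T * splitMetric * T.transpose = κ • quadricForm) :
    T.transpose * quadricForm * T = κ • splitMetric := by
  have hh : quadricForm * quadricForm = 1 := by
    ext i j
    fin_cases i <;> fin_cases j <;>
      simp [quadricForm, Matrix.mul_apply, Fin.sum_univ_four]
  have hg : splitMetric * splitMetric = 1 := by
    ext i j
    fin_cases i <;> fin_cases j <;>
      simp [splitMetric, Matrix.mul_apply, Fin.sum_univ_four]
  have h1 : (κ⁻¹ • (T * splitMetric)) * (T.transpose * quadricForm) = 1 := by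
    rw [Matrix.smul_mul, ← Matrix.mul_assoc, h, Matrix.smul_mul, hh, smul_smul,
      inv_mul_cancel₀ hκ, one_smul]
  have h2 := mul_eq_one_comm.1 h1
  rw [Matrix.mul_smul, ← Matrix.mul_assoc] at h2
  calc T.transpose * quadricForm * T
      = T.transpose * quadricForm * T * (splitMetric * splitMetric) := by rw [hg, Matrix.mul_one]
    _ = κ • (κ⁻¹ • (T.transpose * quadricForm * T * splitMetric)) * splitMetric := by
        rw [smul_smul, mul_inv_cancel₀ hκ, one_smul, Matrix.mul_assoc _ splitMetric]
    _ = κ • splitMetric := by rw [h2, Matrix.smul_mul, Matrix.one_mul]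

end Developing

/-! ### Conformal parallel frames. -/

section Developing

variable {Q : Type*} [TopologicalSpace Q] [ChartedSpace (EuclideanSpace ℝ (Fin 11)) Q]
  {θ : Fin 4 → OneForm 11 Q} {Ω : Fin 6 → OneForm 11 Q} {A : OneForm 11 Q}

theorem gamma_column_apply (Ω : Fin 6 → OneForm 11 Q) (A : OneForm 11 Q) (t : Fin 4 → ℝ) (q : Q)
    (v : TangentSpace (𝓡 11) q) :
    (∑ j, t j * gamma Ω A j 0 q v = t 0 * (-Ω 0 q v + 1 / 2 * A q v) - t 2 * Ω 3 q v - t 3 * Ω 1 q v) ∧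
    (∑ j, t j * gamma Ω A j 1 q v = t 1 * (Ω 0 q v + 1 / 2 * A q v) - t 2 * Ω 4 q v - t 3 * Ω 2 q v) ∧
    (∑ j, t j * gamma Ω A j 2 q v = t 0 * Ω 2 q v + t 1 * Ω 1 q v + t 2 * (-Ω 5 q v + 1 / 2 * A q v)) ∧
    (∑ j, t j * gamma Ω A j 3 q v = t 0 * Ω 4 q v + t 1 * Ω 3 q v + t 3 * (Ω 5 q v + 1 / 2 * A q v)) := by
  have hz : (0 : OneForm 11 Q) q v = 0 := rfl
  have hn : ∀ η : OneForm 11 Q, (-η) q v = -η q v := fun _ => rfl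
  have hp : ∀ η : OneForm 11 Q, (η + (1 / 2 : ℝ) • A) q v = η q v + 1 / 2 * A q v := fun _ => rfl
  rw [gamma_eq]
  simp only [Fin.sum_univ_four]
  refine ⟨?_, ?_, ?_, ?_⟩
  · change t 0 * (-Ω 0 + (1 / 2 : ℝ) • A) q v + t 1 * (0 : OneForm 11 Q) q v + t 2 * (-Ω 3) q v
      + t 3 * (-Ω 1) q v = _
    rw [hz, hp, hn, hn, hn]
    ring
  · change t 0 * (0 : OneForm 11 Q) q v + t 1 * (Ω 0 + (1 / 2 : ℝ) • A) q v + t 2 * (-Ω 4) q v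
      + t 3 * (-Ω 2) q v = _
    rw [hz, hp, hn, hn]
    ring
  · change t 0 * Ω 2 q v + t 1 * Ω 1 q v + t 2 * (-Ω 5 + (1 / 2 : ℝ) • A) q v
      + t 3 * (0 : OneForm 11 Q) q v = _
    rw [hz, hp, hn]
    ring
  · change t 0 * Ω 4 q v + t 1 * Ω 3 q v + t 2 * (0 : OneForm 11 Q) q v
      + t 3 * (Ω 5 + (1 / 2 : ℝ) • A) q v = _
    rw [hz, hp]
    ring

/-- The split scalar product of two rows. -/
def splitProduct (s t : Fin 4 → ℝ) : ℝ := s 0 * t 1 + s 1 * t 0 + s 2 * t 3 + s 3 * t 2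

theorem mul_splitMetric_mul_transpose_apply (T : Matrix (Fin 4) (Fin 4) ℝ) (a b : Fin 4) :
    (T * splitMetric * T.transpose) a b = splitProduct (T a) (T b) := by
  simp [Matrix.mul_apply, splitMetric, Fin.sum_univ_four, splitProduct]
  ring

/-- Γ preserves the metric up to its trace part: Γg + gΓᵗ = A g. -/
theorem diff_splitProduct {s t : Fin 4 → Q → ℝ} {q : Q}
    (hs : ∀ i, MDifferentiableAt (𝓡 11) 𝓘(ℝ) (s i) q)
    (ht : ∀ i, MDifferentiableAt (𝓡 11) 𝓘(ℝ) (t i) q) {v : TangentSpace (𝓡 11) q}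
    (hs' : ∀ i, diff (s i) q v = ∑ j, s j q * gamma Ω A j i q v)
    (ht' : ∀ i, diff (t i) q v = ∑ j, t j q * gamma Ω A j i q v) :
    diff (fun q => splitProduct (fun i => s i q) (fun i => t i q)) q v
      = splitProduct (fun i => s i q) (fun i => t i q) * A q v := by
  have hm : ∀ i j, MDifferentiableAt (𝓡 11) 𝓘(ℝ) (fun q => s i q * t j q) q := fun i j =>
    (hs i).mul (ht j)
  have e1 := diff_add_apply (((hm 0 1).add (hm 1 0)).add (hm 2 3)) (hm 3 2) v
  have e2 := diff_add_apply ((hm 0 1).add (hm 1 0)) (hm 2 3) v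
  have e3 := diff_add_apply (hm 0 1) (hm 1 0) v
  obtain ⟨s0, s1, s2, s3⟩ := gamma_column_apply Ω A (fun i => s i q) q v
  obtain ⟨t0, t1, t2, t3⟩ := gamma_column_apply Ω A (fun i => t i q) q v
  refine e1.trans ?_
  refine (congrArg (· + _) (e2.trans (congrArg (· + _) e3))).trans ?_
  simp only [diff_mul_apply (hs _) (ht _), hs', ht', s0, s1, s2, s3, t0, t1, t2, t3, splitProduct]
  ring

variable [IsManifold (𝓡 11) ∞ Q]

/-- A coframe satisfying the flat structure equations has a conformal parallel frame. -/
theorem exists_conformal_frame (hθ : ∀ i, IsSmooth (θ i)) (hΩ : ∀ i, IsSmooth (Ω i))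
    (hA : IsSmooth A) (h : FlatEquations θ Ω A) (q₀ : Q) :
    ∃ U : Set Q, IsOpen U ∧ q₀ ∈ U ∧ ∃ (T : Fin 4 → Fin 4 → Q → ℝ) (X : Fin 4 → Q → ℝ),
      (∀ a i, T a i q₀ = initialFrame a i) ∧
      (∀ a i, ContMDiffOn (𝓡 11) 𝓘(ℝ) ∞ (T a i) U) ∧
      (∀ a, ContMDiffOn (𝓡 11) 𝓘(ℝ) ∞ (X a) U) ∧
      (∀ q ∈ U, ∀ v : TangentSpace (𝓡 11) q,
        (∀ a i, diff (T a i) q v = ∑ j, T a j q * gamma Ω A j i q v) ∧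
        ∀ a, diff (X a) q v = ∑ j, T a j q * θ j q v) ∧
      ∀ q ∈ U, ∃ κ : ℝ, κ ≠ 0 ∧ ∀ i j, T 0 i q * T 3 j q + T 3 i q * T 0 j q
        - T 1 i q * T 2 j q - T 2 i q * T 1 j q = κ * splitMetric i j := by
  choose U hU hq T X hT0 hTs hXs hd using fun a : Fin 4 =>
    exists_parallel_row hθ hΩ hA h q₀ (initialFrame a)
  have hUi : IsOpen (⋂ a, U a) := isOpen_iInter_of_finite hU
  have hqi : q₀ ∈ ⋂ a, U a := Set.mem_iInter.2 hq
  have hTs' : ∀ a i, ContMDiffOn (𝓡 11) 𝓘(ℝ) ∞ (T a i) (⋂ a, U a) := fun a i =>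
    (hTs a i).mono (Set.iInter_subset _ a)
  have hTd : ∀ q ∈ ⋂ a, U a, ∀ a i, MDifferentiableAt (𝓡 11) 𝓘(ℝ) (T a i) q := fun q hq a i =>
    ((hTs' a i).contMDiffAt (hUi.mem_nhds hq)).mdifferentiableAt (by simp)
  set K : Fin 4 → Fin 4 → Q → ℝ := fun a b q =>
    splitProduct (fun i => T a i q) (fun i => T b i q) with hK
  have hKs : ∀ a b, ContMDiffOn (𝓡 11) 𝓘(ℝ) ∞ (K a b) (⋂ a, U a) := fun a b =>
    ((((hTs' a 0).mul (hTs' b 1)).add ((hTs' a 1).mul (hTs' b 0))).add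
      ((hTs' a 2).mul (hTs' b 3))).add ((hTs' a 3).mul (hTs' b 2))
  have hKd : ∀ q ∈ ⋂ a, U a, ∀ a b, MDifferentiableAt (𝓡 11) 𝓘(ℝ) (K a b) q := fun q hq a b =>
    ((hKs a b).contMDiffAt (hUi.mem_nhds hq)).mdifferentiableAt (by simp)
  have hKA : ∀ q ∈ ⋂ a, U a, ∀ a b, ∀ v : TangentSpace (𝓡 11) q,
      diff (K a b) q v = K a b q * A q v := fun q hq a b v =>
    diff_splitProduct (hTd q hq a) (hTd q hq b) (hd a q (Set.mem_iInter.1 hq a) v).1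
      (hd b q (Set.mem_iInter.1 hq b) v).1
  have hK0 : ∀ a b, K a b q₀ = quadricForm a b := by
    intro a b
    simp only [hK, hT0, splitProduct]
    fin_cases a <;> fin_cases b <;> simp [initialFrame, quadricForm]
  -- The differences solve df = fA and vanish at q₀, where T g Tᵗ is the quadratic form itself, with
  -- entry 1 at (0, 3). So all products stay proportional to it, with factor `K 0 3`.
  have hev : ∀ a b, ∀ᶠ q in nhds q₀, K a b q - quadricForm a b * K 0 3 q = 0 := by
    intro a b
    refine eventually_eq_zero_of_diff_eq_mul hA hUi hqi
      ((hKs a b).sub (contMDiffOn_const.mul (hKs 0 3))) (fun q hq v => ?_) ?_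
    · have hc : MDifferentiableAt (𝓡 11) 𝓘(ℝ) (fun _ : Q => quadricForm a b) q :=
        mdifferentiableAt_const
      refine (diff_sub_apply (hKd q hq a b) (hc.mul (hKd q hq 0 3)) v).trans ?_
      refine (congrArg (_ - ·) (diff_mul_apply hc (hKd q hq 0 3) v)).trans ?_
      rw [diff_const, hKA q hq, hKA q hq]
      ring
    · rw [hK0, hK0]
      simp [quadricForm]
  have hκ : ∀ᶠ q in nhds q₀, K 0 3 q ≠ 0 := by
    refine ((hKs 0 3).continuousOn.continuousAt (hUi.mem_nhds hqi)).eventually_ne ?_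
    rw [hK0]
    simp [quadricForm]
  obtain ⟨V, hV, hVo, hqV⟩ := eventually_nhds_iff.1 ((Filter.eventually_all.2 fun a =>
    Filter.eventually_all.2 (hev a)).and hκ)
  refine ⟨(⋂ a, U a) ∩ V, hUi.inter hVo, ⟨hqi, hqV⟩, T, X, hT0,
    fun a i => (hTs' a i).mono Set.inter_subset_left,
    fun a => (hXs a).mono (Set.inter_subset_left.trans (Set.iInter_subset _ a)),
    fun q hq v => ⟨fun a => (hd a q (Set.mem_iInter.1 hq.1 a) v).1,
      fun a => (hd a q (Set.mem_iInter.1 hq.1 a) v).2⟩, fun q hq => ⟨K 0 3 q, (hV q hq.2).2, ?_⟩⟩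
  have hm : (Matrix.of fun a i => T a i q) * splitMetric * (Matrix.of fun a i => T a i q).transpose
      = K 0 3 q • quadricForm := by
    ext a b
    rw [mul_splitMetric_mul_transpose_apply, Matrix.smul_apply, smul_eq_mul]
    have := (hV q hq.2).1 a b
    simp only [hK] at this ⊢
    rw [mul_comm]
    exact sub_eq_zero.1 this
  intro i j
  have := congrFun (congrFun (transpose_mul_quadricForm_mul (hV q hq.2).2 hm) i) j
  rw [Matrix.smul_apply, smul_eq_mul] at this
  rw [← this]
  simp [Matrix.mul_apply, quadricForm, Fin.sum_univ_four]
  ring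

end Developing

/-! ### The developing map to the flat structure. -/

section Developing

variable {M : Type*} [TopologicalSpace M] [ChartedSpace (EuclideanSpace ℝ (Fin 6)) M]
  [IsManifold (𝓡 6) ∞ M] {S : Structure123 M}
  {Q : Type*} [TopologicalSpace Q] [ChartedSpace (EuclideanSpace ℝ (Fin 11)) Q]
  [IsManifold (𝓡 11) ∞ Q] {L : Lift S Q} {B : Fin 5 → OneForm 11 Q}

/-- The coefficients of the pulled back flat forms with respect to the lifted forms, for a
conformal parallel frame `T`. -/
def developingMatrix (κ : ℝ) (T : Fin 4 → Fin 4 → ℝ) : Matrix (Fin 6) (Fin 6) ℝ :=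
  !![κ * (T 3 2)⁻¹, 0, 0, 0, 0, 0;
     T 1 3, T 1 0, T 1 1, T 1 2, 0, 0;
     T 2 3, T 2 0, T 2 1, T 2 2, 0, 0;
     T 3 3, T 3 0, T 3 1, T 3 2, 0, 0;
     0, 0, 0, 0, (T 2 2 * T 3 0 - T 2 0 * T 3 2) * ((T 3 2) ^ 2)⁻¹,
       (T 2 2 * T 3 1 - T 2 1 * T 3 2) * ((T 3 2) ^ 2)⁻¹;
     0, 0, 0, 0, (T 1 2 * T 3 0 - T 1 0 * T 3 2) * ((T 3 2) ^ 2)⁻¹,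
       (T 1 2 * T 3 1 - T 1 1 * T 3 2) * ((T 3 2) ^ 2)⁻¹]

/-- At the initial frame this is a signed permutation matrix, hence orthogonal. -/
theorem det_developingMatrix_initialFrame : (developingMatrix 1 initialFrame).det ≠ 0 := by
  have h : developingMatrix 1 initialFrame * (developingMatrix 1 initialFrame).transpose = 1 := by
    ext i j
    fin_cases i <;> fin_cases j <;>
      simp [developingMatrix, initialFrame, Matrix.mul_apply, Fin.sum_univ_six]
  exact (Matrix.isUnit_det_of_right_inverse h).ne_zero

theorem _root_.ContinuousAt.eventually_det_ne_zero {X ι : Type*} [TopologicalSpace X] [Fintype ι]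
    [DecidableEq ι] {W : X → Matrix ι ι ℝ} {x : X} (h : ContinuousAt W x) (h0 : (W x).det ≠ 0) :
    ∀ᶠ y in nhds x, (W y).det ≠ 0 :=
  h.eventually (((continuous_id.matrix_det (A := fun G : Matrix ι ι ℝ => G)).continuousAt
    (x := W x)).eventually_ne h0)

/-- A lift with a flat completion develops locally to the flat structure. -/
theorem Lift.IsFlatCompletion.exists_developing_map (h : L.IsFlatCompletion B) (q₀ : Q) :
    ∃ U : Set Q, IsOpen U ∧ q₀ ∈ U ∧ ∃ F : Q → EuclideanSpace ℝ (Fin 6),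
      ContMDiffOn (𝓡 11) (𝓡 6) ∞ F U ∧ ∀ q ∈ U, ∃ G : Matrix (Fin 6) (Fin 6) ℝ,
        IsParaCRMatrix G ∧ ∀ i, ∀ v : TangentSpace (𝓡 11) q,
          pullback (n := 11) F (flatForm i) q v = ∑ j, G i j * L.form j q v := by
  obtain ⟨U, hU, hq, T, X, hT0, hTs, hXs, hd, hκ⟩ := exists_conformal_frame L.isSmooth_theta
    (L.isSmooth_Omega h.1) (h.1 4) h.2.2 q₀
  have hTc : ∀ a i, ContinuousAt (T a i) q₀ := fun a i =>
    (hTs a i).continuousOn.continuousAt (hU.mem_nhds hq)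
  set κ : Q → ℝ := fun q => T 0 2 q * T 3 3 q + T 3 2 q * T 0 3 q - T 1 2 q * T 2 3 q
    - T 2 2 q * T 1 3 q with hκdef
  have h32 : T 3 2 q₀ ≠ 0 := by
    rw [hT0]
    simp [initialFrame]
  have hκ0 : κ q₀ = 1 := by
    simp only [hκdef, hT0]
    simp [initialFrame]
  -- Invertibility is read off at q₀ and spreads by continuity, so no closed formula for the
  -- determinant is needed.
  have hdet : ∀ᶠ q in nhds q₀, (developingMatrix (κ q) fun a i => T a i q).det ≠ 0 := by
    have hκc : ContinuousAt κ q₀ := ((((hTc 0 2).mul (hTc 3 3)).add ((hTc 3 2).mul (hTc 0 3))).sub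
      ((hTc 1 2).mul (hTc 2 3))).sub ((hTc 2 2).mul (hTc 1 3))
    have hc : ContinuousAt (fun q => developingMatrix (κ q) fun a i => T a i q) q₀ := by
      have h1 := (hTc 3 2).inv₀ h32
      have h2 := ((hTc 3 2).pow 2).inv₀ (pow_ne_zero 2 h32)
      have hm : ∀ a i, ContinuousAt (fun q => (T a 2 q * T 3 i q - T a i q * T 3 2 q)
          * ((T 3 2 q) ^ 2)⁻¹) q₀ := fun a i =>
        (((hTc a 2).mul (hTc 3 i)).sub ((hTc a i).mul (hTc 3 2))).mul h2
      refine continuousAt_pi.2 fun i => continuousAt_pi.2 fun j => ?_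
      fin_cases i <;> fin_cases j
      exacts [hκc.mul h1, continuousAt_const, continuousAt_const, continuousAt_const,
        continuousAt_const, continuousAt_const, hTc 1 3, hTc 1 0, hTc 1 1, hTc 1 2,
        continuousAt_const, continuousAt_const, hTc 2 3, hTc 2 0, hTc 2 1, hTc 2 2,
        continuousAt_const, continuousAt_const, hTc 3 3, hTc 3 0, hTc 3 1, hTc 3 2,
        continuousAt_const, continuousAt_const, continuousAt_const, continuousAt_const,
        continuousAt_const, continuousAt_const, hm 2 0, hm 2 1, continuousAt_const,
        continuousAt_const, continuousAt_const, continuousAt_const, hm 1 0, hm 1 1]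
    refine hc.eventually_det_ne_zero ?_
    rw [hκ0, show (fun a i => T a i q₀) = initialFrame from funext₂ hT0]
    exact det_developingMatrix_initialFrame
  obtain ⟨V, hV, hVo, hqV⟩ := eventually_nhds_iff.1 (((hTc 3 2).eventually_ne h32).and hdet)
  -- The X are the flat coordinates of ℝ⁴. The third column of T, the one paired with θ⁴ by the
  -- split metric, is a null vector and gives x and y as quotients of its entries.
  let F : Q → EuclideanSpace ℝ (Fin 6) := fun q => WithLp.toLp 2
    ![-T 2 2 q * (T 3 2 q)⁻¹, -T 1 2 q * (T 3 2 q)⁻¹, X 0 q, X 1 q, X 2 q, X 3 q]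
  have hsx : ∀ a, ∀ q ∈ U ∩ V, ContMDiffAt (𝓡 11) 𝓘(ℝ) ∞ (fun q => -T a 2 q * (T 3 2 q)⁻¹) q :=
    fun a q hq => by
      have h1 : ∀ a, ContMDiffAt (𝓡 11) 𝓘(ℝ) ∞ (T a 2) q := fun a =>
        (hTs a 2).contMDiffAt (hU.mem_nhds hq.1)
      have h2 : ContMDiffAt (𝓡 11) 𝓘(ℝ) ∞ (fun q => (T 3 2 q)⁻¹) q :=
        (contDiffAt_inv ℝ (hV q hq.2).1).contMDiffAt.comp q (h1 3)
      exact (h1 a).neg.mul h2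
  have hF : ∀ q ∈ U ∩ V, ContMDiffAt (𝓡 11) (𝓡 6) ∞ F q := by
    intro q hq
    refine (PiLp.contDiff_toLp (𝕜 := ℝ) (p := 2)).contMDiff.contMDiffAt.comp q
      (contMDiffAt_pi_space.2 fun k => ?_)
    have hX : ∀ a, ContMDiffAt (𝓡 11) 𝓘(ℝ) ∞ (X a) q := fun a =>
      (hXs a).contMDiffAt (hU.mem_nhds hq.1)
    fin_cases k
    exacts [hsx 2 q hq, hsx 1 q hq, hX 0, hX 1, hX 2, hX 3]
  refine ⟨U ∩ V, hU.inter hVo, ⟨hq, hqV⟩, F, fun q hq => (hF q hq).contMDiffWithinAt,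
    fun q hq => ⟨developingMatrix (κ q) fun a i => T a i q,
      ⟨⟨_, _, _, _, _, _, _, _, _, _, _, _, _, _, _, _, _, _, _, rfl⟩, (hV q hq.2).2⟩, ?_⟩⟩
  have h0 : T 3 2 q ≠ 0 := (hV q hq.2).1
  have hTm : ∀ a i, MDifferentiableAt (𝓡 11) 𝓘(ℝ) (T a i) q := fun a i =>
    ((hTs a i).contMDiffAt (hU.mem_nhds hq.1)).mdifferentiableAt (by simp)
  have hinv : MDifferentiableAt (𝓡 11) 𝓘(ℝ) (fun q => (T 3 2 q)⁻¹) q :=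
    ((contDiffAt_inv ℝ h0).contMDiffAt.comp q
      ((hTs 3 2).contMDiffAt (hU.mem_nhds hq.1))).mdifferentiableAt (by simp)
  obtain ⟨k, hk0, hk⟩ := hκ q hq.1
  have hkκ : κ q = k := by
    have := hk 2 3
    simp only [splitMetric] at this
    simpa [hκdef] using this
  suffices H : ∀ v : TangentSpace (𝓡 11) q, (fun i => pullback (n := 11) F (flatForm i) q v)
      = fun i => ∑ j, developingMatrix (κ q) (fun a i => T a i q) i j * L.form j q v from
    fun i v => congrFun (H v) i
  intro v
  have hfl := pullback_flatForm_apply ((hF q hq).mdifferentiableAt (by simp)) v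
  refine hfl.trans ?_
  have hdT : ∀ a, diff (T a 2) q v = T a 0 q * L.form 4 q v + T a 1 q * L.form 5 q v
      + T a 2 q * (-B 3 q v + 1 / 2 * B 4 q v) := fun a =>
    ((hd q hq.1 v).1 a 2).trans
      (gamma_column_apply (L.Omega B) (B 4) (fun j => T a j q) q v).2.2.1
  have hdX : ∀ a, diff (X a) q v = T a 0 q * L.form 1 q v + T a 1 q * L.form 2 q v
      + T a 2 q * L.form 3 q v + T a 3 q * L.form 0 q v := fun a =>
    ((hd q hq.1 v).2 a).trans (Fin.sum_univ_four _)
  -- The third column changes by Ω₃, Ω₂ and a multiple of itself. The multiple, which contains Ω₆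
  -- and A, cancels in a quotient of entries.
  have hdx : ∀ a, diff (fun q => -T a 2 q * (T 3 2 q)⁻¹) q v =
      (T a 2 q * T 3 0 q - T a 0 q * T 3 2 q) * ((T 3 2 q) ^ 2)⁻¹ * L.form 4 q v
      + (T a 2 q * T 3 1 q - T a 1 q * T 3 2 q) * ((T 3 2 q) ^ 2)⁻¹ * L.form 5 q v := by
    intro a
    refine (diff_mul_apply (hTm a 2).neg hinv v).trans ?_
    have e1 : diff (-T a 2) q v = -diff (T a 2) q v := diff_neg_apply (hTm a 2) v
    rw [diff_inv_apply (hTm 3 2) h0, e1, hdT, hdT, Pi.neg_apply]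
    field_simp
    ring
  have k0 := hk 2 0
  have k1 := hk 2 1
  have k2 := hk 2 2
  have k3 := hk 2 3
  simp [splitMetric] at k0 k1 k2 k3
  funext i
  fin_cases i
  · change diff (X 0) q v + (-T 2 2 q * (T 3 2 q)⁻¹) * diff (X 1) q v
      + (-T 1 2 q * (T 3 2 q)⁻¹) * diff (X 2) q v
      + ((-T 2 2 q * (T 3 2 q)⁻¹) * (-T 1 2 q * (T 3 2 q)⁻¹)) * diff (X 3) q v = _
    -- Nullity of the third column: T₀₂T₃₂ = T₁₂T₂₂. Therefore T₃₂λ is that column paired by h with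
    -- the rows of Tθ, and Tᵗ h T = κ g turns this into κθ⁴.
    have hxy : (-T 2 2 q * (T 3 2 q)⁻¹) * (-T 1 2 q * (T 3 2 q)⁻¹) = T 0 2 q * (T 3 2 q)⁻¹ := by
      field_simp
      linear_combination (-1 / 2 : ℝ) * k2
    rw [hxy]
    simp only [hdX, Fin.sum_univ_six]
    simp [developingMatrix]
    rw [hkκ]
    field_simp
    linear_combination L.form 1 q v * k0 + L.form 2 q v * k1 + L.form 3 q v * k2
      + L.form 0 q v * k3
  · change diff (X 1) q v = _
    rw [hdX, Fin.sum_univ_six]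
    simp [developingMatrix]
    ring
  · change diff (X 2) q v = _
    rw [hdX, Fin.sum_univ_six]
    simp [developingMatrix]
    ring
  · change diff (X 3) q v = _
    rw [hdX, Fin.sum_univ_six]
    simp [developingMatrix]
    ring
  · change diff (fun q => -T 2 2 q * (T 3 2 q)⁻¹) q v = _
    rw [hdx, Fin.sum_univ_six]
    simp [developingMatrix]
  · change diff (fun q => -T 1 2 q * (T 3 2 q)⁻¹) q v = _
    rw [hdx, Fin.sum_univ_six]
    simp [developingMatrix]

end Developing

/-! ### Local equivalence from a lift -/

section Pullback

variable {n m k : ℕ} {M N N' : Type*} [TopologicalSpace M]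
  [ChartedSpace (EuclideanSpace ℝ (Fin n)) M] [TopologicalSpace N]
  [ChartedSpace (EuclideanSpace ℝ (Fin m)) N] [TopologicalSpace N']
  [ChartedSpace (EuclideanSpace ℝ (Fin k)) N']

theorem pullback_comp_apply {f : N → N'} {g : M → N} {x : M}
    (hf : MDifferentiableAt (𝓡 m) (𝓡 k) f (g x)) (hg : MDifferentiableAt (𝓡 n) (𝓡 m) g x)
    (η : OneForm k N') (v : TangentSpace (𝓡 n) x) :
    pullback (n := n) (f ∘ g) η x v
      = pullback (n := m) f η (g x) (mfderiv (𝓡 n) (𝓡 m) g x v) :=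
  congrArg (fun L : EuclideanSpace ℝ (Fin n) →L[ℝ] EuclideanSpace ℝ (Fin k) =>
    (η (f (g x)) : EuclideanSpace ℝ (Fin k) →L[ℝ] ℝ) (L v)) (mfderiv_comp x hf hg)

theorem pullback_congr_apply {f g : M → N} {x : M} (h : f =ᶠ[nhds x] g) (η : OneForm m N)
    (v : TangentSpace (𝓡 n) x) : pullback (n := n) f η x v = pullback (n := n) g η x v := by
  have h1 : (mfderiv (𝓡 n) (𝓡 m) f x : EuclideanSpace ℝ (Fin n) →L[ℝ] EuclideanSpace ℝ (Fin m))
      = mfderiv (𝓡 n) (𝓡 m) g x := h.mfderiv_eq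
  have h2 : ∀ y y' : N, y = y' → (η y : EuclideanSpace ℝ (Fin m) →L[ℝ] ℝ) = η y' := by
    rintro y _ rfl
    rfl
  change (η (f x) : EuclideanSpace ℝ (Fin m) →L[ℝ] ℝ)
    ((mfderiv (𝓡 n) (𝓡 m) f x : EuclideanSpace ℝ (Fin n) →L[ℝ] EuclideanSpace ℝ (Fin m)) v) = _
  rw [h1, h2 _ _ h.eq_of_nhds]
  rfl

theorem pullback_id_apply (η : OneForm n M) (x : M) (v : TangentSpace (𝓡 n) x) :
    pullback (n := n) id η x v = η x v :=
  congrArg (fun L : EuclideanSpace ℝ (Fin n) →L[ℝ] EuclideanSpace ℝ (Fin n) =>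
    (η x : EuclideanSpace ℝ (Fin n) →L[ℝ] ℝ) (L v)) mfderiv_id

theorem pullback_apply_eq_zero {f : M → N} {x : M} {v : TangentSpace (𝓡 n) x}
    (h : mfderiv (𝓡 n) (𝓡 m) f x v = 0) (η : OneForm m N) : pullback (n := n) f η x v = 0 :=
  (congrArg (η (f x)) h).trans (map_zero _)

variable [IsManifold (𝓡 m) ∞ N]

/-- There are local parametrizations through a point of a manifold with prescribed derivative. -/
theorem exists_slice (q₀ : N) (l : EuclideanSpace ℝ (Fin n) →L[ℝ] EuclideanSpace ℝ (Fin m))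
    {U : Set N} (hU : IsOpen U) (hq₀ : q₀ ∈ U) :
    ∃ (D : Set (EuclideanSpace ℝ (Fin n))) (j : EuclideanSpace ℝ (Fin n) → N), IsOpen D ∧ 0 ∈ D ∧
      j 0 = q₀ ∧ (∀ s ∈ D, j s ∈ U) ∧ (∀ s ∈ D, ContMDiffAt (𝓡 n) (𝓡 m) ∞ j s) ∧
      ∀ (η : OneForm m N) (v : EuclideanSpace ℝ (Fin n)),
        pullback (n := n) (M := EuclideanSpace ℝ (Fin n)) j η 0 v
          = (η q₀ : EuclideanSpace ℝ (Fin m) →L[ℝ] ℝ) (l v) := by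
  set e := chart m q₀ with he
  have hm : e ∈ atlas (EuclideanSpace ℝ (Fin m)) N := chart_mem_atlas _ _
  have hs : q₀ ∈ e.source := mem_chart_source _ _
  let a : EuclideanSpace ℝ (Fin n) → EuclideanSpace ℝ (Fin m) := fun s => e q₀ + l s
  have ha0 : a 0 = e q₀ := by simp [a]
  have hac : ContDiff ℝ ∞ a := contDiff_const.add l.contDiff
  have hj : ∀ s ∈ a ⁻¹' e.target, ContMDiffAt (𝓡 n) (𝓡 m) ∞ (e.symm ∘ a) s := fun s hs =>
    (contMDiffAt_symm_of_mem_maximalAtlas (I := 𝓡 m) (IsManifold.subset_maximalAtlas hm) hs).comp s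
      hac.contMDiff.contMDiffAt
  have hj0 : (e.symm ∘ a) 0 = q₀ := by
    change e.symm (a 0) = q₀
    rw [ha0, e.left_inv hs]
  refine ⟨a ⁻¹' (e.target ∩ e.symm ⁻¹' U), e.symm ∘ a,
    (e.symm.isOpen_inter_preimage hU).preimage hac.continuous, ⟨?_, ?_⟩, hj0, fun s hs => hs.2,
    fun s hs => hj s hs.1, fun η v => ?_⟩
  · rw [ha0]
    exact e.map_source hs
  · change (e.symm ∘ a) 0 ∈ U
    rwa [hj0]
  · have ht : a 0 ∈ e.target := by
      rw [ha0]
      exact e.map_source hs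
    have h1 : mfderiv (𝓡 n) (𝓡 m) a 0 = l := by
      rw [mfderiv_eq_fderiv]
      exact (l.hasFDerivAt.const_add (e q₀)).fderiv
    have h2 : MDifferentiableAt (𝓡 n) (𝓡 m) a 0 :=
      (hac.differentiable (by simp)).differentiableAt.mdifferentiableAt
    refine (pullback_comp_apply (mdifferentiableAt_chart_symm hm ht) h2 η v).trans ?_
    rw [h1]
    change inChart η e (a 0) (l v) = _
    rw [ha0, inChart_chart_apply]
    rfl

end Pullback

/-! ### The local equivalence obtained from a 6-dimensional slice. -/

section Equivalence

variable {M : Type*} [TopologicalSpace M] [ChartedSpace (EuclideanSpace ℝ (Fin 6)) M]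
  [IsManifold (𝓡 6) ∞ M] {S : Structure123 M}
  {Q : Type*} [TopologicalSpace Q] [ChartedSpace (EuclideanSpace ℝ (Fin 11)) Q]
  [IsManifold (𝓡 11) ∞ Q] {L : Lift S Q} {B : Fin 5 → OneForm 11 Q}

/-- On a slice through q₀ to which the six lifted forms restrict as a coframe at the centre, the
projection to `M` and the developing map both have injective derivative there, because each relates
its pulled back forms to the lifted ones by an invertible matrix. -/
theorem Lift.IsFlatCompletion.locallyEquivalent (h : L.IsFlatCompletion B)
    (hsurj : Function.Surjective L.proj) : S.LocallyEquivalent flatModel := by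
  intro p
  obtain ⟨q₀, rfl⟩ := hsurj p
  obtain ⟨U, hU, hq₀, F, hF, hG⟩ := h.exists_developing_map q₀
  obtain ⟨u, hu⟩ := h.exists_dual_form q₀
  let u' : Fin 6 → EuclideanSpace ℝ (Fin 11) := u
  -- The slice is tangent to the vectors dual to the lifted forms, so these restrict at its centre
  -- to the standard coordinate forms.
  let l : EuclideanSpace ℝ (Fin 6) →L[ℝ] EuclideanSpace ℝ (Fin 11) :=
    ∑ k, (EuclideanSpace.proj k : EuclideanSpace ℝ (Fin 6) →L[ℝ] ℝ).smulRight (u' k)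
  have hl : ∀ i v, (L.form i q₀ : EuclideanSpace ℝ (Fin 11) →L[ℝ] ℝ) (l v) = v i := by
    intro i v
    have e1 : ∀ η : EuclideanSpace ℝ (Fin 11) →L[ℝ] ℝ, η (l v) = ∑ k, v k * η (u' k) :=
      fun η => by simp [l, sum_apply]
    have e2 : ∀ k, (L.form i q₀ : EuclideanSpace ℝ (Fin 11) →L[ℝ] ℝ) (u' k)
        = if i = k then 1 else 0 := hu i
    refine (e1 _).trans
      ((Finset.sum_congr rfl fun k _ => congrArg (v k * ·) (e2 k)).trans ?_)
    simp
  obtain ⟨D, j, hD, h0D, hj0, hjU, hj, hjl⟩ := exists_slice q₀ l hU hq₀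
  have hjm : ∀ s ∈ D, MDifferentiableAt (𝓡 6) (𝓡 11) j s := fun s hs =>
    (hj s hs).mdifferentiableAt (by simp)
  have hFm : ∀ s ∈ D, MDifferentiableAt (𝓡 11) (𝓡 6) F (j s) := fun s hs =>
    (hF.contMDiffAt (hU.mem_nhds (hjU s hs))).mdifferentiableAt (by simp)
  have hpm : ∀ q, MDifferentiableAt (𝓡 11) (𝓡 6) L.proj q := L.smooth_proj.mdifferentiable (by simp)
  have hφ : ContMDiffOn (𝓡 6) (𝓡 6) ∞ (L.proj ∘ j) D := fun s hs =>
    ((L.smooth_proj (j s)).comp s (hj s hs)).contMDiffWithinAt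
  have hψ : ContMDiffOn (𝓡 6) (𝓡 6) ∞ (F ∘ j) D := fun s hs =>
    ((hF.contMDiffAt (hU.mem_nhds (hjU s hs))).comp s (hj s hs)).contMDiffWithinAt
  have hrel1 : ∀ s ∈ D, ∀ (v : TangentSpace (𝓡 6) s) i, pullback (n := 6) j (L.form i) s v
      = ∑ k, L.coeff (j s) i k * pullback (n := 6) (L.proj ∘ j) (S.form k) s v := by
    intro s hs v i
    refine (L.form_apply i (j s) (mfderiv (𝓡 6) (𝓡 11) j s v)).trans ?_
    exact Finset.sum_congr rfl fun k _ => congrArg _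
      (pullback_comp_apply (hpm (j s)) (hjm s hs) (S.form k) v).symm
  have hrel2 : ∀ s ∈ D, ∃ G : Matrix (Fin 6) (Fin 6) ℝ, IsParaCRMatrix G ∧
      ∀ (v : TangentSpace (𝓡 6) s) i, pullback (n := 6) (F ∘ j) (flatForm i) s v
        = ∑ k, G i k * pullback (n := 6) j (L.form k) s v := by
    intro s hs
    obtain ⟨G, hG1, hG2⟩ := hG (j s) (hjU s hs)
    exact ⟨G, hG1, fun v i => (pullback_comp_apply (hFm s hs) (hjm s hs) (flatForm i) v).trans
      (hG2 i _)⟩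
  have hzero : ∀ v : EuclideanSpace ℝ (Fin 6),
      (∀ i, pullback (n := 6) (M := EuclideanSpace ℝ (Fin 6)) j (L.form i) 0 v = 0) → v = 0 :=
    fun v hv => PiLp.ext fun i => (hl i v).symm.trans ((hjl (L.form i) v).symm.trans (hv i))
  obtain ⟨Φ₁, h1, hs1, e1, c1, c1'⟩ := exists_openPartialHomeomorph_of_mfderiv_injective hD h0D hφ
    ((injective_iff_map_eq_zero _).2 fun v hv => hzero v fun i => by
      rw [hrel1 0 h0D]
      exact Finset.sum_eq_zero fun k _ => by rw [pullback_apply_eq_zero hv, mul_zero])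
  obtain ⟨Φ₂, h2, hs2, e2, c2, c2'⟩ := exists_openPartialHomeomorph_of_mfderiv_injective hD h0D hψ
    ((injective_iff_map_eq_zero _).2 fun v hv => hzero v fun i => by
      obtain ⟨G, hG1, hG2⟩ := hrel2 0 h0D
      have := Matrix.eq_zero_of_mulVec_eq_zero hG1.2
        (v := fun k => pullback (n := 6) (M := EuclideanSpace ℝ (Fin 6)) j (L.form k) 0 v)
        (funext fun i => (hG2 v i).symm.trans (pullback_apply_eq_zero hv _))
      exact congrFun this i)
  have hp : Φ₁ 0 = L.proj q₀ := by
    rw [← e1 h1, Function.comp_apply, hj0]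
  -- Back from `M` to the slice, then to ℝ⁶ by the developing map. The two para-CR matrices
  -- multiply.
  refine ⟨Φ₁.symm.trans Φ₂, ?_, ?_, ?_, fun x hx => ?_⟩
  · rw [← hp]
    refine ⟨Φ₁.map_source h1, ?_⟩
    change Φ₁.symm (Φ₁ 0) ∈ Φ₂.source
    rwa [Φ₁.left_inv h1]
  · exact c2.comp (c1'.mono fun x hx => hx.1) fun x hx => hx.2
  · exact c1.comp (c2'.mono fun y hy => hy.1) fun y hy => hy.2
  · have hx1 : x ∈ Φ₁.target := hx.1
    have hx2 : Φ₁.symm x ∈ Φ₂.source := hx.2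
    have hsD : Φ₁.symm x ∈ D := hs2 hx2
    have hc : MDifferentiableAt (𝓡 6) (𝓡 6) Φ₁.symm x :=
      (c1'.contMDiffAt (Φ₁.open_target.mem_nhds hx1)).mdifferentiableAt (by simp)
    have hφm : MDifferentiableAt (𝓡 6) (𝓡 6) (L.proj ∘ j) (Φ₁.symm x) :=
      (hφ.contMDiffAt (hD.mem_nhds hsD)).mdifferentiableAt (by simp)
    have hψm : MDifferentiableAt (𝓡 6) (𝓡 6) (F ∘ j) (Φ₁.symm x) :=
      (hψ.contMDiffAt (hD.mem_nhds hsD)).mdifferentiableAt (by simp)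
    have ev1 : (L.proj ∘ j) ∘ Φ₁.symm =ᶠ[nhds x] id := by
      filter_upwards [Φ₁.open_target.mem_nhds hx1] with y hy
      exact (e1 (Φ₁.map_target hy)).trans (Φ₁.right_inv hy)
    have ev2 : Φ₁.symm.trans Φ₂ =ᶠ[nhds x] (F ∘ j) ∘ Φ₁.symm := by
      filter_upwards [(Φ₁.symm.trans Φ₂).open_source.mem_nhds hx] with y hy
      exact (e2 hy.2).symm
    obtain ⟨G, hG1, hG2⟩ := hrel2 _ hsD
    refine ⟨G * L.coeff (j (Φ₁.symm x)), hG1.mul (L.isParaCRMatrix _), fun i =>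
      ContinuousLinearMap.ext fun w => ?_⟩
    refine (pullback_congr_apply ev2 (flatForm i) w).trans ?_
    refine (pullback_comp_apply hψm hc (flatForm i) w).trans ?_
    refine (hG2 _ i).trans ?_
    have hS : ∀ k, pullback (n := 6) (L.proj ∘ j) (S.form k) (Φ₁.symm x)
        (mfderiv (𝓡 6) (𝓡 6) Φ₁.symm x w) = S.form k x w := fun k =>
      (pullback_comp_apply hφm hc (S.form k) w).symm.trans
        ((pullback_congr_apply ev1 (S.form k) w).trans (pullback_id_apply _ _ _))
    have hsum : ∀ g : Fin 6 → ℝ, (∑ k, g k • S.form k x : EuclideanSpace ℝ (Fin 6) →L[ℝ] ℝ) w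
        = ∑ k, g k * S.form k x w := fun g => sum_apply _ _ _
    refine Eq.trans ?_ (hsum _).symm
    simp only [hrel1 _ hsD, hS, Matrix.mul_apply, Finset.mul_sum, Finset.sum_mul]
    rw [Finset.sum_comm]
    simp only [mul_assoc]

end Equivalence

end ParaCR

end



theorem mainTheorem4 :
    -- The flat model: a unique maximal 11-manifold `P` with a unique completion.
    (∃ (P : Type) (_ : TopologicalSpace P) (_ : T2Space P) (_ : SecondCountableTopology P)
        (_ : ChartedSpace (EuclideanSpace ℝ (Fin 11)) P) (_ : IsManifold (𝓡 11) ∞ P)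
        (L : Lift flatModel P) (B : Fin 5 → OneForm 11 P),
      Function.Surjective L.proj ∧
      Topology.IsEmbedding (fun q => (L.proj q, L.coeff q)) ∧
      L.IsFlatCompletion B ∧
      (∀ B' : Fin 5 → OneForm 11 P, L.IsFlatCompletion B' → B' = B) ∧
      (∀ (Q : Type u) [TopologicalSpace Q] [ChartedSpace (EuclideanSpace ℝ (Fin 11)) Q]
          [IsManifold (𝓡 11) ∞ Q] (K : Lift flatModel Q) (C : Fin 5 → OneForm 11 Q),
        K.IsFlatCompletion C →
          ∃! F : Q → P, IsLocalDiffeomorph (𝓡 11) (𝓡 11) ∞ F ∧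
            (∀ q, L.proj (F q) = K.proj q) ∧ (∀ q, L.coeff (F q) = K.coeff q) ∧
            ∀ i, pullback F (B i) = C i)) ∧
    -- The characterization of the structures that are locally equivalent to the flat one.
    (∀ (M : Type v) [TopologicalSpace M] [T2Space M] [SecondCountableTopology M]
        [ChartedSpace (EuclideanSpace ℝ (Fin 6)) M] [IsManifold (𝓡 6) ∞ M] (S : Structure123 M),
      S.LocallyEquivalent flatModel ↔
        ∃ (P : Type v) (_ : TopologicalSpace P) (_ : T2Space P) (_ : SecondCountableTopology P)
          (_ : ChartedSpace (EuclideanSpace ℝ (Fin 11)) P) (_ : IsManifold (𝓡 11) ∞ P)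
          (L : Lift S P) (B : Fin 5 → OneForm 11 P),
          Function.Surjective L.proj ∧ L.IsFlatCompletion B) := by
  refine ⟨exists_flat_maximal_lift, fun M _ _ _ _ _ S => ⟨fun h => h.exists_lift, ?_⟩⟩
  rintro ⟨P, _, _, _, _, _, L, B, hsurj, hL⟩
  exact hL.locallyEquivalent hsurj
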